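/- **Setting.** Consider a massless quantum field theory in $D$ dimensions given by colour-ordered (planar) Feynman rules: finitely many bosonic or fermionic field components (ghosts count as fermionic), cyclic multilinear vertices $V_r(p_1,\dots,p_r)$, and propagators $N(p)/p^2$ whose numerator on the mass shell $p^2=0$, $p\neq 0$, is the sum over the finitely many one-particle states, $N(p)=\sum_s u_s(p)\otimes \bar u_s(-p)$. Let $\mathcal A^{(0)}$ denote the colour-ordered tree amplitudes (sums of planar tree diagrams), and let $\mathfrak I^{(1)}_n(\ell)$ be the planar one-loop integrand with ordered external legs $1,\dots,n$ ($n\ge 2$): the sum of all planar one-loop diagrams other than tadpoles and bubbles on external legs, with the loop momentum $\ell$ placed between legs $n$ and $1$, so that all loop propagators are of the form $1/(\ell+k_1+\dots+k_j)^2$. In the same way, diagrams of tadpole or external-bubble type are dropped in the tree amplitude of a forward limit. Let $k_1,\dots,k_n$ be null (complex) momenta with $\sum_i k_i=0$, let $q^2=q\cdot k_1=q\cdot k_n=0$, and let $\ell=\ell_0+\alpha q$ with $\ell_0^2=0$. Suppose that vertices and propagator numerators are polynomial along $q$, and that the wavefunctions of legs $1$ and $n$ are polynomial in $z$. Let $\mathfrak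 I^{(1)}_n(z)$ be the integrand after the shift $$k_1\to k_1+zq,\qquad k_n\to k_n-zq,\qquad \ell\to\ell_0+(\alpha-z)q .$$ For a set $I$ of consecutive legs write $K_I=\sum_{i\in I}k_i$, $n_I=|I|$, and let $z_I$ be the value of $z$ at which the shifted $K_I^2$ vanishes ($z_I=-K_I^2/(2K_I\cdot q)$ if $1\in I$). Assume generic kinematics: $\alpha\ne0$, $\ell_0\cdot q\neq 0$, the propagators of $\mathfrak I_n^{(1)}$ are finite, $K_I\cdot q\ne 0$ for all channels $I$ below, and the points $z_I$ are distinct from $\alpha$ and from each other (apart from $z_I=z_{I^c}$). For $2\le j\le n-2$ let $\Sigma_j(z)$ be the part of $\mathfrak I^{(1)}_n(z)$ in which the whole loop is a one-loop self-energy insertion into the tree propagator that separates the legs $1,\dots,j$ from $j+1,\dots,n$ (this part contains the square of that propagator), and let $z_j=z_{\{1,\dots,j\}}$. **Claim.** The boundary term $\mathcal B_n=-\oint_{z=\infty}\frac{dz}{2\pi i\,z}\,\mathfrak I^{(1)}_n(z)$ exists, and if no $\Sigma_j$ has a pole at $z_j$, then $$\mathfrak I^{(1)}_n=\sum_{I}\sum_{\text{states}_I}\mathcal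 A^{(0)}_{n_I+1}(z_I)\,\frac1{K_I^2}\,\mathfrak I^{(1)}_{n-n_I+1}(z_I)+\frac1{\ell^2}\sum_{\text{states}_0}\mathcal A^{(0)}_{n+2}\big(\ell_0,k_1+\alpha q,k_2,\dots,k_{n-1},k_n-\alpha q,-\ell_0\big)+\mathcal B_n ,$$ where $I$ runs over the sets $\{1,\dots,j\}$ and $\{j+1,\dots,n\}$ with $2\le j\le n-2$, i.e. the planar channels that contain exactly one of the legs $1$ and $n$; the loop momentum of $\mathfrak I^{(1)}_{n-n_I+1}(z_I)$ is $\ell_0+(\alpha-z_I)q$; and the sum over $\text{states}_0$ includes the factor $-1$ for fermionic states. Without any assumption on the $\Sigma_j$, the same formula holds with the additional term $-\sum_{j=2}^{n-2}\operatorname{Res}_{z=z_j}\frac{\Sigma_j(z)}{z}$ on the right-hand side. -/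

import Mathlib

open scoped BigOperators Topology

noncomputable section

/-- Complexified momenta in `D = d + 1` space-time dimensions. -/
abbrev Mom (d : ℕ) : Type := Fin (d + 1) → ℂ

/-- The complex-bilinear Minkowski product. -/
def mdot {d : ℕ} (p q : Mom d) : ℂ :=
  p 0 * q 0 - ∑ i : Fin d, p i.succ * q i.succ

/-- A leg of a colour-ordered diagram: its incoming momentum and its wavefunction, the latter
being a vector with one component for each field of the theory. -/
structure Leg (d : ℕ) (F : Type*) where
  mom : Mom d
  wave : F → ℂ

/-- The operator `(-1)^F` on field vectors (`odd a` says that the field `a` is fermionic). -/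
def fermSign {F : Type*} (odd : F → Bool) (v : F → ℂ) : F → ℂ :=
  fun a => if odd a then -v a else v a

/-- Colour-ordered (planar) Feynman rules of a massless quantum field theory with finitely many
field components `F` and finitely many one-particle states `S` for each null momentum.
`vertex r` is the colour-ordered vertex of valence `r` with all momenta incoming, and the
propagator of a line of momentum `p` is `num p / p ^ 2`.  On the mass shell the numerator is the
sum over the states running through the line, `inWave p s` being the wavefunction of the state `s`
entering with momentum `p` at one end, and `outWave p s` the one of the conjugate state entering
with momentum `-p` at the other end. -/
structure PlanarTheory (d : ℕ) (F S : Type*) [Fintype F] [Fintype S] where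
  /-- which fields are fermionic (Faddeev-Popov ghosts count as fermionic) -/
  odd : F → Bool
  /-- which states are fermionic -/
  stateOdd : S → Bool
  vertex : (r : ℕ) → (Fin r → Mom d) → MultilinearMap ℂ (fun _ : Fin r => F → ℂ) ℂ
  num : Mom d → Matrix F F ℂ
  inWave : Mom d → S → F → ℂ
  outWave : Mom d → S → F → ℂ
  /-- vertices conserve fermion number modulo two -/
  vertex_even : ∀ (r : ℕ) (p : Fin r → Mom d) (v : Fin r → F → ℂ),
    vertex r p (fun i => fermSign odd (v i)) = vertex r p v
  /-- colour-ordered vertices are cyclic, up to the sign from moving a fermion around -/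
  vertex_cyclic : ∀ (r : ℕ) (p : Fin (r + 1) → Mom d) (v : Fin (r + 1) → F → ℂ),
    ∑ i, p i = 0 →
      vertex (r + 1) (Fin.snoc (α := fun _ => Mom d) (Fin.tail p) (p 0))
        (Fin.snoc (α := fun _ => F → ℂ) (Fin.tail v) (fermSign odd (v 0))) = vertex (r + 1) p v
  num_even : ∀ (p : Mom d) (a b : F), odd a ≠ odd b → num p a b = 0
  /-- a propagator may be read from either end -/
  num_symm : ∀ (p : Mom d) (a b : F), num (-p) b a = (if odd a then -1 else 1) * num p a b
  inWave_parity : ∀ (p : Mom d) (s : S) (a : F), odd a ≠ stateOdd s → inWave p s a = 0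
  outWave_parity : ∀ (p : Mom d) (s : S) (a : F), odd a ≠ stateOdd s → outWave p s a = 0
  /-- completeness of the on-shell states -/
  complete : ∀ p : Mom d, p ≠ 0 → mdot p p = 0 → ∀ a b : F,
    num p a b = ∑ s : S, inWave p s a * outWave p s b

variable {d : ℕ} {F S : Type*} [Fintype F] [DecidableEq F] [Fintype S]

namespace PlanarTheory

/-- Feynman rules are polynomial along the direction `q`: vertices and propagator numerators depend
polynomially on `z` when multiples of `z q` are added to the momenta.  This holds for every `q` if
the rules are polynomial in the momenta, and it also admits, e.g., the light-cone gauge with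
reference vector `η` as soon as `η ⬝ q = 0`. -/
def PolynomialAlong (T : PlanarTheory d F S) (q : Mom d) : Prop :=
  (∀ (p : Mom d) (a b : F), ∃ P : Polynomial ℂ, ∀ z : ℂ, T.num (p + z • q) a b = P.eval z) ∧
  (∀ (r : ℕ) (p : Fin r → Mom d) (c : Fin r → ℂ) (v : Fin r → F → ℂ),
    ∃ P : Polynomial ℂ, ∀ z : ℂ, T.vertex r (fun i => p i + (z * c i) • q) v = P.eval z)

end PlanarTheory

/-- The scalar factor `1 / K ^ 2` of a propagator, with the convention that it is `0` when
`K ^ 2 = 0`.  At generic kinematics the lines of a one-loop diagram, or of a forward limit, which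
are on shell for every value of the loop momentum are those of the tadpoles (`K = 0`) and of the
bubbles on external legs (`K = ± k_i`); the convention amounts to dropping these diagrams. -/
def propFactor (K : Mom d) : ℂ := if mdot K K = 0 then 0 else 1 / mdot K K

/-- Total momentum of a list of legs. -/
def totalMom (L : List (Leg d F)) : Mom d := (L.map Leg.mom).sum

/-- The unit wavefunction of the field `a`. -/
def unitWave (a : F) : F → ℂ := Pi.single a 1

namespace PlanarTheory

/-- The vertex of the theory at which the legs `L` meet, in this order. -/
def vtx (T : PlanarTheory d F S) (L : List (Leg d F)) : ℂ :=
  T.vertex L.length (fun i => (L.get i).mom) (fun i => (L.get i).wave)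

/-- The legs `L`, each with its wavefunction acted on by `(-1)^F`. -/
def gradeLegs (T : PlanarTheory d F S) (L : List (Leg d F)) : List (Leg d F) :=
  L.map (fun x => ⟨x.mom, fermSign T.odd x.wave⟩)

/-- Off-shell current of the ordered legs `L`: sum of all planar tree diagrams in which the legs `L`
join into one internal line, including the propagator of that line (Berends-Giele recursion over
the vertex at which that line ends).  For a single leg it is the wavefunction of the leg.
The first argument bounds the depth of the diagrams. -/
def currentAux (T : PlanarTheory d F S) : ℕ → List (Leg d F) → F → ℂ
  | 0, _ => 0
  | _ + 1, [x] => x.wave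
  | m + 1, L => fun a => propFactor (totalMom L) * ∑ b : F, T.num (totalMom L) a b *
      ∑ c : Composition L.length with 2 ≤ c.length,
        T.vtx ((L.splitWrtComposition c).map (fun B => ⟨totalMom B, currentAux T m B⟩)
          ++ [⟨-totalMom L, unitWave b⟩])

/-- The internal line into which the legs `L` join, as a leg for the rest of the diagram. -/
def currentLeg (T : PlanarTheory d F S) (L : List (Leg d F)) : Leg d F :=
  ⟨totalMom L, T.currentAux L.length L⟩

/-- The colour-ordered tree amplitude with ordered legs `L, x`: sum of all planar tree diagrams,
organised by the vertex at which the leg `x` ends. -/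
def treeAmp (T : PlanarTheory d F S) (L : List (Leg d F)) (x : Leg d F) : ℂ :=
  ∑ c : Composition L.length with 2 ≤ c.length,
    T.vtx ((L.splitWrtComposition c).map T.currentLeg ++ [x])

/-- Sum of the planar one-loop diagrams with ordered external legs `L` in which a loop line runs
between the last and the first leg.  Its momentum is `ℓ`; the diagrams are cut open along it, and
the ends are glued by the propagator of this line, with the sign for fermion loops. -/
def openLoop (T : PlanarTheory d F S) (L : List (Leg d F)) (ℓ : Mom d) : ℂ :=
  propFactor ℓ * ∑ a : F, ∑ b : F, T.num ℓ a b *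
    T.treeAmp (⟨ℓ, unitWave a⟩ :: L) ⟨-ℓ, fermSign T.odd (unitWave b)⟩

/-- Sum of the planar one-loop diagrams with ordered external legs `L = (1, ..., n)` whose loop
lines closest to the place between the last and the first leg are, on the side of the first leg,
the one between the legs `i` and `i + 1`, and on the side of the last leg, the one between the legs
`m` and `m + 1` (`1 ≤ i ≤ m < n`).  The legs `m + 1, ..., n, 1, ..., i` then form a corner: they
attach to the loop at a single vertex, possibly after joining into trees.  The loop is cut open
along the line between the legs `i` and `i + 1`, of momentum `ℓ + k_1 + ... + k_i`. -/
def cornerLoop (T : PlanarTheory d F S) (L : List (Leg d F)) (ℓ : Mom d) (i m : ℕ) : ℂ :=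
  let p : Mom d := ℓ + totalMom (L.take i)
  let M : List (Leg d F) := (L.take m).drop i
  let W : List (Leg d F) := L.drop m ++ T.gradeLegs (L.take i)
  propFactor p * ∑ a : F, ∑ b : F, T.num p a b *
    ∑ c : Composition W.length,
      T.vtx (T.currentLeg (⟨p, unitWave a⟩ :: M) ::
        ((W.splitWrtComposition c).map T.currentLeg ++ [⟨-p, fermSign T.odd (unitWave b)⟩]))

/-- The planar one-loop integrand with ordered external legs `L`: sum of all planar one-loop
diagrams other than tadpoles and bubbles on external legs, where `ℓ` is the loop momentum between
the last and the first leg, so that the loop propagators are `1 / (ℓ + k_1 + ... + k_j) ^ 2`. -/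
def oneLoop (T : PlanarTheory d F S) (L : List (Leg d F)) (ℓ : Mom d) : ℂ :=
  T.openLoop L ℓ +
    ∑ i ∈ Finset.Ico 1 L.length, ∑ m ∈ Finset.Ico i L.length, T.cornerLoop L ℓ i m

end PlanarTheory

/-- `c` is the residue of `f` at `w`: `∮ f dz / (2 π i) = c` on all small circles around `w`. -/
def HasResidue (f : ℂ → ℂ) (w c : ℂ) : Prop :=
  ∀ᶠ R in 𝓝[>] (0 : ℝ), CircleIntegrable f w R ∧ (∮ z in C(w, R), f z) = 2 * Real.pi * Complex.I * c

/-- `-∮_{z = ∞} f dz / (2 π i) = c`: one has `∮ f dz / (2 π i) = c` on all large circles, run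
through counterclockwise, that is, clockwise around `∞`. -/
def HasBoundaryTerm (f : ℂ → ℂ) (c : ℂ) : Prop :=
  ∀ᶠ R in Filter.atTop, CircleIntegrable f 0 R ∧ (∮ z in C(0, R), f z) = 2 * Real.pi * Complex.I * c

/-- Data of a shifted planar process with external legs `1, ..., n` (the values of `k` and `pol` at
other indices play no role). -/
structure ShiftData (d : ℕ) (F : Type*) where
  n : ℕ
  /-- external momenta, incoming -/
  k : ℕ → Mom d
  /-- shift vector -/
  q : Mom d
  /-- null part of the loop momentum -/
  ell0 : Mom d
  alpha : ℂ
  /-- wavefunctions of the unshifted legs `2, ..., n - 1` -/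
  pol : ℕ → F → ℂ
  /-- wavefunction of the shifted leg `1`, as a polynomial in `z` -/
  pol1 : F → Polynomial ℂ
  /-- wavefunction of the shifted leg `n`, as a polynomial in `z` -/
  poln : F → Polynomial ℂ

namespace ShiftData

/-- The external leg `i` after the shift `k_1 → k_1 + z q`, `k_n → k_n - z q`. -/
def leg (X : ShiftData d F) (z : ℂ) (i : ℕ) : Leg d F :=
  if i = 1 then ⟨X.k 1 + z • X.q, fun a => (X.pol1 a).eval z⟩
  else if i = X.n then ⟨X.k X.n - z • X.q, fun a => (X.poln a).eval z⟩
  else ⟨X.k i, X.pol i⟩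

/-- The shifted legs `i, i + 1, ..., j`. -/
def legs (X : ShiftData d F) (z : ℂ) (i j : ℕ) : List (Leg d F) :=
  (List.range' i (j + 1 - i)).map (X.leg z)

/-- The shifted loop momentum `ℓ₀ + (α - z) q`. -/
def ell (X : ShiftData d F) (z : ℂ) : Mom d := X.ell0 + (X.alpha - z) • X.q

/-- `k_i + ... + k_j`. -/
def K (X : ShiftData d F) (i j : ℕ) : Mom d := ∑ a ∈ Finset.Icc i j, X.k a

/-- The pole `z_I = - K_I ^ 2 / (2 K_I ⬝ q)` of the channel `I = {1, ..., j}`, which is also the one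
of the complementary channel `{j + 1, ..., n}`. -/
def zI (X : ShiftData d F) (j : ℕ) : ℂ := -mdot (X.K 1 j) (X.K 1 j) / (2 * mdot (X.K 1 j) X.q)

/-- The shifted planar one-loop integrand; `z = 0` is the unshifted one. -/
def integrand (X : ShiftData d F) (T : PlanarTheory d F S) (z : ℂ) : ℂ :=
  T.oneLoop (X.legs z 1 X.n) (X.ell z)

/-- Tree factorisation term of the channel `I = {1, ..., j}`. -/
def factorFirst (X : ShiftData d F) (T : PlanarTheory d F S) (j : ℕ) : ℂ :=
  let z := X.zI j
  let P : Mom d := totalMom (X.legs z 1 j)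
  ∑ s : S, T.treeAmp (X.legs z 1 j) ⟨-P, T.outWave P s⟩ *
    (1 / mdot (X.K 1 j) (X.K 1 j)) *
    T.oneLoop (⟨P, T.inWave P s⟩ :: X.legs z (j + 1) X.n) (X.ell z)

/-- Tree factorisation term of the channel `I = {j + 1, ..., n}`. -/
def factorLast (X : ShiftData d F) (T : PlanarTheory d F S) (j : ℕ) : ℂ :=
  let z := X.zI j
  let P : Mom d := totalMom (X.legs z (j + 1) X.n)
  ∑ s : S, T.treeAmp (X.legs z (j + 1) X.n) ⟨-P, T.outWave P s⟩ *
    (1 / mdot (X.K (j + 1) X.n) (X.K (j + 1) X.n)) *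
    T.oneLoop (X.legs z 1 j ++ [⟨P, T.inWave P s⟩]) (X.ell z)

/-- The sum over all channels of consecutive legs that contain exactly one of `1` and `n`, with at
least two legs on either side. -/
def factorisation (X : ShiftData d F) (T : PlanarTheory d F S) : ℂ :=
  ∑ j ∈ Finset.Icc 2 (X.n - 2), (X.factorFirst T j + X.factorLast T j)

/-- The forward-limit term: `1 / ℓ ^ 2` times the sum over the states in the loop (with a sign for
fermions) of the tree amplitude with legs `ℓ₀, k_1 + α q, k_2, ..., k_n - α q, -ℓ₀`. -/
def forwardLimit (X : ShiftData d F) (T : PlanarTheory d F S) : ℂ :=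
  1 / mdot (X.ell 0) (X.ell 0) * ∑ s : S, (if T.stateOdd s then -1 else 1) *
    T.treeAmp (⟨X.ell0, T.inWave X.ell0 s⟩ :: X.legs X.alpha 1 X.n)
      ⟨-X.ell0, T.outWave X.ell0 s⟩

/-- The part of the shifted integrand in which the loop is inserted, as a one-loop self-energy, into
the internal tree line separating the legs `1, ..., j` from `j + 1, ..., n`: these diagrams contain
the square of the propagator of this line. -/
def selfEnergy (X : ShiftData d F) (T : PlanarTheory d F S) (j : ℕ) (z : ℂ) : ℂ :=
  T.oneLoop [T.currentLeg (X.legs z 1 j), T.currentLeg (X.legs z (j + 1) X.n)] (X.ell z)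

/-- Massless external kinematics, and the conditions on `q` and `ℓ₀`. -/
structure OnShell (X : ShiftData d F) : Prop where
  two_le : 2 ≤ X.n
  null : ∀ i, 1 ≤ i → i ≤ X.n → mdot (X.k i) (X.k i) = 0
  conservation : X.K 1 X.n = 0
  q_null : mdot X.q X.q = 0
  k1_q : mdot (X.k 1) X.q = 0
  kn_q : mdot (X.k X.n) X.q = 0
  ell0_null : mdot X.ell0 X.ell0 = 0

/-- Generic kinematics: the propagators of the integrand are finite, and the poles in `z` exist and
do not collide. -/
structure Generic (X : ShiftData d F) : Prop where
  alpha_ne : X.alpha ≠ 0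
  ell0_q : mdot X.ell0 X.q ≠ 0
  loop_line : ∀ j, 1 ≤ j → j < X.n → mdot (X.ell 0 + X.K 1 j) (X.ell 0 + X.K 1 j) ≠ 0
  tree_line : ∀ i j, 2 ≤ i → i < j → j < X.n → mdot (X.K i j) (X.K i j) ≠ 0
  channel : ∀ j, 2 ≤ j → j + 2 ≤ X.n → mdot (X.K 1 j) (X.K 1 j) ≠ 0
  channel_q : ∀ j, 2 ≤ j → j + 2 ≤ X.n → mdot (X.K 1 j) X.q ≠ 0
  zI_ne_alpha : ∀ j, 2 ≤ j → j + 2 ≤ X.n → X.zI j ≠ X.alpha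
  zI_injective : ∀ i j, 2 ≤ i → i < j → j + 2 ≤ X.n → X.zI i ≠ X.zI j

end ShiftData

end

/-! The formula is the residue theorem for the shifted integrand divided by `z`. The integrand is
meromorphic on the whole plane, and few of its propagators depend on `z`. The shifts of `ℓ` and of
`k_1` cancel in `ℓ + k_1 + ... + k_j`, so only `1 / ℓ ^ 2` varies among the loop propagators; a tree
propagator varies only if its line separates leg `1` from leg `n`. Apart from `0`, the possible
poles are therefore `α` and the points `z_j`. The residue at `0` is the unshifted integrand. The
residue at `α` comes from the diagrams cut open along `ℓ`, where completeness of the states on the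
null momentum `ℓ₀` gives minus the forward limit. The sum of all residues is the integral over a
large circle, which is the boundary term.

The work lies in isolating the pole at `z_j`. External legs become natural-number labels and each
tree propagator is multiplied by a mask `χ B` depending on the block `B` of labels it joins, so that
single lines can be deleted. The main combinatorial identity (`splitSum_masked_contract`,
`masked_contract`) says that a sum of diagrams equals the sum without the line joining `V`, plus the
sum in which `V` is contracted to one new leg carrying the current of `V`. It follows from
multilinearity of the vertices, by recursion over the blocks. Applied to `V = {1, ..., j}` and to
its complement `V'`, it splits the loop into four parts (`maskedLoop_decompose`): neither line, only
`V`, only `V'`, and both; the last part is the self-energy `Σ_j`.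

The first part is analytic at `z_j`. The second and third are a simple propagator times an analytic
coefficient, whose value at `z_j` is a sum over states of a tree amplitude times a loop
(`channelFactor_eq_sum_states`). That loop still lacks the line joining the complementary block. At
`z_j` this line has null momentum, so it is an external bubble, dropped by the convention in
`propFactor`; the masked loop is thus the full lower-point integrand. The part `Σ_j` contributes its
own residue, which vanishes when it has no pole.

Analyticity and meromorphy are proved together, for any subalgebra of functions of `z` that contains
the identity and the needed propagators (`RegularLoop`, `regularLoop`). Regularity is inherited
under contraction. The residue theorem `exists_residues` is obtained by subtracting principal parts
one pole at a time. -/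

open scoped BigOperators Topology

set_option linter.unusedSectionVars false

/-! ### Splittings of a list into consecutive blocks -/

noncomputable section Splittings

variable {α : Type*}

open Classical in
/-- The splittings of a list into nonempty consecutive blocks. -/
def splits (L : List α) : Finset (List (List α)) :=
  Finset.univ.image fun c : Composition L.length => L.splitWrtComposition c

theorem mem_splits {L : List α} {s : List (List α)} :
    s ∈ splits L ↔ s.flatten = L ∧ ∀ B ∈ s, B ≠ [] := by
  classical
  simp only [splits, Finset.mem_image, Finset.mem_univ, true_and]
  constructor
  · rintro ⟨c, rfl⟩
    refine ⟨List.flatten_splitWrtComposition L c, fun B hB h => ?_⟩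
    have := List.length_pos_of_mem_splitWrtComposition hB
    simp [h] at this
  · rintro ⟨rfl, hs⟩
    refine ⟨⟨s.map List.length, ?_, ?_⟩, ?_⟩
    · intro i hi
      obtain ⟨B, hB, rfl⟩ := List.mem_map.1 hi
      exact List.length_pos_iff.2 (hs B hB)
    · simp [List.length_flatten]
    · exact List.splitWrtComposition_flatten _ _ rfl

/-- Sum over the splittings of a list into nonempty consecutive blocks. -/
def splitSum (Ψ : List (List α) → ℂ) (L : List α) : ℂ := ∑ s ∈ splits L, Ψ s

theorem splitWrtComposition_injective (L : List α) :
    Function.Injective fun c : Composition L.length => L.splitWrtComposition c := by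
  intro c c' h
  have := congrArg (List.map List.length) h
  simp only [List.map_length_splitWrtComposition] at this
  exact Composition.ext this

theorem sum_composition_eq_splitSum (Ψ : List (List α) → ℂ) (L : List α) :
    ∑ c : Composition L.length, Ψ (L.splitWrtComposition c) = splitSum Ψ L := by
  classical
  rw [splitSum, splits, Finset.sum_image fun c _ c' _ h => splitWrtComposition_injective L h]

theorem sum_composition_filter_eq_splitSum (Ψ : List (List α) → ℂ) (L : List α) :
    ∑ c : Composition L.length with 2 ≤ c.length, Ψ (L.splitWrtComposition c) =
      splitSum (fun s => if 2 ≤ s.length then Ψ s else 0) L := by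
  rw [← sum_composition_eq_splitSum, Finset.sum_filter]
  simp only [List.length_splitWrtComposition]

theorem splitSum_congr {Ψ Ψ' : List (List α) → ℂ} {L : List α}
    (h : ∀ s, s.flatten = L → (∀ B ∈ s, B ≠ []) → Ψ s = Ψ' s) :
    splitSum Ψ L = splitSum Ψ' L :=
  Finset.sum_congr rfl fun s hs => h s (mem_splits.1 hs).1 (mem_splits.1 hs).2

/-- A splitting is determined by the underlying list and the lengths of its blocks, so relabelling
by any `f`, injective or not, is a bijection on splittings. -/
theorem splitSum_map {β : Type*} (f : α → β) (Ψ : List (List β) → ℂ) (L : List α) :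
    splitSum Ψ (L.map f) = splitSum (fun s => Ψ (s.map (List.map f))) L := by
  symm
  refine Finset.sum_nbij (fun s => s.map (List.map f)) ?_ ?_ ?_ fun _ _ => rfl
  · intro s hs
    rw [mem_splits] at hs ⊢
    refine ⟨by rw [← hs.1, List.map_flatten], fun B hB => ?_⟩
    obtain ⟨C, hC, rfl⟩ := List.mem_map.1 hB
    simpa using hs.2 C hC
  · intro s hs s' hs' h
    have h1 := (mem_splits.1 hs).1
    have h2 := (mem_splits.1 hs').1
    have h3 := congrArg (List.map List.length) h
    simp only [List.map_map, Function.comp_def, List.length_map] at h3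
    exact List.eq_iff_flatten_eq.2 ⟨h1.trans h2.symm, h3⟩
  · intro s hs
    have hs := mem_splits.1 (Finset.mem_coe.1 hs)
    -- Surjectivity: the blocks of a splitting of the image are lifted one after another.
    have key : ∀ (s : List (List β)) (L : List α), s.flatten = L.map f → (∀ B ∈ s, B ≠ []) →
        ∃ r : List (List α), (r.flatten = L ∧ ∀ B ∈ r, B ≠ []) ∧ r.map (List.map f) = s := by
      intro s
      induction s with
      | nil =>
        intro L h _
        exact ⟨[], by simpa [eq_comm] using h⟩
      | cons B s ih =>
        intro L h hB
        rw [List.flatten_cons, eq_comm, List.map_eq_append_iff] at h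
        obtain ⟨L1, L2, rfl, h1, h2⟩ := h
        obtain ⟨r, hr, hr'⟩ := ih L2 h2.symm fun B hB' => hB B (List.mem_cons_of_mem _ hB')
        refine ⟨L1 :: r, ⟨by simp [hr.1], ?_⟩, by simp [hr', h1]⟩
        intro C hC
        rcases List.mem_cons.1 hC with rfl | hC
        · rintro rfl
          exact hB B (List.mem_cons_self) (by simpa using h1.symm)
        · exact hr.2 C hC
    obtain ⟨r, hr, hr'⟩ := key s L hs.1 hs.2
    exact ⟨r, Finset.mem_coe.2 (mem_splits.2 hr), hr'⟩

theorem flatten_infix_of_mem {s : List (List α)} {B : List α} (h : B ∈ s) : B <:+: s.flatten := by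
  obtain ⟨s1, s2, rfl⟩ := List.append_of_mem h
  exact ⟨s1.flatten, s2.flatten, by simp⟩

/-- This is the descent behind the recursion for currents: each vertex has at least two incoming
blocks, so every block is strictly shorter than the whole. -/
theorem length_lt_of_mem_split {s : List (List α)} {B : List α} (h : B ∈ s)
    (hs : ∀ C ∈ s, C ≠ []) (h2 : 2 ≤ s.length) : B.length < s.flatten.length := by
  obtain ⟨s1, s2, rfl⟩ := List.append_of_mem h
  have hpos : ∀ r : List (List α), (∀ C ∈ r, C ≠ []) → r.length ≤ r.flatten.length := by
    intro r hr
    induction r with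
    | nil => simp
    | cons C r ih =>
      have h1 := List.length_pos_iff.2 (hr C List.mem_cons_self)
      have h2 := ih fun C hC => hr C (List.mem_cons_of_mem _ hC)
      simp only [List.length_cons, List.flatten_cons, List.length_append]
      omega
  have h1 := hpos s1 fun C hC => hs C (by simp [hC])
  have h2' := hpos s2 fun C hC => hs C (by simp [hC])
  simp only [List.length_append, List.length_cons, List.flatten_append, List.flatten_cons] at *
  omega

theorem exists_block_of_mem {s : List (List α)} {t : α} (ht : t ∈ s.flatten)
    (hnd : s.flatten.Nodup) :
    ∃ pre B post, s = pre ++ B :: post ∧ t ∈ B ∧ t ∉ pre.flatten ∧ t ∉ post.flatten := by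
  obtain ⟨B, hB, htB⟩ := List.mem_flatten.1 ht
  obtain ⟨pre, post, rfl⟩ := List.append_of_mem hB
  refine ⟨pre, B, post, rfl, htB, ?_, ?_⟩
  · intro h
    rw [List.flatten_append, List.flatten_cons] at hnd
    exact (List.nodup_append.1 hnd).2.2 t h t (by simp [htB]) rfl
  · intro h
    rw [List.flatten_append, List.flatten_cons] at hnd
    exact (List.nodup_append.1 (List.nodup_append.1 hnd).2.1).2.2 t htB t h rfl

/-- Applied to a corner `C ++ A`, where the cyclic order passes from the last legs `C` to the first
legs `A`: a tree line either stays on one side or straddles the junction. -/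
theorem infix_append_cases {B C A : List α} (h : B <:+: C ++ A) :
    B <:+: C ∨ B <:+: A ∨ ∃ C0 C1 A1 A2, C1 ≠ [] ∧ A1 ≠ [] ∧ B = C1 ++ A1 ∧ C = C0 ++ C1 ∧
      A = A1 ++ A2 := by
  obtain ⟨X, Y, h⟩ := h
  rw [List.append_assoc, List.append_eq_append_iff] at h
  rcases h with ⟨C', rfl, h⟩ | ⟨A', rfl, h⟩
  · rw [List.append_eq_append_iff] at h
    rcases h with ⟨C'', rfl, h⟩ | ⟨A'', rfl, h⟩
    · exact Or.inl ⟨X, C'', by simp⟩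
    · rcases eq_or_ne C' [] with rfl | hC
      · exact Or.inr (Or.inl ⟨[], Y, by simp [h]⟩)
      · rcases eq_or_ne A'' [] with rfl | hA
        · exact Or.inl ⟨X, [], by simp⟩
        · exact Or.inr (Or.inr ⟨X, C', A'', Y, hC, hA, rfl, rfl, h⟩)
  · exact Or.inr (Or.inl ⟨A', Y, by simp [h]⟩)

theorem infix_cons_cases {B A : List α} {x : α} (h : B <:+: x :: A) :
    B <:+: A ∨ ∃ A1 A2, B = x :: A1 ∧ A = A1 ++ A2 := by
  rcases List.infix_cons_iff.1 h with h | h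
  · rcases List.prefix_cons_iff.1 h with rfl | ⟨A1, rfl, A2, rfl⟩
    · exact Or.inl List.nil_infix
    · exact Or.inr ⟨A1, A2, rfl, rfl⟩
  · exact Or.inl h

end Splittings

/-! ### Contracting a block of labels to a single label -/

section Expansion

/-- Replace the label `t` by the list of labels `V`. -/
def expand (t : ℕ) (V : List ℕ) (B : List ℕ) : List ℕ :=
  B.flatMap fun l => if l = t then V else [l]

theorem expand_append (t : ℕ) (V A B : List ℕ) :
    expand t V (A ++ B) = expand t V A ++ expand t V B := by
  simp [expand]

theorem expand_cons_self (t : ℕ) (V A : List ℕ) : expand t V (t :: A) = V ++ expand t V A := by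
  simp [expand]

theorem expand_cons_of_ne {t : ℕ} (V A : List ℕ) {l : ℕ} (h : l ≠ t) :
    expand t V (l :: A) = l :: expand t V A := by
  simp [expand, h]

theorem expand_of_notMem {t : ℕ} (V : List ℕ) {B : List ℕ} (h : t ∉ B) : expand t V B = B := by
  induction B with
  | nil => rfl
  | cons l B ih =>
    simp only [List.mem_cons, not_or] at h
    rw [expand_cons_of_ne _ _ (Ne.symm h.1), ih h.2]

theorem expand_flatten (t : ℕ) (V : List ℕ) (s : List (List ℕ)) :
    expand t V s.flatten = (s.map (expand t V)).flatten := by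
  induction s with
  | nil => rfl
  | cons B s ih => rw [List.flatten_cons, expand_append, ih]; rfl

theorem length_le_length_expand (t : ℕ) {V : List ℕ} (hV : V ≠ []) (B : List ℕ) :
    B.length ≤ (expand t V B).length := by
  induction B with
  | nil => simp
  | cons l B ih =>
    have := List.length_pos_iff.2 hV
    by_cases h : l = t
    · subst h
      rw [expand_cons_self]
      simp only [List.length_append, List.length_cons]
      omega
    · rw [expand_cons_of_ne _ _ h]
      simpa using ih

theorem expand_ne_nil (t : ℕ) {V : List ℕ} (hV : V ≠ []) {B : List ℕ} (hB : B ≠ []) :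
    expand t V B ≠ [] := by
  have h := length_le_length_expand t hV B
  have h' := List.length_pos_iff.2 hB
  exact List.length_pos_iff.1 (by omega)

theorem expand_infix (t : ℕ) (V : List ℕ) {A B : List ℕ} (h : A <:+: B) :
    expand t V A <:+: expand t V B := by
  obtain ⟨X, Y, rfl⟩ := h
  exact ⟨expand t V X, expand t V Y, by simp [expand_append]⟩

/-- Inverse of `expand t V` on lists without labels from `V`. -/
theorem expand_leftInverse {t : ℕ} {v : ℕ} {V : List ℕ} (hV : (v :: V).Nodup) {B : List ℕ}
    (hB : ∀ l ∈ B, l ∉ v :: V) (htB : t ∉ v :: V) :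
    (expand t (v :: V) B).flatMap
      (fun l => if l = v then [t] else if l ∈ V then [] else [l]) = B := by
  induction B with
  | nil => rfl
  | cons l B ih =>
    have ih := ih fun l hl => hB l (List.mem_cons_of_mem _ hl)
    by_cases h : l = t
    · subst h
      rw [expand_cons_self, List.flatMap_append, ih, List.flatMap_cons, if_pos rfl]
      have : V.flatMap (fun l' => if l' = v then [l] else if l' ∈ V then [] else [l']) = [] := by
        rw [List.flatMap_eq_nil_iff]
        intro x hx
        have : x ≠ v := by rintro rfl; exact (List.nodup_cons.1 hV).1 hx
        simp [this, hx]
      rw [this]; rfl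
    · have h1 := hB l List.mem_cons_self
      simp only [List.mem_cons, not_or] at h1
      rw [expand_cons_of_ne _ _ h, List.flatMap_cons, ih]
      simp [h1.1, h1.2]

/-- In a list without repetitions the position of the first label of `V` fixes where `V` occurs. -/
theorem append_cancel_of_nodup {U V Z X Y : List ℕ} (hV : V ≠ []) (hnd : (U ++ V ++ Z).Nodup)
    (h : X ++ V ++ Y = U ++ V ++ Z) : X = U ∧ Y = Z := by
  have hl : X.length = U.length := by
    obtain ⟨v, V, rfl⟩ := List.exists_cons_of_ne_nil hV
    have h1 : X.length < (U ++ (v :: V) ++ Z).length := by rw [← h]; simp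
    have h2 : U.length < (U ++ (v :: V) ++ Z).length := by simp
    rw [← hnd.getElem_inj_iff (hi := h1) (hj := h2)]
    have e1 : (U ++ (v :: V) ++ Z)[X.length] = v := by simp only [← h]; simp
    have e2 : (U ++ (v :: V) ++ Z)[U.length] = v := by simp
    rw [e1, e2]
  rw [List.append_assoc, List.append_assoc] at h
  obtain ⟨rfl, h⟩ := List.append_inj h hl
  exact ⟨rfl, List.append_cancel_left (List.append_cancel_left h)⟩

open Classical in
/-- Splittings in which the consecutive labels `V` are in one block are the splittings of the list
in which `V` is contracted to a single label. -/
theorem splitSum_contract (Ψ : List (List ℕ) → ℂ) {U V Z : List ℕ} {t : ℕ} (hV : V ≠ [])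
    (hnd : (U ++ V ++ Z).Nodup) (ht : t ∉ U ++ V ++ Z) :
    splitSum Ψ (U ++ V ++ Z) = splitSum (fun s => Ψ (s.map (expand t V))) (U ++ t :: Z) +
      splitSum (fun s => if ∃ B ∈ s, V <:+: B then 0 else Ψ s) (U ++ V ++ Z) := by
  have htU : t ∉ U := fun h => ht (by simp [h])
  have htV : t ∉ V := fun h => ht (by simp [h])
  have htZ : t ∉ Z := fun h => ht (by simp [h])
  have hexp : expand t V (U ++ t :: Z) = U ++ V ++ Z := by
    rw [expand_append, expand_cons_self, expand_of_notMem _ htU, expand_of_notMem _ htZ,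
      List.append_assoc]
  unfold splitSum
  rw [← Finset.sum_filter_add_sum_filter_not (splits (U ++ V ++ Z)) (fun s => ∃ B ∈ s, V <:+: B) Ψ]
  congr 1
  · symm
    refine Finset.sum_nbij (fun s => s.map (expand t V)) ?_ ?_ ?_ fun _ _ => rfl
    · intro s hs
      rw [mem_splits] at hs
      rw [Finset.mem_filter, mem_splits, ← expand_flatten, hs.1]
      refine ⟨⟨hexp, fun B hB => ?_⟩, ?_⟩
      · obtain ⟨C, hC, rfl⟩ := List.mem_map.1 hB
        exact expand_ne_nil t hV (hs.2 C hC)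
      · have : t ∈ s.flatten := by rw [hs.1]; simp
        obtain ⟨B, hB, htB⟩ := List.mem_flatten.1 this
        obtain ⟨X, Y, rfl⟩ := List.append_of_mem htB
        exact ⟨_, List.mem_map_of_mem hB, expand t V X, expand t V Y, by
          rw [expand_append, expand_cons_self, List.append_assoc]⟩
    -- Injectivity: `expand` is undone by sending the first label of `V` to `t` and erasing the
    -- other labels of `V`.
    · intro s hs s' hs' h
      obtain ⟨v, V, rfl⟩ := List.exists_cons_of_ne_nil hV
      have hVnd : (v :: V).Nodup := (List.nodup_append.1 (List.nodup_append.1 hnd).1).2.1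
      have hdisj : ∀ s : List (List ℕ), s.flatten = U ++ t :: Z → ∀ B ∈ s, ∀ l ∈ B, l ∉ v :: V := by
        intro s hs B hB l hl hlV
        have h1 : l ∈ U ++ t :: Z := hs ▸ List.mem_flatten.2 ⟨B, hB, hl⟩
        rcases List.mem_append.1 h1 with h1 | h1
        · exact (List.nodup_append.1 (List.nodup_append.1 hnd).1).2.2 l h1 l hlV rfl
        · rcases List.mem_cons.1 h1 with rfl | h1
          · exact htV hlV
          · exact (List.nodup_append.1 hnd).2.2 l (by simp [List.mem_cons.1 hlV]) l h1 rfl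
      have hinv : ∀ s : List (List ℕ), s.flatten = U ++ t :: Z →
          (s.map (expand t (v :: V))).map (fun B => B.flatMap
            (fun l => if l = v then [t] else if l ∈ V then [] else [l])) = s := by
        intro s hs
        rw [List.map_map]
        conv_rhs => rw [← List.map_id s]
        refine List.map_congr_left fun B hB => ?_
        exact expand_leftInverse hVnd (hdisj s hs B hB) htV
      rw [← hinv s (mem_splits.1 hs).1, ← hinv s' (mem_splits.1 hs').1]
      exact congrArg _ h
    · intro s hs
      rw [Finset.mem_coe, Finset.mem_filter, mem_splits] at hs
      obtain ⟨⟨hf, hne⟩, B, hB, X, Y, rfl⟩ := hs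
      obtain ⟨pre, post, rfl⟩ := List.append_of_mem hB
      have h1 : (pre.flatten ++ X) ++ V ++ (Y ++ post.flatten) = U ++ V ++ Z := by
        rw [← hf]; simp
      -- The occurrence of `V` inside a block is the given one, so it may be replaced by `t`.
      obtain ⟨rfl, rfl⟩ := append_cancel_of_nodup hV hnd h1
      have hmap : ∀ r : List (List ℕ), t ∉ r.flatten → r.map (expand t V) = r := by
        intro r hr
        conv_rhs => rw [← List.map_id r]
        refine List.map_congr_left fun C hC => expand_of_notMem _ fun h => hr ?_
        exact List.mem_flatten.2 ⟨C, hC, h⟩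
      refine ⟨pre ++ (X ++ t :: Y) :: post, ?_, ?_⟩
      · rw [Finset.mem_coe, mem_splits]
        refine ⟨by simp, fun C hC => ?_⟩
        rcases List.mem_append.1 hC with h | h
        · exact hne C (by simp [h])
        · rcases List.mem_cons.1 h with rfl | h
          · simp
          · exact hne C (by simp [h])
      · simp only [List.map_append, List.map_cons]
        rw [hmap pre (fun h => htU (by simp [h])), hmap post (fun h => htZ (by simp [h])),
          expand_append, expand_cons_self, expand_of_notMem _ fun h => htU (by simp [h]),
          expand_of_notMem _ fun h => htZ (by simp [h]), List.append_assoc]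
  · rw [Finset.sum_filter]
    exact Finset.sum_congr rfl fun s _ => by by_cases h : ∃ B ∈ s, V <:+: B <;> simp [h]

end Expansion

/-! ### Diagrams with labelled legs and masked propagators -/

noncomputable section MaskedDiagrams

variable {d : ℕ} {F S : Type*}

/-- Total momentum of the legs with labels in `L`. -/
def labelMom (g : ℕ → Leg d F) (L : List ℕ) : Mom d := totalMom (L.map g)

theorem labelMom_nil (g : ℕ → Leg d F) : labelMom g [] = 0 := by simp [labelMom, totalMom]

theorem labelMom_cons (g : ℕ → Leg d F) (l : ℕ) (L : List ℕ) :
    labelMom g (l :: L) = (g l).mom + labelMom g L := by simp [labelMom, totalMom]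

theorem labelMom_append (g : ℕ → Leg d F) (L M : List ℕ) :
    labelMom g (L ++ M) = labelMom g L + labelMom g M := by simp [labelMom, totalMom]

theorem labelMom_congr {g g' : ℕ → Leg d F} {L : List ℕ} (h : ∀ l ∈ L, (g l).mom = (g' l).mom) :
    labelMom g L = labelMom g' L := by
  induction L with
  | nil => simp [labelMom_nil]
  | cons l L ih =>
    rw [labelMom_cons, labelMom_cons, h l List.mem_cons_self,
      ih fun i hi => h i (List.mem_cons_of_mem _ hi)]

theorem labelMom_expand {g : ℕ → Leg d F} {t : ℕ} {V : List ℕ} (ht : (g t).mom = labelMom g V)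
    (B : List ℕ) : labelMom g (expand t V B) = labelMom g B := by
  induction B with
  | nil => rfl
  | cons l B ih =>
    by_cases h : l = t
    · subst h
      rw [expand_cons_self, labelMom_append, labelMom_cons, ih, ht]
    · rw [expand_cons_of_ne _ _ h, labelMom_cons, labelMom_cons, ih]

theorem map_update_of_notMem {g : ℕ → Leg d F} {t : ℕ} {L : List ℕ} (x : Leg d F) (ht : t ∉ L) :
    L.map (Function.update g t x) = L.map g :=
  List.map_congr_left fun l hl => Function.update_of_ne (by rintro rfl; exact ht hl) _ _

theorem map_update_cons {g : ℕ → Leg d F} {t : ℕ} {L : List ℕ} (x : Leg d F) (ht : t ∉ L) :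
    (t :: L).map (Function.update g t x) = x :: L.map g := by
  rw [List.map_cons, Function.update_self, map_update_of_notMem x ht]

variable [Fintype F] [DecidableEq F] [Fintype S]

namespace PlanarTheory

/-- Off-shell current of the legs with labels `L`, where the propagator of the line into which the
labels `B` join is multiplied by `χ B`. -/
def maskedAux (T : PlanarTheory d F S) (g : ℕ → Leg d F) (χ : List ℕ → ℂ) :
    ℕ → List ℕ → F → ℂ
  | 0, _ => 0
  | _ + 1, [l] => (g l).wave
  | m + 1, L => fun a => χ L * propFactor (labelMom g L) * ∑ b : F, T.num (labelMom g L) a b *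
      splitSum (fun s => if 2 ≤ s.length then
        T.vtx (s.map (fun B => ⟨labelMom g B, maskedAux T g χ m B⟩) ++
          [⟨-labelMom g L, unitWave b⟩]) else 0) L

/-- The length of `L` is enough recursion depth, by `maskedAux_eq_masked`. -/
def masked (T : PlanarTheory d F S) (g : ℕ → Leg d F) (χ : List ℕ → ℂ) (L : List ℕ) : F → ℂ :=
  T.maskedAux g χ L.length L

/-- The line into which the labels `L` join, as a leg. -/
def maskedLeg (T : PlanarTheory d F S) (g : ℕ → Leg d F) (χ : List ℕ → ℂ) (L : List ℕ) :
    Leg d F :=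
  ⟨labelMom g L, T.masked g χ L⟩

/-- Masked tree amplitude. -/
def maskedAmp (T : PlanarTheory d F S) (g : ℕ → Leg d F) (χ : List ℕ → ℂ) (L : List ℕ)
    (x : Leg d F) : ℂ :=
  splitSum (fun s => if 2 ≤ s.length then T.vtx (s.map (T.maskedLeg g χ) ++ [x]) else 0) L

theorem maskedAux_succ (T : PlanarTheory d F S) (g : ℕ → Leg d F) (χ : List ℕ → ℂ) (m : ℕ)
    {L : List ℕ} (hL : L.length ≠ 1) : T.maskedAux g χ (m + 1) L =
      fun a => χ L * propFactor (labelMom g L) * ∑ b : F, T.num (labelMom g L) a b *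
      splitSum (fun s => if 2 ≤ s.length then
        T.vtx (s.map (fun B => ⟨labelMom g B, T.maskedAux g χ m B⟩) ++
          [⟨-labelMom g L, unitWave b⟩]) else 0) L := by
  match L, hL with
  | [], _ => rfl
  | [l], h => simp at h
  | _ :: _ :: _, _ => rfl

theorem currentAux_succ (T : PlanarTheory d F S) (m : ℕ)
    {L : List (Leg d F)} (hL : L.length ≠ 1) : T.currentAux (m + 1) L =
      fun a => propFactor (totalMom L) * ∑ b : F, T.num (totalMom L) a b *
      ∑ c : Composition L.length with 2 ≤ c.length,
        T.vtx ((L.splitWrtComposition c).map (fun B => ⟨totalMom B, T.currentAux m B⟩)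
          ++ [⟨-totalMom L, unitWave b⟩]) := by
  match L, hL with
  | [], _ => rfl
  | [l], h => simp at h
  | _ :: _ :: _, _ => rfl

theorem splitSum_nil_of_two_le {α : Type*} (Ψ : List (List α) → ℂ) :
    splitSum (fun s => if 2 ≤ s.length then Ψ s else 0) ([] : List α) = 0 := by
  refine Finset.sum_eq_zero fun s hs => ?_
  have hs := mem_splits.1 hs
  have : s = [] := by
    by_contra h
    obtain ⟨B, hB⟩ := List.exists_mem_of_ne_nil s h
    exact hs.2 B hB (by have := List.flatten_eq_nil_iff.1 hs.1 B hB; simpa using this)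
  simp [this]

/-- Blocks shrink at every vertex, so any depth beyond the number of legs gives the same current. On
the empty list both sides vanish, there being no splitting into two blocks. -/
theorem maskedAux_eq_masked (T : PlanarTheory d F S) (g : ℕ → Leg d F) (χ : List ℕ → ℂ) :
    ∀ (m : ℕ) (L : List ℕ), L.length ≤ m → T.maskedAux g χ m L = T.masked g χ L := by
  intro m
  induction m using Nat.strong_induction_on with
  | _ m ih =>
    intro L hL
    match m, L, ih, hL with
    | m, [], _, _ =>
      rw [masked]
      cases m with
      | zero => rfl
      | succ m =>
        rw [maskedAux_succ _ _ _ _ (by simp)]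
        funext a
        simp only [splitSum_nil_of_two_le, mul_zero, Finset.sum_const_zero]
        rfl
    | m + 1, [l], _, _ => rfl
    | m + 1, l :: l' :: L, ih, hL =>
      rw [masked, List.length_cons, maskedAux_succ _ _ _ _ (by simp),
        maskedAux_succ _ _ _ _ (by simp)]
      funext a
      congr 1
      refine Finset.sum_congr rfl fun b _ => ?_
      congr 1
      refine splitSum_congr fun s hs hne => ?_
      split_ifs with h2
      · congr 2
        refine List.map_congr_left fun B hB => ?_
        have := length_lt_of_mem_split hB hne h2
        rw [hs] at this
        simp only [List.length_cons] at this hL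
        rw [ih m (by omega) B (by omega), ih (l' :: L).length (by simp only [List.length_cons]; omega) B
            (by simp only [List.length_cons]; omega)]
      · rfl

theorem masked_singleton (T : PlanarTheory d F S) (g : ℕ → Leg d F) (χ : List ℕ → ℂ) (l : ℕ) :
    T.masked g χ [l] = (g l).wave := rfl

/-- The depth-free recursion: a current is an amputated amplitude times a masked propagator. All
later arguments use this form. -/
theorem masked_eq (T : PlanarTheory d F S) (g : ℕ → Leg d F) (χ : List ℕ → ℂ) {L : List ℕ}
    (hL : L.length ≠ 1) (a : F) : T.masked g χ L a = χ L * propFactor (labelMom g L) *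
      ∑ b : F, T.num (labelMom g L) a b *
        T.maskedAmp g χ L ⟨-labelMom g L, unitWave b⟩ := by
  rw [← maskedAux_eq_masked T g χ (L.length + 1) L (by omega), maskedAux_succ _ _ _ _ hL]
  simp only
  congr 1
  refine Finset.sum_congr rfl fun b _ => ?_
  congr 1
  refine splitSum_congr fun s hs hne => ?_
  split_ifs with h2
  · congr 2
    refine List.map_congr_left fun B hB => ?_
    have := length_lt_of_mem_split hB hne h2
    rw [hs] at this
    rw [maskedAux_eq_masked T g χ L.length B this.le]
    rfl
  · rfl

theorem currentAux_map (T : PlanarTheory d F S) (g : ℕ → Leg d F) :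
    ∀ (m : ℕ) (L : List ℕ), T.currentAux m (L.map g) = T.maskedAux g (fun _ => 1) m L := by
  intro m
  induction m with
  | zero => intro L; rfl
  | succ m ih =>
    intro L
    by_cases hL : L.length = 1
    · obtain ⟨l, rfl⟩ := List.length_eq_one_iff.1 hL
      rfl
    · rw [maskedAux_succ _ _ _ _ hL, currentAux_succ _ _ (by simpa using hL)]
      funext a
      rw [one_mul]
      refine congrArg _ (Finset.sum_congr rfl fun b _ => congrArg _ ?_)
      refine (sum_composition_filter_eq_splitSum (fun s => T.vtx (s.map (fun B =>
        ⟨totalMom B, T.currentAux m B⟩) ++ [⟨-totalMom (L.map g), unitWave b⟩])) _).trans ?_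
      rw [splitSum_map]
      refine splitSum_congr fun s _ _ => ?_
      simp only [List.length_map, List.map_map]
      congr 3
      refine List.map_congr_left fun B _ => ?_
      simp only [Function.comp_apply, ih]
      rfl

theorem currentLeg_map (T : PlanarTheory d F S) (g : ℕ → Leg d F) (L : List ℕ) :
    T.currentLeg (L.map g) = T.maskedLeg g (fun _ => 1) L := by
  rw [currentLeg, currentAux_map, List.length_map]
  rfl

theorem treeAmp_map (T : PlanarTheory d F S) (g : ℕ → Leg d F) (L : List ℕ) (x : Leg d F) :
    T.treeAmp (L.map g) x = T.maskedAmp g (fun _ => 1) L x := by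
  rw [treeAmp, sum_composition_filter_eq_splitSum
    (fun s => T.vtx (s.map T.currentLeg ++ [x])), splitSum_map]
  refine splitSum_congr fun s _ _ => ?_
  simp only [List.length_map, List.map_map]
  congr 3
  exact List.map_congr_left fun B _ => T.currentLeg_map g B

/-- The legs `g`, those with labels in `A` being acted on by `(-1)^F`. -/
def gradeLabels (T : PlanarTheory d F S) (g : ℕ → Leg d F) (A : List ℕ) : ℕ → Leg d F :=
  fun l => if l ∈ A then ⟨(g l).mom, fermSign T.odd (g l).wave⟩ else g l

/-- `openLoop` without the propagator of the line that is cut; the label `0` is that of the end of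
this line. -/
def maskedOpen (T : PlanarTheory d F S) (g : ℕ → Leg d F) (χ : List ℕ → ℂ) (L : List ℕ)
    (ℓ : Mom d) : ℂ :=
  ∑ a : F, ∑ b : F, T.num ℓ a b * T.maskedAmp (Function.update g 0 ⟨ℓ, unitWave a⟩) χ (0 :: L)
    ⟨-ℓ, fermSign T.odd (unitWave b)⟩

/-- The corner diagrams in which the labels `A` and `C` are the ones of the corner. -/
def maskedCorner (T : PlanarTheory d F S) (g : ℕ → Leg d F) (χ : List ℕ → ℂ) (A M C : List ℕ)
    (ℓ : Mom d) : ℂ :=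
  propFactor (ℓ + labelMom g A) * ∑ a : F, ∑ b : F, T.num (ℓ + labelMom g A) a b *
    splitSum (fun s => T.vtx
      (T.maskedLeg (Function.update g 0 ⟨ℓ + labelMom g A, unitWave a⟩) χ (0 :: M) ::
        (s.map (T.maskedLeg (T.gradeLabels g A) χ) ++
          [⟨-(ℓ + labelMom g A), fermSign T.odd (unitWave b)⟩]))) (C ++ A)

/-- Sum of all corner diagrams. -/
def maskedCorners (T : PlanarTheory d F S) (g : ℕ → Leg d F) (χ : List ℕ → ℂ) (L : List ℕ)
    (ℓ : Mom d) : ℂ :=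
  ∑ i ∈ Finset.Ico 1 L.length, ∑ m ∈ Finset.Ico i L.length,
    T.maskedCorner g χ (L.take i) ((L.take m).drop i) (L.drop m) ℓ

/-- The one-loop integrand with labelled legs and masked propagators. -/
def maskedLoop (T : PlanarTheory d F S) (g : ℕ → Leg d F) (χ : List ℕ → ℂ) (L : List ℕ)
    (ℓ : Mom d) : ℂ :=
  propFactor ℓ * T.maskedOpen g χ L ℓ + T.maskedCorners g χ L ℓ

theorem cornerLoop_eq (T : PlanarTheory d F S) (L : List (Leg d F)) (ℓ : Mom d) (i m : ℕ) :
    T.cornerLoop L ℓ i m = propFactor (ℓ + totalMom (L.take i)) * ∑ a : F, ∑ b : F,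
      T.num (ℓ + totalMom (L.take i)) a b * splitSum (fun s => T.vtx (T.currentLeg
        (⟨ℓ + totalMom (L.take i), unitWave a⟩ :: (L.take m).drop i) ::
          (s.map T.currentLeg ++ [⟨-(ℓ + totalMom (L.take i)),
            fermSign T.odd (unitWave b)⟩]))) (L.drop m ++ T.gradeLegs (L.take i)) := by
  simp only [cornerLoop, ← sum_composition_eq_splitSum]

/-- The sign operator acts on legs in `cornerLoop` and on labels here. The two agree because, the
labels being distinct and `i ≤ m`, no label of `L.drop m` lies in `L.take i`. -/
theorem cornerLoop_map (T : PlanarTheory d F S) (g : ℕ → Leg d F) {L : List ℕ} (hL : L.Nodup)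
    (h0 : 0 ∉ L) (ℓ : Mom d) {i m : ℕ} (him : i ≤ m) :
    T.cornerLoop (L.map g) ℓ i m =
      T.maskedCorner g (fun _ => 1) (L.take i) ((L.take m).drop i) (L.drop m) ℓ := by
  have hW : (L.drop m).map g ++ T.gradeLegs ((L.take i).map g) =
      (L.drop m ++ L.take i).map (T.gradeLabels g (L.take i)) := by
    rw [List.map_append]
    congr 1
    · refine List.map_congr_left fun l hl => ?_
      rw [gradeLabels, if_neg]
      intro hl'
      rw [← List.take_append_drop m L, List.nodup_append] at hL
      exact hL.2.2 l (List.take_subset_take_left L him hl') l hl rfl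
    · rw [gradeLegs, List.map_map]
      refine List.map_congr_left fun l hl => ?_
      rw [gradeLabels, if_pos hl]
      rfl
  rw [cornerLoop_eq, ← List.map_take, ← List.map_take, ← List.map_drop, ← List.map_drop, hW,
    maskedCorner]
  refine congrArg _ (Finset.sum_congr rfl fun a _ => Finset.sum_congr rfl fun b _ =>
    congrArg _ ?_)
  rw [splitSum_map, ← map_update_cons _ fun h => h0 (List.mem_of_mem_take (List.mem_of_mem_drop h)),
    currentLeg_map]
  refine splitSum_congr fun s _ _ => ?_
  have hc : T.currentLeg ∘ List.map (T.gradeLabels g (L.take i)) =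
      T.maskedLeg (T.gradeLabels g (L.take i)) fun _ => 1 := funext (T.currentLeg_map _)
  rw [List.map_map, hc]
  rfl

theorem oneLoop_map (T : PlanarTheory d F S) (g : ℕ → Leg d F) {L : List ℕ} (hL : L.Nodup)
    (h0 : 0 ∉ L) (ℓ : Mom d) :
    T.oneLoop (L.map g) ℓ = T.maskedLoop g (fun _ => 1) L ℓ := by
  rw [oneLoop, maskedLoop, maskedCorners, List.length_map]
  refine congrArg₂ (· + ·) ?_ ?_
  · rw [openLoop, maskedOpen]
    refine congrArg _ (Finset.sum_congr rfl fun a _ => Finset.sum_congr rfl fun b _ => ?_)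
    rw [← treeAmp_map, map_update_cons _ h0]
  · refine Finset.sum_congr rfl fun i _ => Finset.sum_congr rfl fun m hm => ?_
    exact T.cornerLoop_map g hL h0 ℓ (Finset.mem_Ico.1 hm).1

end PlanarTheory

end MaskedDiagrams

/-! ### Locality, linearity and fermion parity of masked diagrams -/

noncomputable section Linearity

section LinearHelpers

variable {ι E : Type*} [AddCommGroup E] [Module ℂ E]

theorem isLinearMap_sum {s : Finset ι} {f : ι → E → ℂ} (h : ∀ i ∈ s, IsLinearMap ℂ (f i)) :
    IsLinearMap ℂ fun v => ∑ i ∈ s, f i v := by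
  refine ⟨fun v w => ?_, fun c v => ?_⟩
  · rw [← Finset.sum_add_distrib]
    exact Finset.sum_congr rfl fun i hi => (h i hi).map_add v w
  · rw [Finset.smul_sum]
    exact Finset.sum_congr rfl fun i hi => (h i hi).map_smul c v

theorem isLinearMap_const_mul {f : E → ℂ} (c : ℂ) (h : IsLinearMap ℂ f) :
    IsLinearMap ℂ fun v => c * f v :=
  ⟨fun v w => by rw [h.map_add, mul_add], fun k v => by
    rw [h.map_smul, smul_eq_mul, smul_eq_mul]; ring⟩

theorem isLinearMap_zero : IsLinearMap ℂ fun _ : E => (0 : ℂ) :=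
  ⟨fun _ _ => by simp, fun _ _ => by simp⟩

theorem isLinearMap_comp {E' G : Type*} [AddCommGroup E'] [Module ℂ E'] [AddCommGroup G]
    [Module ℂ G] {f : E' → G} {σ : E → E'} (h : IsLinearMap ℂ f) (hσ : IsLinearMap ℂ σ) :
    IsLinearMap ℂ fun v => f (σ v) :=
  ⟨fun v w => by rw [hσ.map_add, h.map_add], fun k v => by rw [hσ.map_smul, h.map_smul]⟩

theorem isLinearMap_map_sum {f : E → ℂ} (h : IsLinearMap ℂ f) (s : Finset ι) (c : ι → ℂ)
    (w : ι → E) : f (∑ i ∈ s, c i • w i) = ∑ i ∈ s, c i * f (w i) := by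
  have := map_sum (h.mk' f) (fun i => c i • w i) s
  simpa only [IsLinearMap.mk'_apply, h.map_smul, smul_eq_mul] using this

end LinearHelpers

theorem isLinearMap_fermSign {F : Type*} (odd : F → Bool) : IsLinearMap ℂ (fermSign odd) := by
  refine ⟨fun v w => ?_, fun c v => ?_⟩ <;> funext a <;> by_cases h : odd a <;>
    simp [fermSign, h, add_comm]

variable {d : ℕ} {F S : Type*} [Fintype F] [DecidableEq F] [Fintype S]

theorem sum_smul_unitWave (v : F → ℂ) : ∑ a : F, v a • (unitWave a : F → ℂ) = v := by
  funext b
  simp [unitWave, Finset.sum_apply, Pi.single_apply]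

namespace PlanarTheory

/-- Frees the valence from its dependence on the list, so that vertices of different lists of equal
length can be compared. -/
theorem vtx_of_length (T : PlanarTheory d F S) (L : List (Leg d F)) {r : ℕ} (h : L.length = r) :
    T.vtx L = T.vertex r (fun i => (L[(i : ℕ)]'(h ▸ i.2)).mom)
      (fun i => (L[(i : ℕ)]'(h ▸ i.2)).wave) := by
  subst h; rfl

theorem isLinearMap_vtx (T : PlanarTheory d F S) (pre post : List (Leg d F)) (p : Mom d) :
    IsLinearMap ℂ fun v => T.vtx (pre ++ ⟨p, v⟩ :: post) := by
  have hlen : ∀ v : F → ℂ, (pre ++ (⟨p, v⟩ : Leg d F) :: post).length =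
      pre.length + (post.length + 1) := by intro v; simp
  set k : Fin (pre.length + (post.length + 1)) := ⟨pre.length, by omega⟩ with hk
  have key : ∀ v : F → ℂ, T.vtx (pre ++ ⟨p, v⟩ :: post) =
      T.vertex (pre.length + (post.length + 1))
        (fun i => ((pre ++ (⟨p, 0⟩ : Leg d F) :: post)[(i : ℕ)]'((hlen 0).symm ▸ i.2)).mom)
        (Function.update
          (fun i => ((pre ++ (⟨p, 0⟩ : Leg d F) :: post)[(i : ℕ)]'((hlen 0).symm ▸ i.2)).wave) k v) := by
    intro v
    rw [T.vtx_of_length _ (hlen v)]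
    congr 1
    · congr 1
      funext i
      rcases lt_trichotomy (i : ℕ) pre.length with h | h | h
      · simp [List.getElem_append_left, h]
      · simp [h]
      · obtain ⟨e, he⟩ := Nat.exists_eq_add_of_lt h
        simp only [List.getElem_append_right h.le]
        simp [show (i : ℕ) - pre.length = e + 1 by omega]
    · funext i
      rcases lt_trichotomy (i : ℕ) pre.length with h | h | h
      · rw [Function.update_of_ne (by rintro rfl; simp [hk] at h)]
        simp [List.getElem_append_left, h]
      · have : i = k := Fin.ext h
        subst this
        simp [hk]
      · rw [Function.update_of_ne (by rintro rfl; simp [hk] at h)]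
        obtain ⟨e, he⟩ := Nat.exists_eq_add_of_lt h
        simp only [List.getElem_append_right h.le]
        simp [show (i : ℕ) - pre.length = e + 1 by omega]
  refine ⟨fun v w => ?_, fun c v => ?_⟩
  · rw [key, key, key, MultilinearMap.map_update_add]
  · rw [key, key, MultilinearMap.map_update_smul]

/-- Vertex of the lines `l` and the leg `x`, of valence at least three. -/
def ampVtx (T : PlanarTheory d F S) (x : Leg d F) (l : List (Leg d F)) : ℂ :=
  if 2 ≤ l.length then T.vtx (l ++ [x]) else 0

theorem isLinearMap_ampVtx (T : PlanarTheory d F S) (x : Leg d F) (pre post : List (Leg d F))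
    (p : Mom d) : IsLinearMap ℂ fun v => T.ampVtx x (pre ++ ⟨p, v⟩ :: post) := by
  simp only [ampVtx, List.length_append, List.length_cons]
  split_ifs
  · simpa only [List.append_assoc, List.cons_append] using T.isLinearMap_vtx pre (post ++ [x]) p
  · exact isLinearMap_zero

theorem maskedAmp_eq (T : PlanarTheory d F S) (g : ℕ → Leg d F) (χ : List ℕ → ℂ) (L : List ℕ)
    (x : Leg d F) :
    T.maskedAmp g χ L x = splitSum (fun s => T.ampVtx x (s.map (T.maskedLeg g χ))) L := by
  simp only [maskedAmp, ampVtx, List.length_map]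

theorem isLinearMap_maskedAmp_last (T : PlanarTheory d F S) (g : ℕ → Leg d F) (χ : List ℕ → ℂ)
    (L : List ℕ) (p : Mom d) : IsLinearMap ℂ fun v => T.maskedAmp g χ L ⟨p, v⟩ := by
  simp only [maskedAmp, splitSum]
  refine isLinearMap_sum fun s _ => ?_
  split_ifs
  · exact T.isLinearMap_vtx _ [] p
  · exact isLinearMap_zero

/-- Locality: a current sees only its own legs and the masks of consecutive sublists of length at
least two; a single leg has no propagator. -/
theorem maskedAux_congr (T : PlanarTheory d F S) {g g' : ℕ → Leg d F} {χ χ' : List ℕ → ℂ}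
    (m : ℕ) {L : List ℕ} (hg : ∀ l ∈ L, g l = g' l)
    (hχ : ∀ B, B <:+: L → 2 ≤ B.length → χ B = χ' B) :
    T.maskedAux g χ m L = T.maskedAux g' χ' m L := by
  induction m generalizing L with
  | zero => rfl
  | succ m ih =>
    by_cases hL : L.length = 1
    · obtain ⟨l, rfl⟩ := List.length_eq_one_iff.1 hL
      simp only [maskedAux]
      rw [hg l (by simp)]
    · rw [maskedAux_succ _ _ _ _ hL, maskedAux_succ _ _ _ _ hL]
      funext a
      rw [labelMom_congr fun l hl => congrArg Leg.mom (hg l hl)]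
      rcases Nat.lt_or_ge L.length 2 with h2 | h2
      · have : L = [] := List.length_eq_zero_iff.1 (by omega)
        subst this
        simp only [splitSum_nil_of_two_le]
        simp
      rw [hχ L List.infix_rfl h2]
      refine congrArg _ (Finset.sum_congr rfl fun b _ => congrArg _ ?_)
      refine splitSum_congr fun s hs _ => ?_
      split_ifs with h
      · congr 2
        refine List.map_congr_left fun B hB => ?_
        have hBL := flatten_infix_of_mem hB
        rw [hs] at hBL
        have hgB : ∀ l ∈ B, g l = g' l := fun l hl => hg l (hBL.subset hl)
        rw [ih hgB fun C hC => hχ C (hC.trans hBL),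
          labelMom_congr fun l hl => congrArg Leg.mom (hgB l hl)]
      · rfl

theorem masked_congr (T : PlanarTheory d F S) {g g' : ℕ → Leg d F} {χ χ' : List ℕ → ℂ}
    {L : List ℕ} (hg : ∀ l ∈ L, g l = g' l)
    (hχ : ∀ B, B <:+: L → 2 ≤ B.length → χ B = χ' B) :
    T.masked g χ L = T.masked g' χ' L :=
  T.maskedAux_congr _ hg hχ

theorem maskedLeg_congr (T : PlanarTheory d F S) {g g' : ℕ → Leg d F} {χ χ' : List ℕ → ℂ}
    {L : List ℕ} (hg : ∀ l ∈ L, g l = g' l)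
    (hχ : ∀ B, B <:+: L → 2 ≤ B.length → χ B = χ' B) :
    T.maskedLeg g χ L = T.maskedLeg g' χ' L := by
  rw [maskedLeg, maskedLeg, T.masked_congr hg hχ,
    labelMom_congr fun l hl => congrArg Leg.mom (hg l hl)]

theorem map_maskedLeg_congr (T : PlanarTheory d F S) {g g' : ℕ → Leg d F} {χ χ' : List ℕ → ℂ}
    {s : List (List ℕ)} (hg : ∀ l ∈ s.flatten, g l = g' l)
    (hχ : ∀ B, (∃ C ∈ s, B <:+: C) → 2 ≤ B.length → χ B = χ' B) :
    s.map (T.maskedLeg g χ) = s.map (T.maskedLeg g' χ') :=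
  List.map_congr_left fun C hC => T.maskedLeg_congr
    (fun l hl => hg l (List.mem_flatten.2 ⟨C, hC, hl⟩)) fun B hB => hχ B ⟨C, hC, hB⟩

theorem maskedAmp_congr (T : PlanarTheory d F S) {g g' : ℕ → Leg d F} {χ χ' : List ℕ → ℂ}
    {L : List ℕ} (x : Leg d F) (hg : ∀ l ∈ L, g l = g' l)
    (hχ : ∀ B, B <:+: L → 2 ≤ B.length → B.length < L.length → χ B = χ' B) :
    T.maskedAmp g χ L x = T.maskedAmp g' χ' L x := by
  refine splitSum_congr fun s hs hne => ?_
  split_ifs with h2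
  · rw [T.map_maskedLeg_congr (hs ▸ hg)]
    rintro B ⟨C, hC, hBC⟩ hB
    refine hχ B (hBC.trans (hs ▸ flatten_infix_of_mem hC)) hB ?_
    have := length_lt_of_mem_split hC hne h2
    rw [hs] at this
    exact hBC.length_le.trans_lt this
  · rfl

theorem gradeLabels_congr (T : PlanarTheory d F S) {g g' : ℕ → Leg d F} (A : List ℕ) {l : ℕ}
    (h : g l = g' l) : T.gradeLabels g A l = T.gradeLabels g' A l := by
  simp only [gradeLabels, h]

theorem maskedOpen_congr (T : PlanarTheory d F S) {g g' : ℕ → Leg d F} {χ χ' : List ℕ → ℂ}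
    {L : List ℕ} (ℓ : Mom d) (hg : ∀ l ∈ L, g l = g' l)
    (hχ : ∀ B, B <:+: 0 :: L → 2 ≤ B.length → B.length < L.length + 1 → χ B = χ' B) :
    T.maskedOpen g χ L ℓ = T.maskedOpen g' χ' L ℓ := by
  refine Finset.sum_congr rfl fun a _ => Finset.sum_congr rfl fun b _ => congrArg _ ?_
  refine T.maskedAmp_congr _ (fun l hl => ?_) fun B h1 h2 h3 => hχ B h1 h2 (by simpa using h3)
  by_cases h : l = 0
  · subst h; simp
  · rw [Function.update_of_ne h, Function.update_of_ne h]
    exact hg l ((List.mem_cons.1 hl).resolve_left h)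

theorem maskedCorner_congr (T : PlanarTheory d F S) {g g' : ℕ → Leg d F} {χ χ' : List ℕ → ℂ}
    {A M C : List ℕ} (ℓ : Mom d) (hg : ∀ l ∈ A ++ M ++ C, g l = g' l)
    (hχM : ∀ B, B <:+: 0 :: M → 2 ≤ B.length → χ B = χ' B)
    (hχ : ∀ B, B <:+: C ++ A → 2 ≤ B.length → χ B = χ' B) :
    T.maskedCorner g χ A M C ℓ = T.maskedCorner g' χ' A M C ℓ := by
  rw [maskedCorner, maskedCorner, labelMom_congr (g' := g') fun l hl => congrArg Leg.mom
    (hg l (by simp [hl]))]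
  refine congrArg _ (Finset.sum_congr rfl fun a _ => Finset.sum_congr rfl fun b _ => congrArg _ ?_)
  refine splitSum_congr fun s hs _ => ?_
  refine congrArg T.vtx (congrArg₂ List.cons ?_ (congrArg₂ (· ++ ·) ?_ rfl))
  · refine T.maskedLeg_congr (fun l hl => ?_) hχM
    by_cases h : l = 0
    · subst h; simp
    · rw [Function.update_of_ne h, Function.update_of_ne h]
      exact hg l (by simp [(List.mem_cons.1 hl).resolve_left h])
  · refine T.map_maskedLeg_congr (g := T.gradeLabels g A) (g' := T.gradeLabels g' A)
      (fun l hl => T.gradeLabels_congr A (hg l ?_)) ?_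
    · rw [hs] at hl
      rcases List.mem_append.1 hl with h | h <;> simp [h]
    · rintro B ⟨D, hD, hBD⟩
      exact hχ B (hBD.trans (hs ▸ flatten_infix_of_mem hD))

theorem take_append_mid_append_drop {α : Type*} (L : List α) {i m : ℕ} (h : i ≤ m) :
    L.take i ++ (L.take m).drop i ++ L.drop m = L := by
  conv_rhs => rw [← List.take_append_drop m L, ← List.take_append_drop i (L.take m)]
  rw [List.take_take, min_eq_left h]

theorem maskedLoop_congr_legs (T : PlanarTheory d F S) {g g' : ℕ → Leg d F} (χ : List ℕ → ℂ)
    {L : List ℕ} (ℓ : Mom d) (hg : ∀ l ∈ L, g l = g' l) :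
    T.maskedLoop g χ L ℓ = T.maskedLoop g' χ L ℓ := by
  rw [maskedLoop, maskedLoop, T.maskedOpen_congr ℓ hg fun _ _ _ _ => rfl, maskedCorners,
    maskedCorners]
  refine congrArg _ (Finset.sum_congr rfl fun i _ => Finset.sum_congr rfl fun m hm => ?_)
  refine T.maskedCorner_congr ℓ ?_ (fun _ _ _ => rfl) fun _ _ _ => rfl
  rw [take_append_mid_append_drop L (Finset.mem_Ico.1 hm).1]
  exact hg

/-- The labels are distinct, so exactly one block of each splitting contains `t`. Linearity in that
block's line composes with linearity of this line in the wavefunction of `t`. -/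
theorem isLinearMap_splitSum {φ : List (Leg d F) → ℂ}
    (hφ : ∀ pre post p, IsLinearMap ℂ fun v => φ (pre ++ ⟨p, v⟩ :: post))
    {J : (F → ℂ) → List ℕ → Leg d F} {L : List ℕ} {t : ℕ} (hL : L.Nodup) (ht : t ∈ L)
    (hmom : ∀ v B, (J v B).mom = (J 0 B).mom) (hout : ∀ v B, t ∉ B → J v B = J 0 B)
    (hin : ∀ B, B.Nodup → t ∈ B → IsLinearMap ℂ fun v => (J v B).wave) :
    IsLinearMap ℂ fun v => splitSum (fun s => φ (s.map (J v))) L := by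
  refine isLinearMap_sum fun s hs => ?_
  have hs := (mem_splits.1 hs).1
  obtain ⟨pre, B, post, rfl, htB, h1, h2⟩ := exists_block_of_mem (hs ▸ ht) (hs ▸ hL)
  have hmap : ∀ (v : F → ℂ) (r : List (List ℕ)), t ∉ r.flatten → r.map (J v) = r.map (J 0) :=
    fun v r hr => List.map_congr_left fun C hC => hout v C fun h =>
      hr (List.mem_flatten.2 ⟨C, hC, h⟩)
  have key : ∀ v, φ ((pre ++ B :: post).map (J v)) =
      φ (pre.map (J 0) ++ ⟨(J 0 B).mom, (J v B).wave⟩ :: post.map (J 0)) := by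
    intro v
    rw [List.map_append, List.map_cons, hmap v pre h1, hmap v post h2, ← hmom v]
  simp only [key]
  refine isLinearMap_comp (f := fun w => φ (pre.map (J 0) ++ ⟨(J 0 B).mom, w⟩ :: post.map (J 0)))
    (hφ _ _ _) (hin B ?_ htB)
  rw [← hs] at hL
  exact hL.sublist (flatten_infix_of_mem (by simp)).sublist

theorem labelMom_update (g : ℕ → Leg d F) (t : ℕ) (P : Mom d) (v w : F → ℂ) (B : List ℕ) :
    labelMom (Function.update g t ⟨P, v⟩) B = labelMom (Function.update g t ⟨P, w⟩) B := by
  refine labelMom_congr fun l _ => ?_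
  by_cases h : l = t
  · subst h; simp
  · rw [Function.update_of_ne h, Function.update_of_ne h]

theorem isLinearMap_maskedAux (T : PlanarTheory d F S) (g : ℕ → Leg d F) (χ : List ℕ → ℂ)
    {t : ℕ} (P : Mom d) (m : ℕ) {L : List ℕ} (hL : L.Nodup) (ht : t ∈ L) :
    IsLinearMap ℂ fun v => T.maskedAux (Function.update g t ⟨P, v⟩) χ m L := by
  induction m generalizing L with
  | zero => exact ⟨fun _ _ => by simp [maskedAux], fun _ _ => by simp [maskedAux]⟩
  | succ m ih =>
    by_cases h1 : L.length = 1
    · obtain ⟨l, rfl⟩ := List.length_eq_one_iff.1 h1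
      rw [List.mem_singleton] at ht
      subst ht
      simp only [maskedAux, Function.update_self]
      exact ⟨fun _ _ => rfl, fun _ _ => rfl⟩
    · simp only [maskedAux_succ _ _ _ _ h1]
      have key : ∀ a, IsLinearMap ℂ fun v : F → ℂ =>
          χ L * propFactor (labelMom (Function.update g t ⟨P, v⟩) L) *
          ∑ b : F, T.num (labelMom (Function.update g t ⟨P, v⟩) L) a b *
          splitSum (fun s => if 2 ≤ s.length then
            T.vtx (s.map (fun B => ⟨labelMom (Function.update g t ⟨P, v⟩) B,
              T.maskedAux (Function.update g t ⟨P, v⟩) χ m B⟩) ++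
              [⟨-labelMom (Function.update g t ⟨P, v⟩) L, unitWave b⟩]) else 0) L := by
        intro a
        simp only [fun v => labelMom_update g t P v 0 L]
        refine isLinearMap_const_mul _ (isLinearMap_sum fun b _ => isLinearMap_const_mul _ ?_)
        have := isLinearMap_splitSum (T.isLinearMap_ampVtx
          ⟨-labelMom (Function.update g t ⟨P, 0⟩) L, unitWave b⟩)
          (J := fun v B => ⟨labelMom (Function.update g t ⟨P, v⟩) B,
            T.maskedAux (Function.update g t ⟨P, v⟩) χ m B⟩) hL ht
          (fun v B => labelMom_update g t P v 0 B) ?_ fun B hB htB => ih hB htB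
        · simpa only [ampVtx, List.length_map] using this
        · intro v B hB
          rw [labelMom_update g t P v 0]
          congr 1
          refine T.maskedAux_congr m (fun l hl => ?_) fun _ _ _ => rfl
          have : l ≠ t := by rintro rfl; exact hB hl
          rw [Function.update_of_ne this, Function.update_of_ne this]
      exact ⟨fun v w => funext fun a => (key a).map_add v w,
        fun c v => funext fun a => (key a).map_smul c v⟩

theorem isLinearMap_masked (T : PlanarTheory d F S) (g : ℕ → Leg d F) (χ : List ℕ → ℂ)
    {t : ℕ} (P : Mom d) {L : List ℕ} (hL : L.Nodup) (ht : t ∈ L) :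
    IsLinearMap ℂ fun v => T.masked (Function.update g t ⟨P, v⟩) χ L :=
  T.isLinearMap_maskedAux g χ P _ hL ht

theorem maskedLeg_update (T : PlanarTheory d F S) (g : ℕ → Leg d F) (χ : List ℕ → ℂ)
    {t : ℕ} (P : Mom d) (v w : F → ℂ) {B : List ℕ} (hB : t ∉ B) :
    T.maskedLeg (Function.update g t ⟨P, v⟩) χ B =
      T.maskedLeg (Function.update g t ⟨P, w⟩) χ B := by
  refine T.maskedLeg_congr (fun l hl => ?_) fun _ _ _ => rfl
  have : l ≠ t := by rintro rfl; exact hB hl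
  rw [Function.update_of_ne this, Function.update_of_ne this]

theorem isLinearMap_splitSum_maskedLeg (T : PlanarTheory d F S) {φ : List (Leg d F) → ℂ}
    (hφ : ∀ pre post p, IsLinearMap ℂ fun v => φ (pre ++ ⟨p, v⟩ :: post))
    (g : ℕ → Leg d F) (χ : List ℕ → ℂ) {L : List ℕ} {t : ℕ} (P : Mom d) (hL : L.Nodup)
    (ht : t ∈ L) : IsLinearMap ℂ fun v =>
      splitSum (fun s => φ (s.map (T.maskedLeg (Function.update g t ⟨P, v⟩) χ))) L :=
  isLinearMap_splitSum hφ hL ht (fun v B => labelMom_update g t P v 0 B)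
    (fun v _ hB => T.maskedLeg_update g χ P v 0 hB) fun _ hB htB => T.isLinearMap_masked g χ P hB htB

theorem isLinearMap_maskedAmp (T : PlanarTheory d F S) (g : ℕ → Leg d F) (χ : List ℕ → ℂ)
    {L : List ℕ} {t : ℕ} (P : Mom d) (x : Leg d F) (hL : L.Nodup) (ht : t ∈ L) :
    IsLinearMap ℂ fun v => T.maskedAmp (Function.update g t ⟨P, v⟩) χ L x := by
  simp only [maskedAmp_eq]
  exact T.isLinearMap_splitSum_maskedLeg (T.isLinearMap_ampVtx x) g χ P hL ht

theorem isLinearMap_maskedOpen (T : PlanarTheory d F S) (g : ℕ → Leg d F) (χ : List ℕ → ℂ)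
    {L : List ℕ} {t : ℕ} (P ℓ : Mom d) (hL : L.Nodup) (ht : t ∈ L) (h0 : 0 ∉ L) :
    IsLinearMap ℂ fun v => T.maskedOpen (Function.update g t ⟨P, v⟩) χ L ℓ := by
  refine isLinearMap_sum fun a _ => isLinearMap_sum fun b _ => isLinearMap_const_mul _ ?_
  have h : t ≠ 0 := by rintro rfl; exact h0 ht
  simp only [fun v : F → ℂ => Function.update_comm h (⟨P, v⟩ : Leg d F) ⟨ℓ, unitWave a⟩ g]
  exact T.isLinearMap_maskedAmp _ χ P _ (List.nodup_cons.2 ⟨h0, hL⟩) (List.mem_cons_of_mem _ ht)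

theorem gradeLabels_update (T : PlanarTheory d F S) (g : ℕ → Leg d F) (A : List ℕ) (t : ℕ)
    (P : Mom d) (v : F → ℂ) : T.gradeLabels (Function.update g t ⟨P, v⟩) A =
      Function.update (T.gradeLabels g A) t
        ⟨P, (if t ∈ A then fermSign T.odd else fun v => v) v⟩ := by
  funext l
  by_cases h : l = t
  · subst h
    rw [gradeLabels, Function.update_self, Function.update_self]
    split_ifs <;> rfl
  · rw [Function.update_of_ne h, gradeLabels, gradeLabels, Function.update_of_ne h]

/-- As `t` lies in the corner, the current of the opened loop over `M` does not depend on its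
wavefunction. If `t` is in `A`, the wavefunction enters through `fermSign`, which is linear. -/
theorem isLinearMap_maskedCorner (T : PlanarTheory d F S) (g : ℕ → Leg d F) (χ : List ℕ → ℂ)
    {A M C : List ℕ} {t : ℕ} (P ℓ : Mom d) (hL : (A ++ M ++ C).Nodup) (ht : t ∈ C ++ A)
    (h0 : t ≠ 0) :
    IsLinearMap ℂ fun v => T.maskedCorner (Function.update g t ⟨P, v⟩) χ A M C ℓ := by
  simp only [maskedCorner, fun v => labelMom_update g t P v 0 A]
  refine isLinearMap_const_mul _ (isLinearMap_sum fun a _ => isLinearMap_sum fun b _ =>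
    isLinearMap_const_mul _ ?_)
  have hCA : (C ++ A).Nodup :=
    (List.perm_append_comm.nodup_iff).1 (hL.sublist (by simp))
  have htM : t ∉ M := by
    intro h
    rw [List.nodup_append] at hL
    rcases List.mem_append.1 ht with h' | h'
    · exact hL.2.2 t (by simp [h]) t h' rfl
    · exact (List.nodup_append.1 hL.1).2.2 t h' t h rfl
  simp only [fun v : F → ℂ => Function.update_comm h0 (⟨P, v⟩ : Leg d F)
    ⟨ℓ + labelMom (Function.update g t ⟨P, 0⟩) A, unitWave a⟩ g]
  have ht0 : t ∉ 0 :: M := by simp [h0, htM]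
  simp only [fun v => T.maskedLeg_update (Function.update g 0
    ⟨ℓ + labelMom (Function.update g t ⟨P, 0⟩) A, unitWave a⟩) χ P v 0 ht0, gradeLabels_update]
  set y : Leg d F := T.maskedLeg (Function.update (Function.update g 0
    ⟨ℓ + labelMom (Function.update g t ⟨P, 0⟩) A, unitWave a⟩) t ⟨P, 0⟩) χ (0 :: M)
  refine isLinearMap_comp (E' := F → ℂ) (f := fun v => splitSum (fun s => T.vtx (y :: (s.map
    (T.maskedLeg (Function.update (T.gradeLabels g A) t ⟨P, v⟩) χ) ++ _))) (C ++ A))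
    (T.isLinearMap_splitSum_maskedLeg (φ := fun l => T.vtx (y :: (l ++ _))) (fun pre post p => ?_)
      _ χ P hCA ht) ?_
  · simpa only [List.append_assoc, List.cons_append] using
      T.isLinearMap_vtx (y :: pre) (post ++ _) p
  · split_ifs
    · exact isLinearMap_fermSign _
    · exact ⟨fun _ _ => rfl, fun _ _ => rfl⟩

/-- The loop is linear in the wavefunction of the first and of the last leg. -/
theorem isLinearMap_maskedLoop (T : PlanarTheory d F S) (g : ℕ → Leg d F) (χ : List ℕ → ℂ)
    {L : List ℕ} {t : ℕ} (P ℓ : Mom d) (hL : L.Nodup) (ht : t ∈ L) (h0 : 0 ∉ L)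
    (hend : ∀ i m, 1 ≤ i → m < L.length → t ∈ L.drop m ++ L.take i) :
    IsLinearMap ℂ fun v => T.maskedLoop (Function.update g t ⟨P, v⟩) χ L ℓ := by
  have h1 := isLinearMap_const_mul (propFactor ℓ) (T.isLinearMap_maskedOpen g χ P ℓ hL ht h0)
  have h2 : IsLinearMap ℂ fun v => T.maskedCorners (Function.update g t ⟨P, v⟩) χ L ℓ := by
    refine isLinearMap_sum fun i hi => isLinearMap_sum fun m hm => ?_
    rw [Finset.mem_Ico] at hi hm
    refine T.isLinearMap_maskedCorner g χ P ℓ ?_ (hend i m hi.1 hm.2) ?_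
    · rwa [take_append_mid_append_drop L hm.1]
    · rintro rfl; exact h0 ht
  exact ⟨fun v w => by simp only [maskedLoop, h1.map_add, h2.map_add]; ring,
    fun c v => by simp only [maskedLoop, h1.map_smul, h2.map_smul, smul_eq_mul]; ring⟩

theorem fermSign_unitWave (odd : F → Bool) (a : F) :
    fermSign odd (unitWave a) = (if odd a then -1 else 1 : ℂ) • unitWave a := by
  funext b
  by_cases h : b = a
  · subst h; by_cases h' : odd b <;> simp [fermSign, unitWave, h']
  · by_cases h' : odd b <;> simp [fermSign, unitWave, h, h']

theorem fermSign_fermSign (odd : F → Bool) (v : F → ℂ) : fermSign odd (fermSign odd v) = v := by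
  funext b; by_cases h : odd b <;> simp [fermSign, h]

theorem vtx_grade (T : PlanarTheory d F S) (L : List (Leg d F)) :
    T.vtx (L.map fun x => ⟨x.mom, fermSign T.odd x.wave⟩) = T.vtx L := by
  rw [T.vtx_of_length (r := L.length) _ (by simp)]
  simp only [List.getElem_map]
  exact T.vertex_even L.length (fun i => L[(i : ℕ)].mom) (fun i => L[(i : ℕ)].wave)

/-- Fermion parity passes through a tree: vertices are invariant under `(-1)^F` on all legs, and
`num` preserves parity, so the sign moves from the incoming legs to the outgoing end. -/
theorem maskedAux_grade (T : PlanarTheory d F S) {g g' : ℕ → Leg d F} (χ : List ℕ → ℂ)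
    (m : ℕ) {L : List ℕ} (hg : ∀ l ∈ L, g' l = ⟨(g l).mom, fermSign T.odd (g l).wave⟩) :
    T.maskedAux g' χ m L = fermSign T.odd (T.maskedAux g χ m L) := by
  induction m generalizing L with
  | zero => funext a; simp [maskedAux, fermSign]
  | succ m ih =>
    by_cases hL : L.length = 1
    · obtain ⟨l, rfl⟩ := List.length_eq_one_iff.1 hL
      simp only [maskedAux]
      rw [hg l (by simp)]
    · rw [maskedAux_succ _ _ _ _ hL, maskedAux_succ _ _ _ _ hL]
      have hmom : ∀ B, B <:+: L → labelMom g' B = labelMom g B := fun B hB =>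
        labelMom_congr fun l hl => by rw [hg l (hB.subset hl)]
      funext a
      have hsign : fermSign T.odd (fun a => χ L * propFactor (labelMom g L) *
          ∑ b : F, T.num (labelMom g L) a b * splitSum (fun s => if 2 ≤ s.length then
            T.vtx (s.map (fun B => ⟨labelMom g B, T.maskedAux g χ m B⟩) ++
              [⟨-labelMom g L, unitWave b⟩]) else 0) L) a =
          χ L * propFactor (labelMom g L) * ∑ b : F, T.num (labelMom g L) a b *
            ((if T.odd b then -1 else 1) * splitSum (fun s => if 2 ≤ s.length then
            T.vtx (s.map (fun B => ⟨labelMom g B, T.maskedAux g χ m B⟩) ++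
              [⟨-labelMom g L, unitWave b⟩]) else 0) L) := by
        have : ∀ f : F → ℂ, fermSign T.odd f a = (if T.odd a then -1 else 1) * f a := by
          intro f; by_cases h : T.odd a <;> simp [fermSign, h]
        rw [this, mul_left_comm, Finset.mul_sum]
        refine congrArg _ (Finset.sum_congr rfl fun b _ => ?_)
        by_cases h : T.odd a = T.odd b
        · rw [h]; ring
        · rw [T.num_even _ a b h]; ring
      rw [hsign, hmom L List.infix_rfl]
      refine congrArg _ (Finset.sum_congr rfl fun b _ => congrArg _ ?_)
      rw [splitSum, splitSum, Finset.mul_sum]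
      refine Finset.sum_congr rfl fun s hs => ?_
      have hs := (mem_splits.1 hs).1
      split_ifs with h2 hb hb
      all_goals try rw [mul_zero]
      all_goals
        rw [← T.vtx_grade, List.map_append, List.map_map]
        have : s.map ((fun x : Leg d F => (⟨x.mom, fermSign T.odd x.wave⟩ : Leg d F)) ∘
            fun B => ⟨labelMom g' B, T.maskedAux g' χ m B⟩) =
            s.map (fun B => ⟨labelMom g B, T.maskedAux g χ m B⟩) := by
          refine List.map_congr_left fun B hB => ?_
          have hBL : B <:+: L := hs ▸ flatten_infix_of_mem hB
          simp only [Function.comp_apply]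
          rw [ih fun l hl => hg l (hBL.subset hl), hmom B hBL, fermSign_fermSign]
        rw [this, List.map_cons, List.map_nil, fermSign_unitWave]
        have := (T.isLinearMap_vtx (s.map (fun B => ⟨labelMom g B, T.maskedAux g χ m B⟩)) []
          (-labelMom g L)).map_smul (if T.odd b then -1 else 1) (unitWave b)
        rw [this, smul_eq_mul]
        simp [hb]

theorem masked_grade (T : PlanarTheory d F S) {g g' : ℕ → Leg d F} (χ : List ℕ → ℂ)
    {L : List ℕ} (hg : ∀ l ∈ L, g' l = ⟨(g l).mom, fermSign T.odd (g l).wave⟩) :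
    T.masked g' χ L = fermSign T.odd (T.masked g χ L) :=
  T.maskedAux_grade χ _ hg

end PlanarTheory

end Linearity

/-! ### Contraction identity for trees, open loops and single corners -/

noncomputable section TreeContraction

variable {d : ℕ} {F S : Type*} [Fintype F] [DecidableEq F] [Fintype S]

/-- The mask `χ₀` is the mask `χ` with the line of the labels `V` removed, and does not distinguish
the label `t` from the block `V`. -/
structure IsCut (χ χ₀ : List ℕ → ℂ) (V : List ℕ) (t : ℕ) : Prop where
  self : χ₀ V = 0
  of_ne : ∀ B, B ≠ V → χ₀ B = χ B
  contract : ∀ U Z, χ₀ (U ++ t :: Z) = χ (U ++ V ++ Z)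

theorem IsCut.eq_of_not_infix {χ χ₀ : List ℕ → ℂ} {V : List ℕ} {t : ℕ} (h : IsCut χ χ₀ V t)
    {L : List ℕ} (hL : ¬ V <:+: L) : ∀ B, B <:+: L → χ B = χ₀ B := fun B hB =>
  (h.of_ne B (by rintro rfl; exact hL hB)).symm

namespace PlanarTheory

/-- Splittings that break `V` do not see the change of mask. In the others a single block contains
`V`; the identity `hc` for its current, put into `φ` by linearity, gives the two terms. The last
premise of `hc` exempts the block that is the whole list when `φ` vanishes on single lines, and this
is what lets the recursion in `masked_contract` close. -/
theorem splitSum_masked_contract (T : PlanarTheory d F S) {φ : List (Leg d F) → ℂ}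
    (hφ : ∀ pre post p, IsLinearMap ℂ fun v => φ (pre ++ ⟨p, v⟩ :: post))
    {g : ℕ → Leg d F} {χ χ₀ : List ℕ → ℂ} {U V Z : List ℕ} {t : ℕ}
    (hcut : IsCut χ χ₀ V t) (hV : V ≠ []) (hnd : (U ++ V ++ Z).Nodup) (ht : t ∉ U ++ V ++ Z)
    (hmom : (g t).mom = labelMom g V)
    (hc : ∀ U₁ Z₁, U₁ <:+ U → Z₁ <+: Z → (U₁ = U → Z₁ = Z → ∃ x, φ [x] ≠ 0) →
      T.masked g χ (U₁ ++ V ++ Z₁) =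
        T.masked g χ₀ (U₁ ++ V ++ Z₁) + T.masked g χ₀ (U₁ ++ t :: Z₁)) :
    splitSum (fun s => φ (s.map (T.maskedLeg g χ))) (U ++ V ++ Z) =
      splitSum (fun s => φ (s.map (T.maskedLeg g χ₀))) (U ++ V ++ Z) +
      splitSum (fun s => φ (s.map (T.maskedLeg g χ₀))) (U ++ t :: Z) := by
  classical
  have htU : t ∉ U := fun h => ht (by simp [h])
  have htZ : t ∉ Z := fun h => ht (by simp [h])
  rw [splitSum_contract _ hV hnd ht,
    splitSum_contract (fun s => φ (s.map (T.maskedLeg g χ₀))) hV hnd ht]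
  -- The masks differ only on `V`, which lies in no block of these splittings.
  have hno : splitSum (fun s => if ∃ B ∈ s, V <:+: B then 0 else φ (s.map (T.maskedLeg g χ)))
      (U ++ V ++ Z) = splitSum (fun s => if ∃ B ∈ s, V <:+: B then 0
        else φ (s.map (T.maskedLeg g χ₀))) (U ++ V ++ Z) := by
    refine splitSum_congr fun s _ _ => ?_
    split_ifs with h
    · rfl
    · rw [T.map_maskedLeg_congr (fun _ _ => rfl)]
      rintro B ⟨C, hC, hBC⟩ _
      exact hcut.eq_of_not_infix (fun hVC => h ⟨C, hC, hVC⟩) B hBC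
  rw [hno, add_right_comm]
  congr 1
  rw [splitSum, splitSum, splitSum, ← Finset.sum_add_distrib]
  refine Finset.sum_congr rfl fun s hs => ?_
  rw [mem_splits] at hs
  have hnd' : (U ++ t :: Z).Nodup := by
    rw [List.nodup_middle, List.nodup_cons]
    refine ⟨by simp [htU, htZ], hnd.sublist ?_⟩
    rw [List.append_assoc]
    exact (List.Sublist.refl U).append (List.sublist_append_right V Z)
  obtain ⟨pre, B, post, rfl, htB, hpre, hpost⟩ :=
    exists_block_of_mem (t := t) (s := s) (by rw [hs.1]; simp) (hs.1 ▸ hnd')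
  obtain ⟨U₁, Z₁, rfl⟩ := List.append_of_mem htB
  have hf : (pre.flatten ++ U₁) ++ [t] ++ (Z₁ ++ post.flatten) = U ++ [t] ++ Z := by
    have := hs.1
    simp only [List.flatten_append, List.flatten_cons] at this
    simpa using this
  obtain ⟨hU, hZ⟩ := append_cancel_of_nodup (by simp) (by simpa using hnd') hf
  have hU₁ : U₁ <:+ U := ⟨_, hU⟩
  have hZ₁ : Z₁ <+: Z := ⟨_, hZ⟩
  have hexp : ∀ r : List (List ℕ), t ∉ r.flatten → r.map (expand t V) = r := by
    intro r hr
    conv_rhs => rw [← List.map_id r]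
    refine List.map_congr_left fun C hC => expand_of_notMem _ fun h => hr ?_
    exact List.mem_flatten.2 ⟨C, hC, h⟩
  have hexpB : expand t V (U₁ ++ t :: Z₁) = U₁ ++ V ++ Z₁ := by
    rw [expand_append, expand_cons_self, expand_of_notMem _ fun h => htU (hU₁.subset h),
      expand_of_notMem _ fun h => htZ (hZ₁.subset h), List.append_assoc]
  obtain ⟨v, hv⟩ := List.exists_mem_of_ne_nil V hV
  have hvU : v ∉ U := fun h =>
    (List.nodup_append.1 (List.nodup_append.1 hnd).1).2.2 v h v hv rfl
  have hvZ : v ∉ Z := fun h => (List.nodup_append.1 hnd).2.2 v (by simp [hv]) v h rfl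
  have hχ : ∀ r : List (List ℕ), v ∉ r.flatten →
      r.map (T.maskedLeg g χ) = r.map (T.maskedLeg g χ₀) := by
    intro r hr
    refine T.map_maskedLeg_congr (fun _ _ => rfl) ?_
    rintro B ⟨C, hC, hBC⟩ _
    refine hcut.eq_of_not_infix (fun hVC => hr ?_) B hBC
    exact List.mem_flatten.2 ⟨C, hC, hVC.subset hv⟩
  have hmomB : labelMom g (U₁ ++ t :: Z₁) = labelMom g (U₁ ++ V ++ Z₁) := by
    rw [← labelMom_expand hmom, hexpB]
  simp only [List.map_append, List.map_cons]
  rw [hexp pre hpre, hexp post hpost, hexpB, hχ pre fun h => hvU (by rw [← hU]; simp [h]),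
    hχ post fun h => hvZ (by rw [← hZ]; simp [h])]
  simp only [maskedLeg, hmomB]
  -- Otherwise the block is the whole list, and every term is `φ` of a single line, which is zero.
  by_cases hfull : (U₁ = U → Z₁ = Z → ∃ x, φ [x] ≠ 0)
  · rw [hc U₁ Z₁ hU₁ hZ₁ hfull]
    exact (hφ _ _ _).map_add _ _
  · push Not at hfull
    obtain ⟨rfl, rfl, h0⟩ := hfull
    have hpre' : pre = [] := by
      by_contra hne
      obtain ⟨B, hB⟩ := List.exists_mem_of_ne_nil pre hne
      have h1 : pre.flatten = [] := by simpa using hU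
      exact hs.2 B (by simp [hB]) (List.flatten_eq_nil_iff.1 h1 B hB)
    have hpost' : post = [] := by
      by_contra hne
      obtain ⟨B, hB⟩ := List.exists_mem_of_ne_nil post hne
      have h1 : post.flatten = [] := by simpa using hZ
      exact hs.2 B (by simp [hB]) (List.flatten_eq_nil_iff.1 h1 B hB)
    subst hpre' hpost'
    simp [h0]

/-- Induction on the number of labels outside `V`: the line of `U ++ V ++ Z` ends at a vertex, and
the identity holds for the shorter block that contains `V` there. -/
theorem masked_contract (T : PlanarTheory d F S) {g : ℕ → Leg d F} {χ χ₀ : List ℕ → ℂ}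
    {V : List ℕ} {t : ℕ} (hcut : IsCut χ χ₀ V t) (hV : 2 ≤ V.length)
    (hg : g t = T.maskedLeg g χ V) (N : ℕ) : ∀ {U Z : List ℕ}, U.length + Z.length = N →
    (U ++ V ++ Z).Nodup → t ∉ U ++ V ++ Z → T.masked g χ (U ++ V ++ Z) =
      T.masked g χ₀ (U ++ V ++ Z) + T.masked g χ₀ (U ++ t :: Z) := by
  induction N using Nat.strong_induction_on with
  | _ N ih =>
    intro U Z hN hnd ht
    have hV0 : V ≠ [] := by rintro rfl; simp at hV
    -- For the block `V` itself, `χ₀` kills the current and the leg `t` supplies it.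
    by_cases hUZ : N = 0
    · have hU : U = [] := List.length_eq_zero_iff.1 (by omega)
      have hZ : Z = [] := List.length_eq_zero_iff.1 (by omega)
      subst hU hZ
      simp only [List.nil_append, List.append_nil]
      rw [masked_singleton, hg]
      funext a
      rw [Pi.add_apply, T.masked_eq g χ₀ (by omega), hcut.self]
      simp [maskedLeg]
    · have hmom : (g t).mom = labelMom g V := by rw [hg]; rfl
      have hmomL : labelMom g (U ++ t :: Z) = labelMom g (U ++ V ++ Z) := by
        rw [labelMom_append, labelMom_cons, labelMom_append, labelMom_append, hmom, add_assoc]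
      have hne : U ++ V ++ Z ≠ V := by
        intro h
        have := congrArg List.length h
        simp only [List.length_append] at this
        omega
      funext a
      rw [Pi.add_apply, T.masked_eq g χ (by simp only [List.length_append]; omega),
        T.masked_eq g χ₀ (by simp only [List.length_append]; omega),
        T.masked_eq g χ₀ (by simp only [List.length_append, List.length_cons]; omega),
        hcut.of_ne _ hne, hcut.contract, hmomL, ← mul_add, ← Finset.sum_add_distrib]
      refine congrArg _ (Finset.sum_congr rfl fun b _ => ?_)
      rw [← mul_add, maskedAmp_eq, maskedAmp_eq, maskedAmp_eq]
      congr 1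
      refine T.splitSum_masked_contract (T.isLinearMap_ampVtx _) hcut hV0 hnd ht hmom ?_
      intro U₁ Z₁ hU₁ hZ₁ hfull
      -- `ampVtx` vanishes on a single line, so the full block is exempt and only shorter ones
      -- remain.
      have hlt : U₁.length + Z₁.length < N := by
        by_contra hge
        have h1 := hU₁.length_le
        have h2 := hZ₁.length_le
        obtain ⟨x, hx⟩ := hfull (hU₁.eq_of_length (by omega)) (hZ₁.eq_of_length (by omega))
        exact hx (by simp [ampVtx])
      have hsub : (U₁ ++ V ++ Z₁).Sublist (U ++ V ++ Z) :=
        (hU₁.sublist.append (List.Sublist.refl V)).append hZ₁.sublist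
      exact ih _ hlt rfl (hnd.sublist hsub) fun h => ht (hsub.subset h)

/-- A sum over the splittings of `U ++ V ++ Z` is the sum of the terms without the line `V`, and of
those in which `V` has been contracted to a leg. -/
theorem splitSum_maskedLeg_contract (T : PlanarTheory d F S) {φ : List (Leg d F) → ℂ}
    (hφ : ∀ pre post p, IsLinearMap ℂ fun v => φ (pre ++ ⟨p, v⟩ :: post))
    {g : ℕ → Leg d F} {χ χ₀ : List ℕ → ℂ} {U V Z : List ℕ} {t : ℕ}
    (hcut : IsCut χ χ₀ V t) (hV : 2 ≤ V.length) (hnd : (U ++ V ++ Z).Nodup)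
    (ht : t ∉ U ++ V ++ Z) (hg : g t = T.maskedLeg g χ V) :
    splitSum (fun s => φ (s.map (T.maskedLeg g χ))) (U ++ V ++ Z) =
      splitSum (fun s => φ (s.map (T.maskedLeg g χ₀))) (U ++ V ++ Z) +
      splitSum (fun s => φ (s.map (T.maskedLeg g χ₀))) (U ++ t :: Z) := by
  refine T.splitSum_masked_contract hφ hcut (by rintro rfl; simp at hV) hnd ht (by rw [hg]; rfl) ?_
  intro U₁ Z₁ hU₁ hZ₁ _
  have hsub : (U₁ ++ V ++ Z₁).Sublist (U ++ V ++ Z) :=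
    (hU₁.sublist.append (List.Sublist.refl V)).append hZ₁.sublist
  exact T.masked_contract hcut hV hg _ rfl (hnd.sublist hsub) fun h => ht (hsub.subset h)

theorem maskedOpen_contract (T : PlanarTheory d F S) {g : ℕ → Leg d F} {χ χ₀ : List ℕ → ℂ}
    {U V Z : List ℕ} {t : ℕ} (hcut : IsCut χ χ₀ V t) (hV : 2 ≤ V.length)
    (hnd : (U ++ V ++ Z).Nodup) (ht : t ∉ U ++ V ++ Z) (h0 : 0 ∉ U ++ V ++ Z) (ht0 : t ≠ 0)
    (hg : g t = T.maskedLeg g χ V) (ℓ : Mom d) :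
    T.maskedOpen g χ (U ++ V ++ Z) ℓ =
      T.maskedOpen g χ₀ (U ++ V ++ Z) ℓ + T.maskedOpen g χ₀ (U ++ t :: Z) ℓ := by
  simp only [maskedOpen, ← Finset.sum_add_distrib, ← mul_add]
  refine Finset.sum_congr rfl fun a _ => Finset.sum_congr rfl fun b _ => congrArg _ ?_
  simp only [maskedAmp_eq]
  refine T.splitSum_maskedLeg_contract (U := 0 :: U) (T.isLinearMap_ampVtx _) hcut hV
    (List.nodup_cons.2 ⟨h0, hnd⟩) (by simpa [ht0] using ht) ?_
  rw [Function.update_of_ne ht0, hg]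
  refine T.maskedLeg_congr (fun l hl => ?_) fun _ _ _ => rfl
  rw [Function.update_of_ne]
  rintro rfl
  exact h0 (by simp [hl])

/-- The sum over the corner diagrams, for given current of the legs outside the corner. -/
theorem maskedCorner_contract (T : PlanarTheory d F S) {g : ℕ → Leg d F} {χ χ₀ : List ℕ → ℂ}
    {A A' M C C' U V Z : List ℕ} {t : ℕ} (hcut : IsCut χ χ₀ V t) (hV : 2 ≤ V.length)
    (hCA : C ++ A = U ++ V ++ Z) (hCA' : C' ++ A' = U ++ t :: Z)
    (hnd : (U ++ V ++ Z).Nodup) (ht : t ∉ U ++ V ++ Z) (hVM : ¬ V <:+: 0 :: M)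
    (hmom : labelMom g A' = labelMom g A)
    (hgr : ∀ l ∈ U ++ V ++ Z, l ∈ A ↔ l ∈ A' ∨ (l ∈ V ∧ t ∈ A'))
    (hgr' : ∀ l ∈ U ++ Z, l ∈ A' → l ∈ A) (hgrV : ∀ l ∈ V, l ∉ A')
    (hg : g t = T.maskedLeg g χ V) (ℓ : Mom d) :
    T.maskedCorner g χ A M C ℓ =
      T.maskedCorner g χ₀ A M C ℓ + T.maskedCorner g χ₀ A' M C' ℓ := by
  simp only [maskedCorner, hmom, ← mul_add, ← Finset.sum_add_distrib]
  refine congrArg _ (Finset.sum_congr rfl fun a _ => Finset.sum_congr rfl fun b _ =>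
    congrArg _ ?_)
  rw [T.maskedLeg_congr (χ' := χ₀) (fun _ _ => rfl) fun B hB _ =>
    hcut.eq_of_not_infix hVM B hB, hCA, hCA']
  set y := T.maskedLeg (Function.update g 0 ⟨ℓ + labelMom g A, unitWave a⟩) χ₀ (0 :: M)
  set x : Leg d F := ⟨-(ℓ + labelMom g A), fermSign T.odd (unitWave b)⟩
  -- One assignment of legs for all three sums: `t` is graded according to `A'`, every other label
  -- according to `A`.
  set g' : ℕ → Leg d F := fun l => if l = t then T.gradeLabels g A' l else T.gradeLabels g A l
    with hg'
  have e1 : ∀ ψ : List ℕ → ℂ,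
      splitSum (fun s => T.vtx (y :: (s.map (T.maskedLeg (T.gradeLabels g A) ψ) ++ [x])))
        (U ++ V ++ Z) =
      splitSum (fun s => T.vtx (y :: (s.map (T.maskedLeg g' ψ) ++ [x]))) (U ++ V ++ Z) := by
    intro ψ
    refine splitSum_congr fun s hs _ => ?_
    rw [T.map_maskedLeg_congr (g' := g') (χ' := ψ) (fun l hl => ?_) fun _ _ _ => rfl]
    rw [hs] at hl
    rw [hg']
    simp only
    rw [if_neg (by rintro rfl; exact ht hl)]
  have e2 : splitSum (fun s => T.vtx (y :: (s.map (T.maskedLeg (T.gradeLabels g A') χ₀) ++ [x])))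
        (U ++ t :: Z) =
      splitSum (fun s => T.vtx (y :: (s.map (T.maskedLeg g' χ₀) ++ [x]))) (U ++ t :: Z) := by
    refine splitSum_congr fun s hs _ => ?_
    rw [T.map_maskedLeg_congr (g' := g') (χ' := χ₀) (fun l hl => ?_) fun _ _ _ => rfl]
    rw [hs] at hl
    rw [hg']
    simp only
    split_ifs with h
    · rfl
    · have hl' : l ∈ U ++ Z := by
        simp only [List.mem_append, List.mem_cons] at hl ⊢
        tauto
      have hlV : l ∈ U ++ V ++ Z := by
        simp only [List.mem_append] at hl' ⊢
        tauto
      have hiff : l ∈ A ↔ l ∈ A' := by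
        refine ⟨fun hA => ?_, hgr' l hl'⟩
        rcases (hgr l hlV).1 hA with h1 | ⟨h1, _⟩
        · exact h1
        · exfalso
          rcases List.mem_append.1 hl' with h2 | h2
          · exact (List.nodup_append.1 (List.nodup_append.1 hnd).1).2.2 l h2 l h1 rfl
          · exact (List.nodup_append.1 hnd).2.2 l (by simp [h1]) l h2 rfl
      simp only [gradeLabels, hiff]
  rw [e1, e1, e2]
  refine T.splitSum_maskedLeg_contract (φ := fun l => T.vtx (y :: (l ++ [x])))
    (fun pre post p => ?_) hcut hV hnd ht ?_
  · simpa only [List.append_assoc, List.cons_append] using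
      T.isLinearMap_vtx (y :: pre) (post ++ [x]) p
  -- The block `V` lies either wholly inside `A` or wholly outside it, so its current is graded as a
  -- whole and matches the grading of `t`.
  · have hgV : ∀ l ∈ V, g' l = if t ∈ A' then ⟨(g l).mom, fermSign T.odd (g l).wave⟩ else g l := by
      intro l hl
      have hlm : l ∈ U ++ V ++ Z := by simp [hl]
      have hne : l ≠ t := by rintro rfl; exact ht hlm
      have hiff : l ∈ A ↔ t ∈ A' := by
        rw [hgr l hlm]
        have := hgrV l hl
        tauto
      simp only [hg', if_neg hne, gradeLabels, hiff]
    simp only [hg', if_true]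
    by_cases htA : t ∈ A'
    · simp only [htA, if_true] at hgV
      rw [gradeLabels, if_pos htA]
      rw [maskedLeg, T.masked_grade χ hgV, hg]
      have : labelMom g' V = labelMom g V := labelMom_congr fun l hl => by rw [hgV l hl]
      rw [show (fun l => if l = t then T.gradeLabels g A' l else T.gradeLabels g A l) = g' from rfl,
        this]
      rfl
    · simp only [htA, if_false] at hgV
      rw [gradeLabels, if_neg htA, hg]
      exact T.maskedLeg_congr (fun l hl => (hgV l hl).symm) fun _ _ _ => rfl

theorem maskedCorner_eq_of_not_infix (T : PlanarTheory d F S) {g : ℕ → Leg d F}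
    {χ χ₀ : List ℕ → ℂ} {A M C V : List ℕ} {t : ℕ} (hcut : IsCut χ χ₀ V t)
    (hVM : ¬ V <:+: 0 :: M) (hVC : ¬ V <:+: C ++ A) (ℓ : Mom d) :
    T.maskedCorner g χ A M C ℓ = T.maskedCorner g χ₀ A M C ℓ :=
  T.maskedCorner_congr ℓ (fun _ _ => rfl) (fun B hB _ => hcut.eq_of_not_infix hVM B hB)
    fun B hB _ => hcut.eq_of_not_infix hVC B hB

end PlanarTheory

end TreeContraction

/-! ### Contraction identity for the one-loop integrand -/

noncomputable section LoopContraction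

variable {d : ℕ} {F S : Type*} [Fintype F] [DecidableEq F] [Fintype S]

namespace PlanarTheory

theorem maskedOpen_prefix (T : PlanarTheory d F S) {g : ℕ → Leg d F} {χ χ₀ : List ℕ → ℂ}
    {V Z : List ℕ} {t : ℕ} (hcut : IsCut χ χ₀ V t) (hV : 2 ≤ V.length)
    (hnd : (V ++ Z).Nodup) (ht : t ∉ V ++ Z) (h0 : 0 ∉ V ++ Z) (ht0 : t ≠ 0)
    (hg : g t = T.maskedLeg g χ V) (ℓ : Mom d) :
    T.maskedOpen g χ (V ++ Z) ℓ =
      T.maskedOpen g χ₀ (V ++ Z) ℓ + T.maskedOpen g χ₀ (t :: Z) ℓ := by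
  simpa using T.maskedOpen_contract (U := []) hcut hV hnd ht h0 ht0 hg ℓ

/-- All of `V` lies in the graded part `A` of the corner, so the contracted leg `t` inherits the
grading. -/
theorem maskedCorner_prefix (T : PlanarTheory d F S) {g : ℕ → Leg d F} {χ χ₀ : List ℕ → ℂ}
    {V Z M C : List ℕ} {t : ℕ} (hcut : IsCut χ χ₀ V t) (hV : 2 ≤ V.length)
    (hnd : (V ++ Z ++ M ++ C).Nodup) (ht : t ∉ V ++ Z ++ M ++ C) (h0 : 0 ∉ V)
    (hg : g t = T.maskedLeg g χ V) (ℓ : Mom d) :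
    T.maskedCorner g χ (V ++ Z) M C ℓ =
      T.maskedCorner g χ₀ (V ++ Z) M C ℓ + T.maskedCorner g χ₀ (t :: Z) M C ℓ := by
  have hnd' : (C ++ V ++ Z).Nodup := by
    have : (C ++ (V ++ Z ++ M)).Nodup := (List.perm_append_comm.nodup_iff).1 hnd
    refine this.sublist ?_
    rw [List.append_assoc, List.append_assoc]
    exact (List.Sublist.refl C).append (by simp)
  have ht' : t ∉ C ++ V ++ Z := fun h => ht (by
    simp only [List.mem_append] at h ⊢; tauto)
  refine T.maskedCorner_contract hcut hV (by simp) (by simp) hnd' ht' ?_ ?_ ?_ ?_ ?_ hg ℓ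
  · intro h
    obtain ⟨v, hv⟩ := List.exists_mem_of_ne_nil V (by rintro rfl; simp at hV)
    rcases List.mem_cons.1 (h.subset hv) with rfl | h'
    · exact h0 hv
    · exact (List.nodup_append.1 (List.nodup_append.1 hnd).1).2.2 v (by simp [hv]) v h' rfl
  · rw [labelMom_cons, labelMom_append, hg]; rfl
  · intro l hl
    have : l ≠ t := by rintro rfl; exact ht' hl
    simp only [List.mem_append, List.mem_cons, this, false_or, true_or, and_true]
    tauto
  · intro l hl hlA
    have hlt : l ≠ t := by
      rintro rfl
      exact ht' (by simp only [List.mem_append] at hl ⊢; tauto)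
    have := (List.mem_cons.1 hlA).resolve_left hlt
    simp [this]
  · intro l hl hlA
    rcases List.mem_cons.1 hlA with rfl | h
    · exact ht' (by simp [hl])
    · exact (List.nodup_append.1 hnd').2.2 l (by simp [hl]) l h rfl

/-- Here `V` lies in the ungraded part of the corner, so the grading plays no role in the
contraction. -/
theorem maskedCorner_suffix (T : PlanarTheory d F S) {g : ℕ → Leg d F} {χ χ₀ : List ℕ → ℂ}
    {A M U V : List ℕ} {t : ℕ} (hcut : IsCut χ χ₀ V t) (hV : 2 ≤ V.length)
    (hnd : (A ++ M ++ (U ++ V)).Nodup) (ht : t ∉ A ++ M ++ (U ++ V)) (h0 : 0 ∉ V)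
    (hg : g t = T.maskedLeg g χ V) (ℓ : Mom d) :
    T.maskedCorner g χ A M (U ++ V) ℓ =
      T.maskedCorner g χ₀ A M (U ++ V) ℓ + T.maskedCorner g χ₀ A M (U ++ [t]) ℓ := by
  have hnd' : (U ++ V ++ A).Nodup :=
    (List.perm_append_comm.nodup_iff).1 (hnd.sublist (by simp))
  have ht' : t ∉ U ++ V ++ A := fun h => ht (by
    simp only [List.mem_append] at h ⊢; tauto)
  have htA : t ∉ A := fun h => ht' (by simp [h])
  have hVA : ∀ l ∈ V, l ∉ A := fun l hl hA =>
    (List.nodup_append.1 hnd').2.2 l (by simp [hl]) l hA rfl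
  refine T.maskedCorner_contract hcut hV rfl (by simp) hnd' ht' ?_ rfl ?_ ?_ hVA hg ℓ
  · intro h
    obtain ⟨v, hv⟩ := List.exists_mem_of_ne_nil V (by rintro rfl; simp at hV)
    rcases List.mem_cons.1 (h.subset hv) with rfl | h'
    · exact h0 hv
    · exact (List.nodup_append.1 hnd).2.2 v (by simp [h']) v (by simp [hv]) rfl
  · intro l _; simp [htA]
  · exact fun l _ h => h

theorem sum_corner_shift (f : ℕ → ℕ → ℂ) (v z : ℕ) :
    ∑ i ∈ Finset.Ico v (v + z), ∑ m ∈ Finset.Ico i (v + z), f i m =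
      ∑ i ∈ Finset.range z, ∑ m ∈ Finset.range (z - i), f (v + i) (v + i + m) := by
  rw [Finset.sum_Ico_eq_sum_range, Nat.add_sub_cancel_left]
  refine Finset.sum_congr rfl fun i _ => ?_
  rw [Finset.sum_Ico_eq_sum_range, Nat.add_sub_add_left]

/-- The corner diagrams with a tree line joining the first legs `V`. -/
theorem maskedCorners_prefix (T : PlanarTheory d F S) {g : ℕ → Leg d F} {χ χ₀ : List ℕ → ℂ}
    {V Z : List ℕ} {t : ℕ} (hcut : IsCut χ χ₀ V t) (hV : 2 ≤ V.length)
    (hnd : (V ++ Z).Nodup) (ht : t ∉ V ++ Z) (h0 : 0 ∉ V ++ Z)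
    (hg : g t = T.maskedLeg g χ V) (ℓ : Mom d) :
    T.maskedCorners g χ (V ++ Z) ℓ =
      T.maskedCorners g χ₀ (V ++ Z) ℓ + T.maskedCorners g χ₀ (t :: Z) ℓ := by
  have h0V : 0 ∉ V := fun h => h0 (by simp [h])
  obtain ⟨v, V', hVv⟩ := List.exists_cons_of_ne_nil (show V ≠ [] by rintro rfl; simp at hV)
  -- The loop line after leg `i` cuts `V`, so no tree line joins `V`: its first label lies in `A`, a
  -- sublist within `A` is too short, and a straddling one would start in `C`.
  have hlow : ∀ i ∈ Finset.Ico 1 V.length, ∀ m ∈ Finset.Ico i (V ++ Z).length,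
      T.maskedCorner g χ ((V ++ Z).take i) (((V ++ Z).take m).drop i) ((V ++ Z).drop m) ℓ =
      T.maskedCorner g χ₀ ((V ++ Z).take i) (((V ++ Z).take m).drop i) ((V ++ Z).drop m) ℓ := by
    intro i hi m hm
    rw [Finset.mem_Ico] at hi hm
    have hsplit := take_append_mid_append_drop (V ++ Z) hm.1
    have hA : v ∈ (V ++ Z).take i := by
      obtain ⟨k, rfl⟩ := Nat.exists_eq_add_of_le' hi.1
      simp [hVv]
    rw [← hsplit, List.nodup_append] at hnd
    have hvM : v ∉ ((V ++ Z).take m).drop i := fun h =>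
      (List.nodup_append.1 hnd.1).2.2 v hA v h rfl
    have hvC : v ∉ (V ++ Z).drop m := fun h => hnd.2.2 v (by simp [hA]) v h rfl
    have hvV : v ∈ V := by simp [hVv]
    refine T.maskedCorner_eq_of_not_infix hcut (fun h => ?_) (fun h => ?_) ℓ
    · rcases List.mem_cons.1 (h.subset hvV) with rfl | h'
      · exact h0V hvV
      · exact hvM h'
    · rcases infix_append_cases h with h | h | ⟨C0, C1, A1, A2, hC1, _, hVe, hCe, _⟩
      · exact hvC (h.subset hvV)
      · have := h.length_le
        rw [List.length_take] at this
        omega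
      · refine hvC ?_
        obtain ⟨w, C1', rfl⟩ := List.exists_cons_of_ne_nil hC1
        rw [hVv, List.cons_append] at hVe
        obtain ⟨rfl, _⟩ := List.cons.inj hVe
        rw [hCe]; simp
  -- The corner contains all of `V`. After contraction the indices drop by `V.length - 1`, hence the
  -- offsets `V.length + i` and `1 + i`.
  have hhigh : ∀ i m, i + m < Z.length →
      T.maskedCorner g χ ((V ++ Z).take (V.length + i))
        (((V ++ Z).take (V.length + i + m)).drop (V.length + i))
        ((V ++ Z).drop (V.length + i + m)) ℓ =
      T.maskedCorner g χ₀ ((V ++ Z).take (V.length + i))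
        (((V ++ Z).take (V.length + i + m)).drop (V.length + i))
        ((V ++ Z).drop (V.length + i + m)) ℓ +
      T.maskedCorner g χ₀ ((t :: Z).take (1 + i)) (((t :: Z).take (1 + i + m)).drop (1 + i))
        ((t :: Z).drop (1 + i + m)) ℓ := by
    intro i m _
    have hsplit := take_append_mid_append_drop (V ++ Z) (Nat.le_add_right (V.length + i) m)
    have e1 : (V ++ Z).take (V.length + i) = V ++ Z.take i := List.take_length_add_append _
    have e2 : (t :: Z).take (1 + i) = t :: Z.take i := by rw [Nat.add_comm, List.take_succ_cons]
    have e3 : ((V ++ Z).take (V.length + i + m)).drop (V.length + i) =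
        (Z.take (i + m)).drop i := by
      rw [Nat.add_assoc, List.take_length_add_append, List.drop_length_add_append]
    have e4 : ((t :: Z).take (1 + i + m)).drop (1 + i) = (Z.take (i + m)).drop i := by
      rw [Nat.add_assoc, Nat.add_comm 1 (i + m), Nat.add_comm 1 i, List.take_succ_cons,
        List.drop_succ_cons]
    have e5 : (V ++ Z).drop (V.length + i + m) = Z.drop (i + m) := by
      rw [Nat.add_assoc, List.drop_length_add_append]
    have e6 : (t :: Z).drop (1 + i + m) = Z.drop (i + m) := by
      rw [Nat.add_assoc, Nat.add_comm 1 (i + m), List.drop_succ_cons]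
    rw [e1, e3, e5] at hsplit
    rw [e1, e3, e5]
    rw [e2, e4, e6]
    refine T.maskedCorner_prefix hcut hV ?_ ?_ h0V hg ℓ
    · rw [hsplit]; exact hnd
    · rw [hsplit]; exact ht
  have hlen : (V ++ Z).length = V.length + Z.length := by simp
  have hlen' : (t :: Z).length = 1 + Z.length := by simp [Nat.add_comm]
  unfold maskedCorners
  rw [← Finset.sum_Ico_consecutive _ (show 1 ≤ V.length by omega)
      (show V.length ≤ (V ++ Z).length by omega),
    ← Finset.sum_Ico_consecutive _ (show 1 ≤ V.length by omega)
      (show V.length ≤ (V ++ Z).length by omega),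
    Finset.sum_congr rfl fun i hi => Finset.sum_congr rfl fun m hm => hlow i hi m hm,
    hlen, hlen', sum_corner_shift, sum_corner_shift, sum_corner_shift, add_assoc,
    ← Finset.sum_add_distrib]
  congr 1
  refine Finset.sum_congr rfl fun i hi => ?_
  rw [← Finset.sum_add_distrib]
  refine Finset.sum_congr rfl fun m hm => hhigh i m ?_
  rw [Finset.mem_range] at hi hm
  omega

/-- The corner diagrams with a tree line joining the last legs `V`. -/
theorem maskedCorners_suffix (T : PlanarTheory d F S) {g : ℕ → Leg d F} {χ χ₀ : List ℕ → ℂ}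
    {U V : List ℕ} {t : ℕ} (hcut : IsCut χ χ₀ V t) (hV : 2 ≤ V.length)
    (hnd : (U ++ V).Nodup) (ht : t ∉ U ++ V) (h0 : 0 ∉ U ++ V)
    (hg : g t = T.maskedLeg g χ V) (ℓ : Mom d) :
    T.maskedCorners g χ (U ++ V) ℓ =
      T.maskedCorners g χ₀ (U ++ V) ℓ + T.maskedCorners g χ₀ (U ++ [t]) ℓ := by
  have h0V : 0 ∉ V := fun h => h0 (by simp [h])
  have hV0 : V ≠ [] := by rintro rfl; simp at hV
  set w := V.getLast hV0 with hw
  have hwV : w ∈ V := List.getLast_mem hV0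
  -- The last label of `V` is in `C` and the corner starts inside `V`: a sublist within `C` is too
  -- short, and a straddling one would end in `A`.
  have hhigh : ∀ i m, 1 ≤ i → i ≤ m → U.length < m → m < (U ++ V).length →
      T.maskedCorner g χ ((U ++ V).take i) (((U ++ V).take m).drop i) ((U ++ V).drop m) ℓ =
      T.maskedCorner g χ₀ ((U ++ V).take i) (((U ++ V).take m).drop i) ((U ++ V).drop m) ℓ := by
    intro i m _ him hUm hm
    have hsplit := take_append_mid_append_drop (U ++ V) him
    have hC : w ∈ (U ++ V).drop m := by
      rw [hw, ← List.getLast_append_of_ne_nil (l := U) (by simp [hV0]) hV0]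
      have hne : (U ++ V).drop m ≠ [] := by
        rw [Ne, List.drop_eq_nil_iff]; omega
      rw [← List.getLast_drop hne]
      exact List.getLast_mem hne
    rw [← hsplit, List.nodup_append] at hnd
    have hwM : w ∉ ((U ++ V).take m).drop i := fun h => hnd.2.2 w (by simp [h]) w hC rfl
    have hwA : w ∉ (U ++ V).take i := fun h => hnd.2.2 w (by simp [h]) w hC rfl
    refine T.maskedCorner_eq_of_not_infix hcut (fun h => ?_) (fun h => ?_) ℓ
    · rcases List.mem_cons.1 (h.subset hwV) with h' | h'
      · rw [h'] at hwV; exact h0V hwV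
      · exact hwM h'
    · rcases infix_append_cases h with h | h | ⟨C0, C1, A1, A2, _, hA1, hVe, _, hAe⟩
      · have := h.length_le
        simp only [List.length_drop, List.length_append] at this
        omega
      · exact hwA (h.subset hwV)
      · refine hwA ?_
        have : w = A1.getLast hA1 := by
          rw [hw]
          simp only [hVe]
          exact List.getLast_append_of_ne_nil _ hA1
        rw [hAe, this]
        exact List.mem_append_left _ (List.getLast_mem hA1)
  have hlow : ∀ i m, 1 ≤ i → i ≤ m → m ≤ U.length →
      T.maskedCorner g χ ((U ++ V).take i) (((U ++ V).take m).drop i) ((U ++ V).drop m) ℓ =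
      T.maskedCorner g χ₀ ((U ++ V).take i) (((U ++ V).take m).drop i) ((U ++ V).drop m) ℓ +
      T.maskedCorner g χ₀ ((U ++ [t]).take i) (((U ++ [t]).take m).drop i)
        ((U ++ [t]).drop m) ℓ := by
    intro i m _ him hm
    have hsplit := take_append_mid_append_drop (U ++ V) him
    rw [List.take_append_of_le_length hm, List.take_append_of_le_length (him.trans hm),
      List.drop_append_of_le_length hm] at hsplit ⊢
    rw [List.take_append_of_le_length hm, List.take_append_of_le_length (him.trans hm),
      List.drop_append_of_le_length hm]
    refine T.maskedCorner_suffix hcut hV ?_ ?_ h0V hg ℓ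
    · rw [hsplit]; exact hnd
    · rw [hsplit]; exact ht
  -- The contracted list has fewer corners; padding with zeros for `m > U.length` puts both sums on
  -- the same index set.
  have hext : T.maskedCorners g χ₀ (U ++ [t]) ℓ =
      ∑ i ∈ Finset.Ico 1 (U ++ V).length, ∑ m ∈ Finset.Ico i (U ++ V).length,
        if m ≤ U.length then T.maskedCorner g χ₀ ((U ++ [t]).take i)
          (((U ++ [t]).take m).drop i) ((U ++ [t]).drop m) ℓ else 0 := by
    rw [maskedCorners]
    have hlen : (U ++ [t]).length = U.length + 1 := by simp
    have hlen' : (U ++ V).length = U.length + V.length := by simp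
    have h1 : ∀ i, ∑ m ∈ Finset.Ico i (U ++ V).length,
        (if m ≤ U.length then T.maskedCorner g χ₀ ((U ++ [t]).take i)
          (((U ++ [t]).take m).drop i) ((U ++ [t]).drop m) ℓ else 0) =
        ∑ m ∈ Finset.Ico i (U ++ [t]).length, T.maskedCorner g χ₀ ((U ++ [t]).take i)
          (((U ++ [t]).take m).drop i) ((U ++ [t]).drop m) ℓ := by
      intro i
      rw [← Finset.sum_filter]
      refine Finset.sum_congr ?_ fun _ _ => rfl
      ext m
      simp only [Finset.mem_filter, Finset.mem_Ico]
      omega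
    simp only [h1]
    refine Finset.sum_subset (fun i hi => ?_) fun i _ hi => ?_
    · rw [Finset.mem_Ico] at hi ⊢; omega
    · rw [Finset.mem_Ico] at *
      rw [Finset.Ico_eq_empty (by omega), Finset.sum_empty]
  rw [hext, maskedCorners, maskedCorners, ← Finset.sum_add_distrib]
  refine Finset.sum_congr rfl fun i hi => ?_
  rw [← Finset.sum_add_distrib]
  refine Finset.sum_congr rfl fun m hm => ?_
  rw [Finset.mem_Ico] at hi hm
  split_ifs with h
  · exact hlow i m hi.1 hm.1 h
  · rw [add_zero]
    exact hhigh i m hi.1 hm.1 (by omega) hm.2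

/-- The loop is the sum of the diagrams without a line joining the first legs `V`, and of those
with this line. -/
theorem maskedLoop_prefix (T : PlanarTheory d F S) {g : ℕ → Leg d F} {χ χ₀ : List ℕ → ℂ}
    {V Z : List ℕ} {t : ℕ} (hcut : IsCut χ χ₀ V t) (hV : 2 ≤ V.length)
    (hnd : (V ++ Z).Nodup) (ht : t ∉ V ++ Z) (h0 : 0 ∉ V ++ Z) (ht0 : t ≠ 0)
    (hg : g t = T.maskedLeg g χ V) (ℓ : Mom d) :
    T.maskedLoop g χ (V ++ Z) ℓ =
      T.maskedLoop g χ₀ (V ++ Z) ℓ + T.maskedLoop g χ₀ (t :: Z) ℓ := by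
  simp only [maskedLoop]
  rw [T.maskedOpen_prefix hcut hV hnd ht h0 ht0 hg, T.maskedCorners_prefix hcut hV hnd ht h0 hg]
  ring

/-- The loop is the sum of the diagrams without a line joining the last legs `V`, and of those
with this line. -/
theorem maskedLoop_suffix (T : PlanarTheory d F S) {g : ℕ → Leg d F} {χ χ₀ : List ℕ → ℂ}
    {U V : List ℕ} {t : ℕ} (hcut : IsCut χ χ₀ V t) (hV : 2 ≤ V.length)
    (hnd : (U ++ V).Nodup) (ht : t ∉ U ++ V) (h0 : 0 ∉ U ++ V) (ht0 : t ≠ 0)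
    (hg : g t = T.maskedLeg g χ V) (ℓ : Mom d) :
    T.maskedLoop g χ (U ++ V) ℓ =
      T.maskedLoop g χ₀ (U ++ V) ℓ + T.maskedLoop g χ₀ (U ++ [t]) ℓ := by
  have hopen := T.maskedOpen_contract (Z := []) hcut hV (by simpa using hnd) (by simpa using ht)
    (by simpa using h0) ht0 hg ℓ
  rw [List.append_nil] at hopen
  simp only [maskedLoop]
  rw [hopen, T.maskedCorners_suffix hcut hV hnd ht h0 hg]
  ring

end PlanarTheory

end LoopContraction

/-! ### Regularity in the shift parameter -/

noncomputable section Regularity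

variable {d : ℕ} {F S : Type*} [Fintype F] [DecidableEq F] [Fintype S]

/-- A momentum that moves along a straight line in the direction `q`. -/
def AffineAlong (q : Mom d) (P : ℂ → Mom d) : Prop :=
  ∃ (p : Mom d) (c : ℂ), ∀ z, P z = p + (z * c) • q

namespace AffineAlong

variable {q : Mom d} {P Q : ℂ → Mom d}

theorem zero : AffineAlong q (fun _ => (0 : Mom d)) := ⟨0, 0, fun z => by simp⟩

theorem add (hP : AffineAlong q P) (hQ : AffineAlong q Q) : AffineAlong q fun z => P z + Q z := by
  obtain ⟨p, c, hp⟩ := hP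
  obtain ⟨p', c', hp'⟩ := hQ
  refine ⟨p + p', c + c', fun z => ?_⟩
  simp only [hp, hp', mul_add, add_smul]
  abel

theorem neg (hP : AffineAlong q P) : AffineAlong q fun z => -P z := by
  obtain ⟨p, c, hp⟩ := hP
  refine ⟨-p, -c, fun z => ?_⟩
  simp only [hp, mul_neg, neg_smul, neg_add]

end AffineAlong

/-- A leg whose momentum moves along `q` and whose wavefunction has components in `𝒜`. -/
structure RegularLeg (𝒜 : Subalgebra ℂ (ℂ → ℂ)) (q : Mom d) (x : ℂ → Leg d F) : Prop where
  mom : AffineAlong q fun z => (x z).mom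
  wave : ∀ a, (fun z => (x z).wave a) ∈ 𝒜

theorem const_mem (𝒜 : Subalgebra ℂ (ℂ → ℂ)) (c : ℂ) : (fun _ : ℂ => c) ∈ 𝒜 :=
  𝒜.algebraMap_mem c

theorem fun_sum_mem {ι : Type*} (𝒜 : Subalgebra ℂ (ℂ → ℂ)) {s : Finset ι} {f : ι → ℂ → ℂ}
    (h : ∀ i ∈ s, f i ∈ 𝒜) : (fun z => ∑ i ∈ s, f i z) ∈ 𝒜 := by
  have := 𝒜.sum_mem h
  convert this using 1
  funext z
  simp

theorem fun_prod_mem {ι : Type*} (𝒜 : Subalgebra ℂ (ℂ → ℂ)) {s : Finset ι} {f : ι → ℂ → ℂ}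
    (h : ∀ i ∈ s, f i ∈ 𝒜) : (fun z => ∏ i ∈ s, f i z) ∈ 𝒜 := by
  have := 𝒜.prod_mem h
  convert this using 1
  funext z
  simp

theorem fun_mul_mem (𝒜 : Subalgebra ℂ (ℂ → ℂ)) {f g : ℂ → ℂ} (hf : f ∈ 𝒜) (hg : g ∈ 𝒜) :
    (fun z => f z * g z) ∈ 𝒜 := 𝒜.mul_mem hf hg

theorem fun_add_mem (𝒜 : Subalgebra ℂ (ℂ → ℂ)) {f g : ℂ → ℂ} (hf : f ∈ 𝒜) (hg : g ∈ 𝒜) :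
    (fun z => f z + g z) ∈ 𝒜 := 𝒜.add_mem hf hg

theorem polynomial_mem {𝒜 : Subalgebra ℂ (ℂ → ℂ)} (hid : (fun z : ℂ => z) ∈ 𝒜)
    (p : Polynomial ℂ) : (fun z => p.eval z) ∈ 𝒜 := by
  simp only [Polynomial.eval_eq_sum_range]
  exact fun_sum_mem 𝒜 fun i _ => fun_mul_mem 𝒜 (const_mem 𝒜 _) (𝒜.pow_mem hid i)

namespace PlanarTheory

variable {𝒜 : Subalgebra ℂ (ℂ → ℂ)} {q : Mom d}

theorem num_mem (T : PlanarTheory d F S) (hT : T.PolynomialAlong q)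
    (hid : (fun z : ℂ => z) ∈ 𝒜) {P : ℂ → Mom d} (hP : AffineAlong q P) (a b : F) :
    (fun z => T.num (P z) a b) ∈ 𝒜 := by
  obtain ⟨p, c, hp⟩ := hP
  obtain ⟨R, hR⟩ := hT.1 p a b
  have : (fun z => T.num (P z) a b) =
      fun z => (R.comp (Polynomial.X * Polynomial.C c)).eval z := by
    funext z
    rw [hp, hR]
    simp only [Polynomial.eval_comp, Polynomial.eval_mul, Polynomial.eval_X, Polynomial.eval_C]
  rw [this]
  exact polynomial_mem hid _

/-- Expanding each wavefunction in unit vectors separates the two dependences on `z`: the components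
lie in `𝒜`, and the vertex at constant wavefunctions is polynomial along `q`. -/
theorem vtx_mem (T : PlanarTheory d F S) (hT : T.PolynomialAlong q)
    (hid : (fun z : ℂ => z) ∈ 𝒜) {L : List (ℂ → Leg d F)} (hL : ∀ x ∈ L, RegularLeg 𝒜 q x) :
    (fun z => T.vtx (L.map fun x => x z)) ∈ 𝒜 := by
  have hreg : ∀ i : Fin L.length, RegularLeg 𝒜 q L[(i : ℕ)] := fun i =>
    hL _ (List.getElem_mem i.2)
  choose p c hp using fun i => (hreg i).mom
  have key : (fun z => T.vtx (L.map fun x => x z)) = fun z => ∑ r : Fin L.length → F,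
      (∏ i : Fin L.length, (L[(i : ℕ)] z).wave (r i)) *
        T.vertex L.length (fun i => p i + (z * c i) • q) (fun i => unitWave (r i)) := by
    funext z
    rw [T.vtx_of_length (r := L.length) _ (by simp)]
    simp only [List.getElem_map]
    have hw : (fun i : Fin L.length => (L[(i : ℕ)] z).wave) =
        fun i : Fin L.length => ∑ a : F, (L[(i : ℕ)] z).wave a • (unitWave a : F → ℂ) := by
      funext i
      exact (sum_smul_unitWave _).symm
    have hm : (fun i : Fin L.length => (L[(i : ℕ)] z).mom) = fun i => p i + (z * c i) • q :=
      funext fun i => hp i z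
    rw [hw, hm, MultilinearMap.map_sum]
    refine Finset.sum_congr rfl fun r _ => ?_
    rw [MultilinearMap.map_smul_univ, smul_eq_mul]
  rw [key]
  refine fun_sum_mem 𝒜 fun r _ => fun_mul_mem 𝒜 (fun_prod_mem 𝒜 fun i _ => (hreg i).wave _) ?_
  obtain ⟨R, hR⟩ := hT.2 L.length p c fun i => unitWave (r i)
  simp only [hR]
  exact polynomial_mem hid R

theorem affineAlong_labelMom {γ : ℂ → ℕ → Leg d F} {L : List ℕ}
    (h : ∀ l ∈ L, AffineAlong q fun z => (γ z l).mom) :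
    AffineAlong q fun z => labelMom (γ z) L := by
  induction L with
  | nil => simpa only [labelMom_nil] using AffineAlong.zero
  | cons l L ih =>
    simp only [labelMom_cons]
    exact (h l List.mem_cons_self).add (ih fun i hi => h i (List.mem_cons_of_mem _ hi))

theorem regularLeg_unitWave {P : ℂ → Mom d} (hP : AffineAlong q P) (a : F) :
    RegularLeg 𝒜 q fun z => (⟨P z, unitWave a⟩ : Leg d F) :=
  ⟨hP, fun _ => const_mem 𝒜 _⟩

theorem regularLeg_const_wave {P : ℂ → Mom d} (hP : AffineAlong q P) (v : F → ℂ) :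
    RegularLeg 𝒜 q fun z => (⟨P z, v⟩ : Leg d F) :=
  ⟨hP, fun _ => const_mem 𝒜 _⟩

/-- The propagator of the line into which the labels `B` join is in `𝒜`. -/
def RegularLine (𝒜 : Subalgebra ℂ (ℂ → ℂ)) (γ : ℂ → ℕ → Leg d F) (χ : List ℕ → ℂ)
    (B : List ℕ) : Prop :=
  (fun z => χ B * propFactor (labelMom (γ z) B)) ∈ 𝒜

/-- The list `pre` and the condition `p` allow one statement for trees (nothing in front, valence
bound) and for corners (the opened loop in front, no bound). -/
theorem splitSum_mem (T : PlanarTheory d F S) (hT : T.PolynomialAlong q)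
    (hid : (fun z : ℂ => z) ∈ 𝒜) {J : ℂ → List ℕ → Leg d F} {x : ℂ → Leg d F}
    {pre : List (ℂ → Leg d F)} {L : List ℕ} (hpre : ∀ y ∈ pre, RegularLeg 𝒜 q y)
    (hx : RegularLeg 𝒜 q x) (p : List (List ℕ) → Prop) [DecidablePred p]
    (hJ : ∀ s, s.flatten = L → (∀ B ∈ s, B ≠ []) → p s → ∀ B ∈ s, RegularLeg 𝒜 q fun z => J z B) :
    (fun z => splitSum (fun s => if p s then
      T.vtx (pre.map (fun y => y z) ++ (s.map (J z) ++ [x z])) else 0) L) ∈ 𝒜 := by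
  refine fun_sum_mem 𝒜 fun s hs => ?_
  rw [mem_splits] at hs
  beta_reduce
  split_ifs with h
  · have := T.vtx_mem hT hid (L := pre ++ (s.map (fun B z => J z B) ++ [x])) ?_
    · simpa [Function.comp_def] using this
    · intro y hy
      simp only [List.mem_append, List.mem_map, List.mem_singleton] at hy
      rcases hy with hy | ⟨B, hB, rfl⟩ | rfl
      · exact hpre y hy
      · exact hJ s hs.1 hs.2 h B hB
      · exact hx
  · exact const_mem 𝒜 0

theorem maskedAux_mem (T : PlanarTheory d F S) (hT : T.PolynomialAlong q)
    (hid : (fun z : ℂ => z) ∈ 𝒜) {γ : ℂ → ℕ → Leg d F} {χ : List ℕ → ℂ} (m : ℕ) {L : List ℕ}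
    (hleg : ∀ l ∈ L, RegularLeg 𝒜 q fun z => γ z l)
    (hline : ∀ B, B <:+: L → 2 ≤ B.length → RegularLine 𝒜 γ χ B) (a : F) :
    (fun z => T.maskedAux (γ z) χ m L a) ∈ 𝒜 := by
  induction m generalizing L a with
  | zero => exact const_mem 𝒜 0
  | succ m ih =>
    by_cases h1 : L.length = 1
    · obtain ⟨l, rfl⟩ := List.length_eq_one_iff.1 h1
      exact (hleg l (by simp)).wave a
    · simp only [maskedAux_succ _ _ _ _ h1]
      rcases Nat.lt_or_ge L.length 2 with h2 | h2
      · have : L = [] := List.length_eq_zero_iff.1 (by omega)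
        subst this
        simp only [splitSum_nil_of_two_le, mul_zero, Finset.sum_const_zero]
        exact const_mem 𝒜 0
      have hmom := affineAlong_labelMom (fun l hl => (hleg l hl).mom)
      refine fun_mul_mem 𝒜 (hline L List.infix_rfl h2) (fun_sum_mem 𝒜 fun b _ =>
        fun_mul_mem 𝒜 (T.num_mem hT hid hmom a b) ?_)
      refine T.splitSum_mem hT hid (pre := []) (by simp)
        (regularLeg_unitWave hmom.neg b) _ fun s hs _ _ B hB => ?_
      have hBL : B <:+: L := hs ▸ flatten_infix_of_mem hB
      exact ⟨affineAlong_labelMom fun l hl => (hleg l (hBL.subset hl)).mom,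
        fun a => ih (fun l hl => hleg l (hBL.subset hl)) (fun C hC => hline C (hC.trans hBL)) a⟩

theorem regularLeg_maskedLeg (T : PlanarTheory d F S) (hT : T.PolynomialAlong q)
    (hid : (fun z : ℂ => z) ∈ 𝒜) {γ : ℂ → ℕ → Leg d F} {χ : List ℕ → ℂ} {L : List ℕ}
    (hleg : ∀ l ∈ L, RegularLeg 𝒜 q fun z => γ z l)
    (hline : ∀ B, B <:+: L → 2 ≤ B.length → RegularLine 𝒜 γ χ B) :
    RegularLeg 𝒜 q fun z => T.maskedLeg (γ z) χ L :=
  ⟨affineAlong_labelMom fun l hl => (hleg l hl).mom, T.maskedAux_mem hT hid _ hleg hline⟩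

theorem maskedAmp_mem (T : PlanarTheory d F S) (hT : T.PolynomialAlong q)
    (hid : (fun z : ℂ => z) ∈ 𝒜) {γ : ℂ → ℕ → Leg d F} {χ : List ℕ → ℂ} {L : List ℕ}
    {x : ℂ → Leg d F} (hx : RegularLeg 𝒜 q x)
    (hleg : ∀ l ∈ L, RegularLeg 𝒜 q fun z => γ z l)
    (hline : ∀ B, B <:+: L → 2 ≤ B.length → B.length < L.length → RegularLine 𝒜 γ χ B) :
    (fun z => T.maskedAmp (γ z) χ L (x z)) ∈ 𝒜 := by
  refine T.splitSum_mem hT hid (pre := []) (by simp) hx _ fun s hs hne h2 B hB => ?_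
  have hBL : B <:+: L := hs ▸ flatten_infix_of_mem hB
  have := length_lt_of_mem_split hB hne h2
  rw [hs] at this
  exact T.regularLeg_maskedLeg hT hid (fun l hl => hleg l (hBL.subset hl))
    fun C hC hC2 => hline C (hC.trans hBL) hC2 (hC.length_le.trans_lt this)

/-- Regularity of all lines of the one-loop diagrams with legs `L`, apart from the loop line between
the last and the first leg. -/
structure RegularLoop (𝒜 : Subalgebra ℂ (ℂ → ℂ)) (q : Mom d) (γ : ℂ → ℕ → Leg d F)
    (χ : List ℕ → ℂ) (L : List ℕ) (ℓ : ℂ → Mom d) : Prop where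
  leg : ∀ l ∈ L, RegularLeg 𝒜 q fun z => γ z l
  loopMom : AffineAlong q ℓ
  mask : ∀ B, χ (0 :: B) = 1
  tree : ∀ B, B <:+: L → 2 ≤ B.length → RegularLine 𝒜 γ χ B
  loop : ∀ A C, A ++ C = L → A ≠ [] → C ≠ [] →
    (fun z => propFactor (ℓ z + labelMom (γ z) A)) ∈ 𝒜
  corner : ∀ A M C, A ++ M ++ C = L → A ≠ [] → C ≠ [] → RegularLine 𝒜 γ χ (C ++ A)

theorem labelMom_update_zero (g : ℕ → Leg d F) (x : Leg d F) {L : List ℕ} (h0 : 0 ∉ L) :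
    labelMom (Function.update g 0 x) L = labelMom g L :=
  labelMom_congr fun l hl => by
    rw [Function.update_of_ne]
    rintro rfl; exact h0 hl

theorem RegularLoop.maskedOpen_mem {T : PlanarTheory d F S} (hT : T.PolynomialAlong q)
    (hid : (fun z : ℂ => z) ∈ 𝒜) {γ : ℂ → ℕ → Leg d F} {χ : List ℕ → ℂ} {L : List ℕ}
    {ℓ : ℂ → Mom d} (h : RegularLoop 𝒜 q γ χ L ℓ) (h0 : 0 ∉ L) :
    (fun z => T.maskedOpen (γ z) χ L (ℓ z)) ∈ 𝒜 := by
  refine fun_sum_mem 𝒜 fun a _ => fun_sum_mem 𝒜 fun b _ =>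
    fun_mul_mem 𝒜 (T.num_mem hT hid h.loopMom a b) ?_
  refine T.maskedAmp_mem (γ := fun z => Function.update (γ z) 0 ⟨ℓ z, unitWave a⟩) hT hid
    (regularLeg_const_wave h.loopMom.neg _) (fun l hl => ?_) fun B hB hB2 hBlt => ?_
  · by_cases hl0 : l = 0
    · subst hl0
      simp only [Function.update_self]
      exact regularLeg_unitWave h.loopMom a
    · simp only [Function.update_of_ne hl0]
      exact h.leg l ((List.mem_cons.1 hl).resolve_left hl0)
  -- A line without the label `0` is a tree line. One with it is the loop line after the legs `A`;
  -- `C` is nonempty because the block is proper.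
  · rcases infix_cons_cases hB with hB | ⟨A, C, rfl, rfl⟩
    · have hB0 : 0 ∉ B := fun h => h0 (hB.subset h)
      have := h.tree B hB hB2
      simpa only [RegularLine, labelMom_update_zero _ _ hB0] using this
    · have hA0 : 0 ∉ A := fun h => h0 (by simp [h])
      have hA : A ≠ [] := by rintro rfl; simp at hB2
      have hC : C ≠ [] := by rintro rfl; simp at hBlt
      simp only [RegularLine, labelMom_cons, Function.update_self, labelMom_update_zero _ _ hA0,
        h.mask, one_mul]
      exact h.loop A C rfl hA hC

theorem RegularLoop.maskedCorner_mem {T : PlanarTheory d F S} (hT : T.PolynomialAlong q)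
    (hid : (fun z : ℂ => z) ∈ 𝒜) {γ : ℂ → ℕ → Leg d F} {χ : List ℕ → ℂ} {A M C : List ℕ}
    {ℓ : ℂ → Mom d} (h : RegularLoop 𝒜 q γ χ (A ++ M ++ C) ℓ) (h0 : 0 ∉ A ++ M ++ C)
    (hA : A ≠ []) (hC : C ≠ []) :
    (fun z => T.maskedCorner (γ z) χ A M C (ℓ z)) ∈ 𝒜 := by
  have hp : AffineAlong q fun z => ℓ z + labelMom (γ z) A :=
    h.loopMom.add (affineAlong_labelMom fun l hl => (h.leg l (by simp [hl])).mom)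
  refine fun_mul_mem 𝒜 (h.loop A (M ++ C) (by simp) hA (by simp [hC])) (fun_sum_mem 𝒜 fun a _ =>
    fun_sum_mem 𝒜 fun b _ => fun_mul_mem 𝒜 (T.num_mem hT hid hp a b) ?_)
  have h0M : 0 ∉ M := fun h => h0 (by simp [h])
  have hfirst : RegularLeg 𝒜 q fun z => T.maskedLeg (Function.update (γ z) 0
      ⟨ℓ z + labelMom (γ z) A, unitWave a⟩) χ (0 :: M) := by
    refine T.regularLeg_maskedLeg (γ := fun z => Function.update (γ z) 0
      ⟨ℓ z + labelMom (γ z) A, unitWave a⟩) hT hid (fun l hl => ?_) fun B hB hB2 => ?_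
    · by_cases hl0 : l = 0
      · subst hl0
        simp only [Function.update_self]
        exact regularLeg_unitWave hp a
      · simp only [Function.update_of_ne hl0]
        exact h.leg l (by simp [(List.mem_cons.1 hl).resolve_left hl0])
    · rcases infix_cons_cases hB with hB | ⟨M₁, M₂, rfl, rfl⟩
      · have hB0 : 0 ∉ B := fun h => h0M (hB.subset h)
        have := h.tree B (hB.trans ⟨A, C, rfl⟩) hB2
        simpa only [RegularLine, labelMom_update_zero _ _ hB0] using this
      · have hM0 : 0 ∉ M₁ := fun h => h0M (by simp [h])
        simp only [RegularLine, labelMom_cons, Function.update_self,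
          labelMom_update_zero _ _ hM0, h.mask, one_mul]
        -- The opened line carries `ℓ` plus the momentum of `A`, so adding `M₁` gives the loop line
        -- after `A ++ M₁`.
        have := h.loop (A ++ M₁) (M₂ ++ C) (by simp) (by simp [hA]) (by simp [hC])
        simpa only [labelMom_append, add_assoc] using this
  have := T.splitSum_mem hT hid (J := fun z => T.maskedLeg (T.gradeLabels (γ z) A) χ)
    (x := fun z => ⟨-(ℓ z + labelMom (γ z) A), fermSign T.odd (unitWave b)⟩)
    (pre := [_]) (L := C ++ A) (List.forall_mem_singleton.2 hfirst) (regularLeg_const_wave hp.neg _) (fun _ => True) ?_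
  · simpa using this
  · intro s hs _ _ B hB
    have hBL : B <:+: C ++ A := hs ▸ flatten_infix_of_mem hB
    have hmom : ∀ (z : ℂ) (D : List ℕ), labelMom (T.gradeLabels (γ z) A) D = labelMom (γ z) D := by
      intro z D
      refine labelMom_congr fun l _ => ?_
      rw [gradeLabels]; split_ifs <;> rfl
    refine T.regularLeg_maskedLeg (γ := fun z => T.gradeLabels (γ z) A) hT hid (fun l hl => ?_)
      fun D hD hD2 => ?_
    · have hreg : RegularLeg 𝒜 q fun z => γ z l := by
        rcases List.mem_append.1 (hBL.subset hl) with h' | h' <;> exact h.leg l (by simp [h'])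
      by_cases hlA : l ∈ A
      · simp only [gradeLabels, if_pos hlA]
        refine ⟨hreg.mom, fun e => ?_⟩
        by_cases he : T.odd e
        · simp only [fermSign, he, if_true]
          exact 𝒜.neg_mem (hreg.wave e)
        · simp only [fermSign, he]
          exact hreg.wave e
      · simpa only [gradeLabels, if_neg hlA] using hreg
    · simp only [RegularLine, hmom]
      -- Only a tree line straddling the junction of the corner needs the field `corner`.
      rcases infix_append_cases (hD.trans hBL) with h' | h' |
        ⟨C₀, C₁, A₁, A₂, hC₁, hA₁, rfl, rfl, rfl⟩
      · exact h.tree D (h'.trans ⟨A ++ M, [], by simp⟩) hD2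
      · exact h.tree D (h'.trans ⟨[], M ++ C, by simp⟩) hD2
      · exact h.corner A₁ (A₂ ++ M ++ C₀) C₁ (by simp) hA₁ hC₁

theorem RegularLoop.maskedCorners_mem {T : PlanarTheory d F S} (hT : T.PolynomialAlong q)
    (hid : (fun z : ℂ => z) ∈ 𝒜) {γ : ℂ → ℕ → Leg d F} {χ : List ℕ → ℂ} {L : List ℕ}
    {ℓ : ℂ → Mom d} (h : RegularLoop 𝒜 q γ χ L ℓ) (h0 : 0 ∉ L) :
    (fun z => T.maskedCorners (γ z) χ L (ℓ z)) ∈ 𝒜 := by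
  refine fun_sum_mem 𝒜 fun i hi => fun_sum_mem 𝒜 fun m hm => ?_
  rw [Finset.mem_Ico] at hi hm
  have hL := take_append_mid_append_drop L hm.1
  refine RegularLoop.maskedCorner_mem hT hid (by rwa [hL]) (by rwa [hL]) ?_ ?_
  · rw [Ne, List.take_eq_nil_iff]
    rintro (h | rfl)
    · omega
    · simp at hm
  · rw [Ne, List.drop_eq_nil_iff]; omega

theorem RegularLoop.maskedLoop_mem {T : PlanarTheory d F S} (hT : T.PolynomialAlong q)
    (hid : (fun z : ℂ => z) ∈ 𝒜) {γ : ℂ → ℕ → Leg d F} {χ : List ℕ → ℂ} {L : List ℕ}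
    {ℓ : ℂ → Mom d} (h : RegularLoop 𝒜 q γ χ L ℓ) (h0 : 0 ∉ L)
    (hℓ : (fun z => propFactor (ℓ z)) ∈ 𝒜) :
    (fun z => T.maskedLoop (γ z) χ L (ℓ z)) ∈ 𝒜 :=
  fun_add_mem 𝒜 (fun_mul_mem 𝒜 hℓ (h.maskedOpen_mem hT hid h0)) (h.maskedCorners_mem hT hid h0)

end PlanarTheory

/-- For a block of at least two labels containing `t`, the expansion is strictly longer than `V`, so
`χ` and `χ₀` agree on it. This lets regular lines be transferred between a loop and its contraction.
-/
theorem IsCut.expand {χ χ₀ : List ℕ → ℂ} {V : List ℕ} {t : ℕ} (h : IsCut χ χ₀ V t)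
    {B : List ℕ} (hB : B.Nodup) (hB2 : 2 ≤ B.length) :
    χ₀ (expand t V B) = χ₀ B := by
  by_cases ht : t ∈ B
  · obtain ⟨U, Z, rfl⟩ := List.append_of_mem ht
    rw [List.nodup_middle, List.nodup_cons, List.mem_append, not_or] at hB
    rw [expand_append, expand_cons_self, expand_of_notMem _ hB.1.1, expand_of_notMem _ hB.1.2,
      ← List.append_assoc, h.contract, h.of_ne]
    intro he
    have := congrArg List.length he
    simp only [List.length_append, List.length_cons] at this hB2
    omega
  · rw [expand_of_notMem _ ht]

namespace PlanarTheory

/-- Regularity is inherited when the legs `V` are contracted to one leg. -/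
theorem RegularLoop.contract {𝒜 : Subalgebra ℂ (ℂ → ℂ)} {q : Mom d} {γ : ℂ → ℕ → Leg d F}
    {χ χ₀ : List ℕ → ℂ} {U V Z : List ℕ} {t : ℕ} {ℓ : ℂ → Mom d}
    (h : RegularLoop 𝒜 q γ χ₀ (U ++ V ++ Z) ℓ) (hcut : IsCut χ χ₀ V t) (hV : V ≠ [])
    (hnd : (U ++ t :: Z).Nodup) (ht : RegularLeg 𝒜 q fun z => γ z t)
    (hmom : ∀ z, (γ z t).mom = labelMom (γ z) V) :
    RegularLoop 𝒜 q γ χ₀ (U ++ t :: Z) ℓ := by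
  have htUZ : t ∉ U ∧ t ∉ Z := by
    rw [List.nodup_middle, List.nodup_cons, List.mem_append, not_or] at hnd
    exact hnd.1
  have hexp : expand t V (U ++ t :: Z) = U ++ V ++ Z := by
    rw [expand_append, expand_cons_self, expand_of_notMem _ htUZ.1, expand_of_notMem _ htUZ.2,
      List.append_assoc]
  have hline : ∀ B, B.Nodup → 2 ≤ B.length → RegularLine 𝒜 γ χ₀ (expand t V B) →
      RegularLine 𝒜 γ χ₀ B := by
    intro B hB hB2 hr
    simpa only [RegularLine, labelMom_expand (hmom _), hcut.expand hB hB2] using hr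
  refine ⟨fun l hl => ?_, h.loopMom, h.mask, fun B hB hB2 => ?_, fun A C hAC hA hC => ?_,
    fun A M C hL hA hC => ?_⟩
  · by_cases hlt : l = t
    · subst hlt; exact ht
    · refine h.leg l ?_
      simp only [List.mem_append, List.mem_cons, hlt, false_or] at hl ⊢
      tauto
  · refine hline B (hnd.sublist hB.sublist) hB2 (h.tree _ ?_ ?_)
    · rw [← hexp]; exact expand_infix t V hB
    · exact hB2.trans (length_le_length_expand t hV B)
  · have := h.loop (expand t V A) (expand t V C) (by rw [← hexp, ← hAC, expand_append])
      (expand_ne_nil t hV hA) (expand_ne_nil t hV hC)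
    simpa only [labelMom_expand (hmom _)] using this
  · have hA' := List.length_pos_iff.2 hA
    have hC' := List.length_pos_iff.2 hC
    refine hline (C ++ A) ?_ (by simp only [List.length_append]; omega) ?_
    · refine (List.perm_append_comm.nodup_iff).1 (hnd.sublist ?_)
      rw [← hL]
      simp
    · rw [expand_append]
      exact h.corner (expand t V A) (expand t V M) (expand t V C)
        (by rw [← hexp, ← hL, expand_append, expand_append])
        (expand_ne_nil t hV hA) (expand_ne_nil t hV hC)

end PlanarTheory

end Regularity

/-! ### Residues at poles and the residue theorem in the plane -/

noncomputable section ResidueTheorem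

section Residues

/-- `∮ f dz / (2 π i) = c` on the circle of radius `R` around `w`. -/
def HasCircleIntegral (f : ℂ → ℂ) (w : ℂ) (R : ℝ) (c : ℂ) : Prop :=
  CircleIntegrable f w R ∧ (∮ z in C(w, R), f z) = 2 * Real.pi * Complex.I * c

namespace HasCircleIntegral

variable {f g : ℂ → ℂ} {w : ℂ} {R : ℝ} {c c' : ℂ}

theorem add (hf : HasCircleIntegral f w R c) (hg : HasCircleIntegral g w R c') :
    HasCircleIntegral (fun z => f z + g z) w R (c + c') :=
  ⟨hf.1.add hg.1, by rw [circleIntegral.integral_add hf.1 hg.1, hf.2, hg.2, mul_add]⟩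

theorem const_mul (k : ℂ) (hf : HasCircleIntegral f w R c) :
    HasCircleIntegral (fun z => k * f z) w R (k * c) :=
  ⟨hf.1.const_smul (a := k), by rw [circleIntegral.integral_const_mul, hf.2]; ring⟩

theorem congr (hR : 0 ≤ R) (hf : HasCircleIntegral f w R c)
    (h : Set.EqOn f g (Metric.sphere w R)) : HasCircleIntegral g w R c := by
  refine ⟨(circleIntegrable_congr (by rwa [abs_of_nonneg hR])).1 hf.1, ?_⟩
  rw [← circleIntegral.integral_congr hR h, hf.2]

theorem of_differentiableOn (hR : 0 ≤ R)
    (hf : ∀ z ∈ Metric.closedBall w R, DifferentiableAt ℂ f z) : HasCircleIntegral f w R 0 := by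
  have hc : ContinuousOn f (Metric.closedBall w R) := fun z hz =>
    (hf z hz).continuousAt.continuousWithinAt
  refine ⟨(hc.mono Metric.sphere_subset_closedBall).circleIntegrable hR, ?_⟩
  rw [mul_zero]
  exact Complex.circleIntegral_eq_zero_of_differentiable_on_off_countable hR
    Set.countable_empty hc fun z hz => hf z (Metric.ball_subset_closedBall hz.1)

theorem sub_pow_inv {s : ℂ} (hs : s ∈ Metric.ball w R) (k : ℕ) :
    HasCircleIntegral (fun z => ((z - s) ^ (k + 1))⁻¹) w R (if k = 0 then 1 else 0) := by
  have hR : 0 ≤ R := (dist_nonneg.trans_lt (Metric.mem_ball.1 hs)).le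
  constructor
  · refine ContinuousOn.circleIntegrable hR (ContinuousOn.inv₀ (by fun_prop) fun z hz h => ?_)
    have hz' : z = s := by simpa [sub_eq_zero] using h
    subst hz'
    rw [Metric.mem_ball] at hs
    rw [Metric.mem_sphere] at hz
    exact hs.ne hz
  · by_cases hk : k = 0
    · subst hk
      simp only [zero_add, pow_one, if_true, mul_one]
      exact circleIntegral.integral_sub_inv_of_mem_ball hs
    · rw [if_neg hk, mul_zero]
      have := circleIntegral.integral_sub_zpow_of_ne (n := -((k : ℤ) + 1)) (by omega) w s R
      rw [← this]
      rfl

end HasCircleIntegral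

theorem hasResidue_iff {f : ℂ → ℂ} {w c : ℂ} :
    HasResidue f w c ↔ ∀ᶠ R in 𝓝[>] (0 : ℝ), HasCircleIntegral f w R c := Iff.rfl

theorem hasBoundaryTerm_iff {f : ℂ → ℂ} {c : ℂ} :
    HasBoundaryTerm f c ↔ ∀ᶠ R in Filter.atTop, HasCircleIntegral f 0 R c := Iff.rfl

theorem eventually_closedBall {p : ℂ → Prop} {w : ℂ} (h : ∀ᶠ z in 𝓝 w, p z) :
    ∀ᶠ R in 𝓝[>] (0 : ℝ), ∀ z ∈ Metric.closedBall w R, p z := by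
  obtain ⟨ε, hε, hb⟩ := Metric.eventually_nhds_iff_ball.1 h
  filter_upwards [Ioo_mem_nhdsGT hε] with R hR z hz
  exact hb z (Metric.closedBall_subset_ball hR.2 hz)

namespace HasResidue

variable {f g : ℂ → ℂ} {w c c' : ℂ}

theorem add (hf : HasResidue f w c) (hg : HasResidue g w c') :
    HasResidue (fun z => f z + g z) w (c + c') := by
  rw [hasResidue_iff] at *
  filter_upwards [hf, hg] with R h1 h2 using h1.add h2

theorem const_mul (k : ℂ) (hf : HasResidue f w c) : HasResidue (fun z => k * f z) w (k * c) := by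
  rw [hasResidue_iff] at *
  filter_upwards [hf] with R h1 using h1.const_mul k

/-- Circles around `w` avoid `w`, so values at the pole, in particular defaults of division, are
irrelevant. -/
theorem congr (hf : HasResidue f w c) (h : f =ᶠ[𝓝[≠] w] g) : HasResidue g w c := by
  rw [hasResidue_iff] at *
  filter_upwards [hf, eventually_closedBall (eventually_nhdsWithin_iff.1 h),
    self_mem_nhdsWithin] with R h1 h2 hR
  refine h1.congr (le_of_lt hR) fun z hz => h2 z (Metric.sphere_subset_closedBall hz) ?_
  rintro rfl
  simp only [Metric.mem_sphere, dist_self] at hz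
  exact (ne_of_lt hR) hz

theorem of_analyticAt (hf : AnalyticAt ℂ f w) : HasResidue f w 0 := by
  rw [hasResidue_iff]
  filter_upwards [eventually_closedBall hf.eventually_analyticAt, self_mem_nhdsWithin] with R h hR
  exact HasCircleIntegral.of_differentiableOn (le_of_lt hR) fun z hz => (h z hz).differentiableAt

theorem sub_pow_inv (w : ℂ) (k : ℕ) :
    HasResidue (fun z => ((z - w) ^ (k + 1))⁻¹) w (if k = 0 then 1 else 0) := by
  rw [hasResidue_iff]
  filter_upwards [self_mem_nhdsWithin] with R hR
  exact HasCircleIntegral.sub_pow_inv (Metric.mem_ball_self hR) k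

theorem unique (hf : HasResidue f w c) (hg : HasResidue f w c') : c = c' := by
  obtain ⟨R, h1, h2⟩ := (hf.and hg).exists
  have h := h1.2.symm.trans h2.2
  have hpi : (2 * Real.pi * Complex.I : ℂ) ≠ 0 := by
    simp [Real.pi_ne_zero]
  exact mul_left_cancel₀ hpi h

end HasResidue

theorem analyticAt_dslope {h : ℂ → ℂ} {w : ℂ} (hh : AnalyticAt ℂ h w) :
    AnalyticAt ℂ (dslope h w) w := by
  obtain ⟨p, hp⟩ := hh
  exact ⟨_, hp.has_fpower_series_dslope_fslope⟩

/-- Write `h z = h w + (z - w) * dslope h w z`; the second term leaves an analytic function. -/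
theorem HasResidue.simple_pole {h : ℂ → ℂ} {w : ℂ} (hh : AnalyticAt ℂ h w) :
    HasResidue (fun z => (z - w)⁻¹ * h z) w (h w) := by
  have h1 := ((HasResidue.sub_pow_inv w 0).const_mul (h w)).add
    (HasResidue.of_analyticAt (analyticAt_dslope hh))
  simp only [if_true, mul_one, add_zero, zero_add, pow_one] at h1
  refine h1.congr ?_
  filter_upwards [self_mem_nhdsWithin] with z hz
  have hz' : z - w ≠ 0 := sub_ne_zero.2 hz
  have := sub_smul_dslope h w z
  rw [smul_eq_mul] at this
  rw [show h z = h w + (z - w) * dslope h w z by rw [this]; ring, mul_add,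
    inv_mul_cancel_left₀ hz', mul_comm]

/-- The principal part of a function at a pole. -/
def principalPart (s : ℂ) (n : ℕ) (c : ℕ → ℂ) (z : ℂ) : ℂ :=
  ∑ k ∈ Finset.range n, c k * ((z - s) ^ (k + 1))⁻¹

/-- Each `dslope` splits off one Taylor coefficient of the numerator and lowers the order of the
pole by one. -/
theorem exists_principalPart {f : ℂ → ℂ} {s : ℂ} (hf : MeromorphicAt f s) :
    ∃ n c h, AnalyticAt ℂ h s ∧ ∀ᶠ z in 𝓝[≠] s, f z = principalPart s n c z + h z := by
  obtain ⟨n, hn⟩ := hf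
  have key : ∀ (n : ℕ) (g : ℂ → ℂ), AnalyticAt ℂ g s → ∃ c h, AnalyticAt ℂ h s ∧
      ∀ᶠ z in 𝓝[≠] s, ((z - s) ^ n)⁻¹ * g z = principalPart s n c z + h z := by
    intro n
    induction n with
    | zero =>
      intro g hg
      exact ⟨fun _ => 0, g, hg, Filter.Eventually.of_forall fun z => by simp [principalPart]⟩
    | succ n ih =>
      intro g hg
      obtain ⟨c, h, hh, he⟩ := ih _ (analyticAt_dslope hg)
      refine ⟨Function.update c n (g s), h, hh, ?_⟩
      filter_upwards [he, self_mem_nhdsWithin] with z hz hne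
      have hz' : z - s ≠ 0 := sub_ne_zero.2 hne
      have hsum : principalPart s n (Function.update c n (g s)) z = principalPart s n c z :=
        Finset.sum_congr rfl fun k hk => by
          rw [Function.update_of_ne (Finset.mem_range.1 hk).ne]
      rw [principalPart, Finset.sum_range_succ, ← principalPart, hsum, Function.update_self,
        add_right_comm, ← hz]
      have := sub_smul_dslope g s z
      rw [smul_eq_mul] at this
      rw [show g z = (z - s) * dslope g s z + g s by rw [this]; ring, pow_succ]
      field_simp
  obtain ⟨c, h, hh, he⟩ := key n _ hn
  refine ⟨n, c, h, hh, ?_⟩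
  filter_upwards [he, self_mem_nhdsWithin] with z hz hne
  have hz' : z - s ≠ 0 := sub_ne_zero.2 hne
  rw [← hz, smul_eq_mul, inv_mul_cancel_left₀ (pow_ne_zero _ hz')]

theorem analyticAt_principalPart (s : ℂ) (n : ℕ) (c : ℕ → ℂ) {z : ℂ} (hz : z ≠ s) :
    AnalyticAt ℂ (principalPart s n c) z := by
  have : principalPart s n c = fun z => ∑ k ∈ Finset.range n, c k * ((z - s) ^ (k + 1))⁻¹ := rfl
  rw [this]
  refine Finset.analyticAt_fun_sum _ fun k _ => analyticAt_const.mul (AnalyticAt.inv ?_ ?_)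
  · exact (analyticAt_id.sub analyticAt_const).pow _
  · exact pow_ne_zero _ (sub_ne_zero.2 hz)

theorem hasCircleIntegral_principalPart (s : ℂ) (n : ℕ) (c : ℕ → ℂ) {w : ℂ} {R : ℝ}
    (hs : s ∈ Metric.ball w R) :
    HasCircleIntegral (principalPart s n c) w R (if n = 0 then 0 else c 0) := by
  have hR : 0 ≤ R := (dist_nonneg.trans_lt (Metric.mem_ball.1 hs)).le
  induction n with
  | zero =>
    have : principalPart s 0 c = fun _ => 0 := by funext z; simp [principalPart]
    rw [this]
    exact HasCircleIntegral.of_differentiableOn hR fun z _ => differentiableAt_const _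
  | succ n ih =>
    have h := ih.add ((HasCircleIntegral.sub_pow_inv hs n).const_mul (c n))
    convert h using 1
    · funext z
      rw [principalPart, Finset.sum_range_succ, ← principalPart]
    · by_cases hn : n = 0
      · subst hn; simp
      · simp [hn]

theorem MeromorphicAt.exists_hasResidue {f : ℂ → ℂ} {s : ℂ} (hf : MeromorphicAt f s) :
    ∃ c, HasResidue f s c := by
  obtain ⟨n, c, h, hh, he⟩ := exists_principalPart hf
  have hpp : HasResidue (principalPart s n c) s (if n = 0 then 0 else c 0) := by
    rw [hasResidue_iff]
    filter_upwards [self_mem_nhdsWithin] with R hR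
    exact hasCircleIntegral_principalPart s n c (Metric.mem_ball_self hR)
  refine ⟨_, (hpp.add (HasResidue.of_analyticAt hh)).congr ?_⟩
  filter_upwards [he] with z hz using hz.symm

/-- **Residue theorem** for a function on the complex plane with finitely many singularities, all of
them poles. -/
theorem exists_residues (S : Finset ℂ) : ∀ f : ℂ → ℂ, (∀ z ∉ S, AnalyticAt ℂ f z) →
    (∀ z ∈ S, MeromorphicAt f z) →
    ∃ r : ℂ → ℂ, (∀ s ∈ S, HasResidue f s (r s)) ∧ HasBoundaryTerm f (∑ s ∈ S, r s) := by
  classical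
  induction S using Finset.induction_on with
  | empty =>
    intro f hf _
    refine ⟨fun _ => 0, by simp, ?_⟩
    rw [Finset.sum_empty, hasBoundaryTerm_iff]
    filter_upwards [Filter.eventually_ge_atTop 0] with R hR
    exact HasCircleIntegral.of_differentiableOn hR fun z _ =>
      (hf z (Finset.notMem_empty z)).differentiableAt
  | insert s S hs ih =>
    intro f hf hm
    obtain ⟨n, c, h, hh, he⟩ := exists_principalPart (hm s (Finset.mem_insert_self s S))
    -- Subtracting the principal part and filling in the value at `s` removes this singularity
    -- without creating another one.
    set f' : ℂ → ℂ := fun z => if z = s then h s else f z - principalPart s n c z with hf'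
    have hoff : ∀ z, z ≠ s → f' =ᶠ[𝓝 z] fun z => f z - principalPart s n c z := by
      intro z hz
      filter_upwards [isOpen_ne.mem_nhds hz] with y hy
      simp only [hf']
      rw [if_neg hy]
    have hsum : ∀ z, z ≠ s → principalPart s n c z + f' z = f z := by
      intro z hz
      simp only [hf', if_neg hz]
      ring
    have hs' : AnalyticAt ℂ f' s := by
      refine hh.congr ?_
      filter_upwards [eventually_nhdsWithin_iff.1 he] with z hz
      simp only [hf']
      split_ifs with hzs
      · rw [hzs]
      · rw [hz hzs]; ring
    have ha : ∀ z ∉ S, AnalyticAt ℂ f' z := by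
      intro z hz
      by_cases hzs : z = s
      · rw [hzs]; exact hs'
      · exact ((hf z (by simp [hzs, hz])).sub (analyticAt_principalPart s n c hzs)).congr
          (hoff z hzs).symm
    have hme : ∀ z ∈ S, MeromorphicAt f' z := by
      intro z hz
      have hzs : z ≠ s := by rintro rfl; exact hs hz
      exact ((hm z (Finset.mem_insert_of_mem hz)).sub
        (analyticAt_principalPart s n c hzs).meromorphicAt).congr
          (nhdsWithin_le_nhds (hoff z hzs).symm)
    obtain ⟨r, hr, hB⟩ := ih f' ha hme
    · refine ⟨Function.update r s (if n = 0 then 0 else c 0), fun t ht => ?_, ?_⟩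
      · by_cases hts : t = s
        · subst hts
          rw [Function.update_self]
          have hpp : HasResidue (principalPart t n c) t (if n = 0 then 0 else c 0) := by
            rw [hasResidue_iff]
            filter_upwards [self_mem_nhdsWithin] with R hR
            exact hasCircleIntegral_principalPart t n c (Metric.mem_ball_self hR)
          have := hpp.add (HasResidue.of_analyticAt hs')
          rw [add_zero] at this
          refine this.congr ?_
          filter_upwards [self_mem_nhdsWithin] with z hz using hsum z hz
        · rw [Function.update_of_ne hts]
          have htS := (Finset.mem_insert.1 ht).resolve_left hts
          have := (HasResidue.of_analyticAt (analyticAt_principalPart s n c hts)).add (hr t htS)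
          rw [zero_add] at this
          refine this.congr (nhdsWithin_le_nhds ?_)
          filter_upwards [isOpen_ne.mem_nhds hts] with z hz using hsum z hz
      · have hsumS : ∑ t ∈ S, Function.update r s (if n = 0 then 0 else c 0) t = ∑ t ∈ S, r t :=
          Finset.sum_congr rfl fun t ht => Function.update_of_ne (by rintro rfl; exact hs ht) _ _
        rw [Finset.sum_insert hs, Function.update_self, hsumS]
        rw [hasBoundaryTerm_iff] at hB ⊢
        filter_upwards [hB, Filter.eventually_gt_atTop ‖s‖] with R hR hsR
        -- Once the circle encloses `s`, the principal part contributes its coefficient of `1 / (z -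
        -- s)`.
        have hsb : s ∈ Metric.ball (0 : ℂ) R := by simpa using hsR
        refine ((hasCircleIntegral_principalPart s n c hsb).add hR).congr
          ((norm_nonneg s).trans hsR.le) fun z hz => hsum z ?_
        rintro rfl
        simp only [Metric.mem_sphere, dist_zero_right] at hz
        exact hsR.ne hz

end Residues

end ResidueTheorem

/-! ### Kinematics of the shift and the lines that depend on it -/

noncomputable section Kinematics

section Products

variable {d : ℕ}

theorem mdot_comm (p q : Mom d) : mdot p q = mdot q p := by
  simp only [mdot, mul_comm]

theorem mdot_add_left (p p' q : Mom d) : mdot (p + p') q = mdot p q + mdot p' q := by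
  simp only [mdot, Pi.add_apply, add_mul, Finset.sum_add_distrib]
  ring

theorem mdot_smul_left (c : ℂ) (p q : Mom d) : mdot (c • p) q = c * mdot p q := by
  simp only [mdot, Pi.smul_apply, smul_eq_mul, mul_sub, Finset.mul_sum, mul_assoc]

theorem mdot_add_smul_self (p q : Mom d) (c : ℂ) :
    mdot (p + c • q) (p + c • q) = mdot p p + 2 * c * mdot p q + c ^ 2 * mdot q q := by
  rw [mdot_add_left, mdot_comm p, mdot_add_left, mdot_smul_left c q (p + c • q),
    mdot_comm q (p + c • q), mdot_add_left, mdot_smul_left, mdot_smul_left, mdot_comm q p]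
  ring

theorem mdot_neg_self (p : Mom d) : mdot (-p) (-p) = mdot p p := by
  simp [mdot]

theorem mdot_zero_left (q : Mom d) : mdot 0 q = 0 := by simp [mdot]

/-- The convention for null momenta agrees with `0⁻¹ = 0`, so the case distinction disappears. -/
theorem propFactor_eq (K : Mom d) : propFactor K = (mdot K K)⁻¹ := by
  rw [propFactor]
  split_ifs with h
  · rw [h, inv_zero]
  · rw [one_div]

theorem propFactor_neg (K : Mom d) : propFactor (-K) = propFactor K := by
  rw [propFactor_eq, propFactor_eq, mdot_neg_self]

theorem propFactor_of_null {K : Mom d} (h : mdot K K = 0) : propFactor K = 0 := by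
  rw [propFactor, if_pos h]

end Products

section Algebras

/-- The functions that are analytic at `z₀`. -/
def analyticSubalgebra (z₀ : ℂ) : Subalgebra ℂ (ℂ → ℂ) where
  carrier := {f | AnalyticAt ℂ f z₀}
  mul_mem' hf hg := hf.mul hg
  add_mem' hf hg := hf.add hg
  algebraMap_mem' _ := analyticAt_const

/-- The functions that are meromorphic at `z₀`. -/
def meromorphicSubalgebra (z₀ : ℂ) : Subalgebra ℂ (ℂ → ℂ) where
  carrier := {f | MeromorphicAt f z₀}
  mul_mem' hf hg := MeromorphicAt.mul hf hg
  add_mem' hf hg := MeromorphicAt.add hf hg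
  algebraMap_mem' c := MeromorphicAt.const c z₀

theorem mem_analyticSubalgebra {z₀ : ℂ} {f : ℂ → ℂ} :
    f ∈ analyticSubalgebra z₀ ↔ AnalyticAt ℂ f z₀ := Iff.rfl

theorem mem_meromorphicSubalgebra {z₀ : ℂ} {f : ℂ → ℂ} :
    f ∈ meromorphicSubalgebra z₀ ↔ MeromorphicAt f z₀ := Iff.rfl

theorem id_mem_analyticSubalgebra (z₀ : ℂ) : (fun z : ℂ => z) ∈ analyticSubalgebra z₀ :=
  analyticAt_id

theorem id_mem_meromorphicSubalgebra (z₀ : ℂ) : (fun z : ℂ => z) ∈ meromorphicSubalgebra z₀ :=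
  MeromorphicAt.id z₀

variable {d : ℕ} {q : Mom d} {P : ℂ → Mom d} {z₀ : ℂ}

theorem analyticAt_mdot_self (hP : AffineAlong q P) :
    AnalyticAt ℂ (fun z => mdot (P z) (P z)) z₀ := by
  obtain ⟨p, c, hp⟩ := hP
  simp only [hp, mdot_add_smul_self]
  fun_prop

theorem propFactor_mem_analytic (hP : AffineAlong q P) (h : mdot (P z₀) (P z₀) ≠ 0) :
    (fun z => propFactor (P z)) ∈ analyticSubalgebra z₀ := by
  simp only [propFactor_eq, mem_analyticSubalgebra]
  exact (analyticAt_mdot_self hP).inv h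

theorem propFactor_mem_meromorphic (hP : AffineAlong q P) :
    (fun z => propFactor (P z)) ∈ meromorphicSubalgebra z₀ := by
  simp only [propFactor_eq, mem_meromorphicSubalgebra]
  exact (analyticAt_mdot_self hP).meromorphicAt.inv

end Algebras

/-- Consecutive sublists of `1, ..., n` are again ranges, so lines are classified by a start and a
length. -/
theorem append_eq_range' {X B Y : List ℕ} {s n : ℕ} (h : X ++ B ++ Y = List.range' s n) :
    X = List.range' s X.length ∧ B = List.range' (s + X.length) B.length ∧
      Y = List.range' (s + X.length + B.length) Y.length ∧
      X.length + B.length + Y.length = n := by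
  have hn : X.length + B.length + Y.length = n := by
    have := congrArg List.length h
    simpa [add_assoc] using this
  have h' : X ++ (B ++ Y) = List.range' s X.length ++ (List.range' (s + X.length) B.length ++
      List.range' (s + X.length + B.length) Y.length) := by
    rw [List.range'_append_1, List.range'_append_1, ← List.append_assoc, h, ← hn, add_assoc]
  obtain ⟨h1, h2⟩ := List.append_inj h' (by simp)
  obtain ⟨h3, h4⟩ := List.append_inj h2 (by simp)
  exact ⟨h1, h3, h4, hn⟩

namespace ShiftData

variable {d : ℕ} {F S : Type*} [Fintype F] [DecidableEq F] [Fintype S] (X : ShiftData d F)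

theorem leg_mom_one (z : ℂ) : (X.leg z 1).mom = X.k 1 + z • X.q := by simp [leg]

theorem leg_mom_n (h : 2 ≤ X.n) (z : ℂ) : (X.leg z X.n).mom = X.k X.n - z • X.q := by
  rw [leg, if_neg (by omega), if_pos rfl]

theorem leg_mom_of_ne (z : ℂ) {i : ℕ} (h1 : i ≠ 1) (hn : i ≠ X.n) :
    (X.leg z i).mom = X.k i := by
  rw [leg, if_neg h1, if_neg hn]

theorem labelMom_range'_succ (g : ℕ → Leg d F) (i k : ℕ) :
    labelMom g (List.range' i (k + 1)) = labelMom g (List.range' i k) + (g (i + k)).mom := by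
  rw [List.range'_1_concat, labelMom_append, labelMom_cons, labelMom_nil, add_zero]

theorem labelMom_mid (z : ℂ) {i k : ℕ} (hi : 2 ≤ i) (hk : i + k < X.n) :
    labelMom (X.leg z) (List.range' i (k + 1)) = X.K i (i + k) := by
  induction k with
  | zero =>
    rw [labelMom_range'_succ, List.range'_zero, labelMom_nil, zero_add,
      X.leg_mom_of_ne z (by omega) (by omega), add_zero, K, Finset.Icc_self, Finset.sum_singleton]
  | succ k ih =>
    rw [labelMom_range'_succ, ih (by omega), X.leg_mom_of_ne z (by omega) (by omega), K, K,
      ← add_assoc, Finset.sum_Icc_succ_top (by omega)]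

theorem labelMom_first (z : ℂ) {j : ℕ} (hj : 1 ≤ j) (hn : j < X.n) :
    labelMom (X.leg z) (List.range' 1 j) = X.K 1 j + z • X.q := by
  obtain ⟨k, rfl⟩ := Nat.exists_eq_add_of_le' hj
  induction k with
  | zero =>
    rw [labelMom_range'_succ, List.range'_zero, labelMom_nil, zero_add, add_zero, leg_mom_one, K,
      zero_add, Finset.Icc_self, Finset.sum_singleton]
  | succ k ih =>
    rw [labelMom_range'_succ, ih (by omega) (by omega), X.leg_mom_of_ne z (by omega) (by omega),
      K, K, Finset.sum_Icc_succ_top (b := k + 1) (by omega), add_comm 1 (k + 1)]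
    abel

variable {X}

theorem labelMom_all (hX : X.OnShell) (z : ℂ) : labelMom (X.leg z) (List.range' 1 X.n) = 0 := by
  have h2 := hX.two_le
  obtain ⟨k, hk⟩ := Nat.exists_eq_add_of_le' (show 1 ≤ X.n by omega)
  have h := labelMom_range'_succ (X.leg z) 1 k
  have hcons := hX.conservation
  rw [add_comm 1 k, ← hk, X.leg_mom_n h2, X.labelMom_first z (j := k) (by omega) (by omega)] at h
  rw [h]
  rw [K, hk, Finset.sum_Icc_succ_top (by omega), ← hk] at hcons
  rw [K, ← hcons]
  abel

theorem labelMom_last (hX : X.OnShell) (z : ℂ) {j : ℕ} (hj : 1 ≤ j) (hn : j < X.n) :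
    labelMom (X.leg z) (List.range' (j + 1) (X.n - j)) = -(X.K 1 j + z • X.q) := by
  have h := labelMom_all hX z
  have hs : List.range' 1 X.n = List.range' 1 j ++ List.range' (j + 1) (X.n - j) := by
    rw [add_comm j 1, List.range'_append_1]
    congr 1
    omega
  rw [hs, labelMom_append, X.labelMom_first z hj hn] at h
  exact (neg_eq_of_add_eq_zero_right h).symm

theorem leg_null (hX : X.OnShell) (z : ℂ) {i : ℕ} (h1 : 1 ≤ i) (hn : i ≤ X.n) :
    mdot (X.leg z i).mom (X.leg z i).mom = 0 := by
  by_cases hi : i = 1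
  · subst hi
    rw [leg_mom_one, mdot_add_smul_self, hX.null 1 h1 hn, hX.k1_q, hX.q_null]
    ring
  · by_cases hin : i = X.n
    · subst hin
      rw [X.leg_mom_n hX.two_le, sub_eq_add_neg, ← neg_smul, mdot_add_smul_self,
        hX.null X.n h1 hn, hX.kn_q, hX.q_null]
      ring
    · rw [X.leg_mom_of_ne z hi hin, hX.null i h1 hn]

/-- Since `q` is null the square is linear in `z`, so each channel propagator has one simple pole.
-/
theorem channel_sq (hX : X.OnShell) {j : ℕ} (hq : mdot (X.K 1 j) X.q ≠ 0) (z : ℂ) :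
    mdot (X.K 1 j + z • X.q) (X.K 1 j + z • X.q) = 2 * mdot (X.K 1 j) X.q * (z - X.zI j) := by
  rw [mdot_add_smul_self, hX.q_null, zI]
  field_simp
  ring

theorem regularLeg_leg {𝒜 : Subalgebra ℂ (ℂ → ℂ)} (hid : (fun z : ℂ => z) ∈ 𝒜) (i : ℕ) :
    RegularLeg 𝒜 X.q fun z => X.leg z i := by
  by_cases h1 : i = 1
  · subst h1
    refine ⟨⟨X.k 1, 1, fun z => by simp [leg]⟩, fun a => ?_⟩
    simpa [leg] using polynomial_mem hid (X.pol1 a)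
  · by_cases hn : i = X.n
    · subst hn
      refine ⟨⟨X.k X.n, -1, fun z => ?_⟩, fun a => ?_⟩
      · simp [leg, h1, sub_eq_add_neg]
      · simpa [leg, h1] using polynomial_mem hid (X.poln a)
    · refine ⟨⟨X.k i, 0, fun z => by simp [leg, h1, hn]⟩, fun a => ?_⟩
      simpa [leg, h1, hn] using const_mem 𝒜 (X.pol i a)

theorem affineAlong_ell : AffineAlong X.q X.ell :=
  ⟨X.ell0 + X.alpha • X.q, -1, fun z => by rw [ell, sub_smul, mul_neg_one, neg_smul]; abel⟩

open PlanarTheory in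
/-- Outside the channels that contain exactly one of the legs `1` and `n`, all lines are regular. -/
theorem regularLoop (hX : X.OnShell) {𝒜 : Subalgebra ℂ (ℂ → ℂ)}
    (hid : (fun z : ℂ => z) ∈ 𝒜) {γ : ℂ → ℕ → Leg d F} {χ : List ℕ → ℂ}
    (hγ : ∀ z l, l ≤ X.n → γ z l = X.leg z l) (hmask : ∀ B, χ (0 :: B) = 1)
    (hfirst : ∀ j, 2 ≤ j → j + 2 ≤ X.n →
      (fun z => χ (List.range' 1 j) * propFactor (X.K 1 j + z • X.q)) ∈ 𝒜)
    (hlast : ∀ j, 2 ≤ j → j + 2 ≤ X.n →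
      (fun z => χ (List.range' (j + 1) (X.n - j)) * propFactor (X.K 1 j + z • X.q)) ∈ 𝒜) :
    RegularLoop 𝒜 X.q γ χ (List.range' 1 X.n) X.ell := by
  have h2 := hX.two_le
  have hmom : ∀ z B, (∀ l ∈ B, l ≤ X.n) → labelMom (γ z) B = labelMom (X.leg z) B :=
    fun z B hB => labelMom_congr fun l hl => by rw [hγ z l (hB l hl)]
  have hle : ∀ i k : ℕ, i + k ≤ X.n + 1 → ∀ l ∈ List.range' i k, l ≤ X.n := by
    intro i k hik l hl
    rw [List.mem_range'_1] at hl
    omega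
  have hzero : ∀ {B : List ℕ}, (∀ z, mdot (labelMom (γ z) B) (labelMom (γ z) B) = 0) →
      RegularLine 𝒜 γ χ B := by
    intro B h
    simp only [RegularLine, propFactor_of_null (h _), mul_zero]
    exact const_mem 𝒜 0
  have hconst : ∀ {B : List ℕ} (p : Mom d), (∀ z, labelMom (γ z) B = p) →
      RegularLine 𝒜 γ χ B := by
    intro B p h
    simp only [RegularLine, h]
    exact const_mem 𝒜 _
  refine ⟨fun l hl => ?_, affineAlong_ell, hmask, fun B hB hB2 => ?_, fun A C hAC hA hC => ?_,
    fun A M C hL hA hC => ?_⟩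
  · rw [List.mem_range'_1] at hl
    simp only [fun z => hγ z l (by omega)]
    exact regularLeg_leg hid l
  · obtain ⟨Y, Z, hYZ⟩ := hB
    obtain ⟨-, hB, -, hn⟩ := append_eq_range' hYZ
    set y := Y.length
    set k := B.length
    rw [hB]
    have hm : ∀ z, labelMom (γ z) (List.range' (1 + y) k) =
      labelMom (X.leg z) (List.range' (1 + y) k) := fun z => hmom z _ (hle _ _ (by omega))
    -- Classification of a tree line `y + 1, ..., y + k`: all legs or all but one of `1` and `n`
    -- give null momentum for every `z`, so the propagator is zero by convention; other blocks with
    -- exactly one of the legs `1` and `n` are channels; interior blocks have constant momentum.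
    by_cases hy : y = 0
    · simp only [hy, add_zero] at hm hB ⊢
      by_cases hk : k = X.n
      · refine hzero fun z => ?_
        rw [hm, hk, labelMom_all hX, mdot_zero_left]
      · by_cases hk' : k + 1 = X.n
        · refine hzero fun z => ?_
          have h := labelMom_range'_succ (X.leg z) 1 k
          rw [hk', labelMom_all hX, add_comm 1 k, hk'] at h
          rw [hm, eq_neg_of_add_eq_zero_left h.symm, mdot_neg_self, leg_null hX z (by omega) le_rfl]
        · simp only [RegularLine, hm, fun z => X.labelMom_first z (j := k) (by omega) (by omega)]
          exact hfirst k hB2 (by omega)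
    · by_cases hend : y + k = X.n
      · have hk : k = X.n - y := by omega
        have hm' : ∀ z, labelMom (γ z) (List.range' (1 + y) k) = -(X.K 1 y + z • X.q) := by
          intro z
          rw [hm, hk, add_comm 1 y, labelMom_last hX z (by omega) (by omega)]
        by_cases hy1 : y = 1
        · refine hzero fun z => ?_
          rw [hm', mdot_neg_self, ← X.labelMom_first z (by omega) (by omega), hy1]
          have := leg_null hX z le_rfl (by omega : 1 ≤ X.n)
          simpa [labelMom_cons, labelMom_nil] using this
        · simp only [RegularLine, hm', propFactor_neg]
          rw [hk, add_comm 1 y]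
          exact hlast y (by omega) (by omega)
      · obtain ⟨k', hk'⟩ := Nat.exists_eq_add_of_le' (show 1 ≤ k by omega)
        refine hconst (X.K (1 + y) (1 + y + k')) fun z => ?_
        rw [hm, hk', X.labelMom_mid z (by omega) (by omega)]
  · have hAC' : A ++ [] ++ C = List.range' 1 X.n := by simpa using hAC
    obtain ⟨hA', -, -, hn⟩ := append_eq_range' hAC'
    have hA0 := List.length_pos_iff.2 hA
    have hC0 := List.length_pos_iff.2 hC
    simp only [List.length_nil, add_zero] at hn
    -- The shifts of `ℓ` and of leg `1` cancel.
    have : ∀ z, X.ell z + labelMom (γ z) A = X.ell0 + X.alpha • X.q + X.K 1 A.length := by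
      intro z
      rw [hA', hmom z _ (hle _ _ (by omega)), X.labelMom_first z (by omega) (by omega), ell,
        sub_smul, ← hA']
      abel
    simp only [this]
    exact const_mem 𝒜 _
  · obtain ⟨hA', hM', hC', hn⟩ := append_eq_range' hL
    have hA0 := List.length_pos_iff.2 hA
    have hC0 := List.length_pos_iff.2 hC
    have hle' : ∀ B : List ℕ, B ⊆ A ++ M ++ C → ∀ l ∈ B, l ≤ X.n := fun B hB l hl =>
      hle 1 X.n (by omega) l (hL ▸ hB hl)
    -- A line around the junction contains both shifted legs, so its momentum is minus that of the
    -- unshifted legs `M`. Empty `M` is the tadpole, whose propagator is zero by convention.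
    have hall : ∀ z, labelMom (γ z) (C ++ A) = -labelMom (γ z) M := by
      intro z
      have h := labelMom_all hX z
      rw [← hL, ← hmom z _ (hle' _ (List.Subset.refl _)), labelMom_append, labelMom_append] at h
      rw [labelMom_append, eq_neg_iff_add_eq_zero, ← h]
      abel
    have hMm : ∀ z, labelMom (γ z) M = labelMom (X.leg z) (List.range' (1 + A.length) M.length) :=
      fun z => by rw [hmom z M (hle' _ (by intro l hl; simp [hl])), ← hM']
    by_cases hM0 : M.length = 0
    · refine hzero fun z => ?_
      rw [hall, mdot_neg_self, hMm, hM0, List.range'_zero, labelMom_nil, mdot_zero_left]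
    · obtain ⟨k', hk'⟩ := Nat.exists_eq_add_of_le' (show 1 ≤ M.length by omega)
      refine hconst (-X.K (1 + A.length) (1 + A.length + k')) fun z => ?_
      rw [hall, hMm, hk', X.labelMom_mid z (by omega) (by omega)]

end ShiftData

end Kinematics

/-! ### Decomposition of the loop in a factorisation channel, and completeness -/

noncomputable section Channels

variable {d : ℕ} {F S : Type*} [Fintype F] [DecidableEq F] [Fintype S]

/-- The mask that removes the lines joining the labels of one of the lists `𝒱`. -/
def cutMask (𝒱 : List (List ℕ)) (B : List ℕ) : ℂ := if B ∈ 𝒱 then 0 else 1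

theorem cutMask_of_notMem {𝒱 : List (List ℕ)} {B : List ℕ} (h : B ∉ 𝒱) : cutMask 𝒱 B = 1 :=
  if_neg h

/-- A list containing `t` is never masked because `t` is fresh, and one containing `V` is not masked
by `𝒱`; so both sides of the contraction clause are `1`. -/
theorem isCut_cutMask {𝒱 : List (List ℕ)} {V : List ℕ} {t : ℕ} (htV : t ∉ V)
    (ht : ∀ W ∈ 𝒱, t ∉ W) (hV : ∀ W ∈ 𝒱, ¬ V <:+: W) :
    IsCut (cutMask 𝒱) (cutMask (V :: 𝒱)) V t := by
  refine ⟨if_pos List.mem_cons_self, fun B hB => ?_, fun U Z => ?_⟩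
  · simp only [cutMask, List.mem_cons, hB, false_or]
  · rw [cutMask_of_notMem, cutMask_of_notMem]
    · exact fun h => hV _ h ⟨U, Z, rfl⟩
    · intro h
      rcases List.mem_cons.1 h with h | h
      · exact htV (by rw [← h]; simp)
      · exact ht _ h (by simp)

theorem isCut_one {V : List ℕ} {t : ℕ} (htV : t ∉ V) :
    IsCut (fun _ => 1) (cutMask [V]) V t := by
  have : cutMask [] = fun _ => 1 := by funext B; simp [cutMask]
  rw [← this]
  exact isCut_cutMask htV (by simp) (by simp)

/-- A factorisation channel: two complementary blocks of labels and two labels for the contracted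
blocks. -/
structure IsChannel (V V' : List ℕ) (t t' : ℕ) : Prop where
  two_le : 2 ≤ V.length
  two_le' : 2 ≤ V'.length
  nodup : (V ++ V').Nodup
  zero : 0 ∉ V ++ V'
  left : t ∉ V ++ V'
  right : t' ∉ V ++ V'
  ne : t ≠ t'
  left_ne : t ≠ 0
  right_ne : t' ≠ 0

namespace IsChannel

variable {V V' : List ℕ} {t t' : ℕ}

theorem disjoint (h : IsChannel V V' t t') : ∀ l ∈ V, l ∉ V' := fun l hl hl' =>
  (List.nodup_append.1 h.nodup).2.2 l hl l hl' rfl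

theorem exists_mem (h : IsChannel V V' t t') : ∃ v ∈ V, v ∉ V' ∧ v ≠ t ∧ v ≠ t' ∧ v ≠ 0 := by
  obtain ⟨v, hv⟩ := List.exists_mem_of_ne_nil V (by rintro rfl; simpa using h.two_le)
  have hm : v ∈ V ++ V' := by simp [hv]
  exact ⟨v, hv, h.disjoint v hv, by rintro rfl; exact h.left hm, by rintro rfl; exact h.right hm,
    by rintro rfl; exact h.zero hm⟩

theorem exists_mem' (h : IsChannel V V' t t') : ∃ v ∈ V', v ∉ V ∧ v ≠ t ∧ v ≠ t' ∧ v ≠ 0 := by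
  obtain ⟨v, hv⟩ := List.exists_mem_of_ne_nil V' (by rintro rfl; simpa using h.two_le')
  have hm : v ∈ V ++ V' := by simp [hv]
  exact ⟨v, hv, fun hV => h.disjoint v hV hv, by rintro rfl; exact h.left hm,
    by rintro rfl; exact h.right hm, by rintro rfl; exact h.zero hm⟩

theorem not_infix (h : IsChannel V V' t t') : ¬ V <:+: V' := fun hV => by
  obtain ⟨v, hv, hv', -⟩ := h.exists_mem
  exact hv' (hV.subset hv)

theorem not_infix' (h : IsChannel V V' t t') : ¬ V' <:+: V := fun hV => by
  obtain ⟨v, hv, hv', -⟩ := h.exists_mem'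
  exact hv' (hV.subset hv)

theorem isCut_second (h : IsChannel V V' t t') :
    IsCut (cutMask [V]) (cutMask [V', V]) V' t' :=
  isCut_cutMask (fun hV => h.right (by simp [hV]))
    (by simpa using fun hV => h.right (by simp [hV])) (by simpa using h.not_infix')

end IsChannel

namespace PlanarTheory

theorem maskedLoop_congr_mask (T : PlanarTheory d F S) (g : ℕ → Leg d F) {χ χ' : List ℕ → ℂ}
    {L : List ℕ} (ℓ : Mom d) (h : ∀ B, B ⊆ 0 :: L → χ B = χ' B) :
    T.maskedLoop g χ L ℓ = T.maskedLoop g χ' L ℓ := by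
  rw [maskedLoop, maskedLoop, maskedCorners, maskedCorners,
    T.maskedOpen_congr ℓ (fun _ _ => rfl) fun B hB _ _ => h B hB.subset]
  refine congrArg _ (Finset.sum_congr rfl fun i _ => Finset.sum_congr rfl fun m _ => ?_)
  refine T.maskedCorner_congr ℓ (fun _ _ => rfl) (fun B hB _ => h B fun l hl => ?_)
    fun B hB _ => h B fun l hl => ?_
  · rcases List.mem_cons.1 (hB.subset hl) with rfl | hl
    · exact List.mem_cons_self
    · exact List.mem_cons_of_mem _ (List.mem_of_mem_take (List.mem_of_mem_drop hl))
  · rcases List.mem_append.1 (hB.subset hl) with hl | hl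
    · exact List.mem_cons_of_mem _ (List.mem_of_mem_drop hl)
    · exact List.mem_cons_of_mem _ (List.mem_of_mem_take hl)

theorem mem_corner_head (t : ℕ) (L : List ℕ) (i m : ℕ) (hi : 1 ≤ i) :
    t ∈ (t :: L).drop m ++ (t :: L).take i := by
  obtain ⟨k, rfl⟩ := Nat.exists_eq_add_of_le' hi
  simp

theorem mem_corner_last (t : ℕ) (L : List ℕ) (i m : ℕ) (hm : m < (L ++ [t]).length) :
    t ∈ (L ++ [t]).drop m ++ (L ++ [t]).take i := by
  rw [List.length_append, List.length_singleton] at hm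
  rw [List.drop_append_of_le_length (by omega)]
  simp

/-- If the total momentum of the last legs `V'` is null then the line joining them does not
contribute. -/
theorem maskedLoop_cut_last (T : PlanarTheory d F S) {g : ℕ → Leg d F} {V V' : List ℕ} {t t' : ℕ}
    (h : IsChannel V V' t t') (ℓ : Mom d) (hnull : mdot (labelMom g V') (labelMom g V') = 0) :
    T.maskedLoop g (cutMask [V', V]) (t :: V') ℓ = T.maskedLoop g (fun _ => 1) (t :: V') ℓ := by
  have htV' : t ∉ V' := fun ht => h.left (by simp [ht])
  have ht'V' : t' ∉ V' := fun ht => h.right (by simp [ht])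
  have h0 : 0 ∉ V' := fun h0 => h.zero (by simp [h0])
  -- With null momentum the current of `V'` is zero. Giving the spare label `t'` this zero
  -- wavefunction makes the contracted term of `maskedLoop_suffix` vanish by linearity.
  set g' := Function.update g t' ⟨labelMom g V', 0⟩ with hg'
  have hgg' : ∀ l, l ≠ t' → g l = g' l := fun l hl => by rw [hg', Function.update_of_ne hl]
  have hV'eq : ∀ l ∈ V', g l = g' l := fun l hl => hgg' l (by rintro rfl; exact ht'V' hl)
  have hLeq : ∀ l ∈ t :: V', g l = g' l := fun l hl => by
    rcases List.mem_cons.1 hl with rfl | hl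
    · exact hgg' l h.ne
    · exact hV'eq l hl
  have hleg : g' t' = T.maskedLeg g' (fun _ => 1) V' := by
    rw [← T.maskedLeg_congr hV'eq fun _ _ _ => rfl, hg', Function.update_self, maskedLeg]
    congr 1
    funext a
    rw [T.masked_eq g _ (by have := h.two_le'; omega), propFactor_of_null hnull]
    simp
  have hsuf := T.maskedLoop_suffix (U := [t]) (isCut_one ht'V') h.two_le'
    (List.nodup_cons.2 ⟨htV', (List.nodup_append.1 h.nodup).2.1⟩)
    (by simp [ht'V', h.ne.symm]) (by simp [h0, h.left_ne.symm]) h.right_ne hleg ℓ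
  have hz : T.maskedLoop g' (cutMask [V']) ([t] ++ [t']) ℓ = 0 :=
    (T.isLinearMap_maskedLoop g (cutMask [V']) (t := t') (L := [t] ++ [t']) (labelMom g V') ℓ
      (by simp [h.ne]) (by simp) (by simp [h.left_ne.symm, h.right_ne.symm])
      fun i m _ hm => mem_corner_last t' [t] i m hm).map_zero
  rw [hz, add_zero] at hsuf
  rw [T.maskedLoop_congr_legs _ ℓ hLeq, T.maskedLoop_congr_legs (fun _ => 1) ℓ hLeq]
  refine Eq.trans (T.maskedLoop_congr_mask g' ℓ fun B hB => ?_) hsuf.symm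
  obtain ⟨v, hv, hv', hvt, -, hv0⟩ := h.exists_mem
  have hBV : B ≠ V := by
    rintro rfl
    have := hB hv
    simp [hv', hvt, hv0] at this
  simp [cutMask, hBV]

/-- If the total momentum of the first legs `V` is null then the line joining them does not
contribute. -/
theorem maskedLoop_cut_first (T : PlanarTheory d F S) {g : ℕ → Leg d F} {V V' : List ℕ}
    {t t' : ℕ} (h : IsChannel V V' t t') (ℓ : Mom d)
    (hnull : mdot (labelMom g V) (labelMom g V) = 0) :
    T.maskedLoop g (cutMask [V', V]) (V ++ [t']) ℓ = T.maskedLoop g (fun _ => 1) (V ++ [t']) ℓ := by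
  have htV : t ∉ V := fun ht => h.left (by simp [ht])
  have ht'V : t' ∉ V := fun ht => h.right (by simp [ht])
  have h0 : 0 ∉ V := fun h0 => h.zero (by simp [h0])
  set g' := Function.update g t ⟨labelMom g V, 0⟩ with hg'
  have hgg' : ∀ l, l ≠ t → g l = g' l := fun l hl => by rw [hg', Function.update_of_ne hl]
  have hVeq : ∀ l ∈ V, g l = g' l := fun l hl => hgg' l (by rintro rfl; exact htV hl)
  have hLeq : ∀ l ∈ V ++ [t'], g l = g' l := fun l hl => by
    rcases List.mem_append.1 hl with hl | hl
    · exact hVeq l hl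
    · rw [List.mem_singleton] at hl
      exact hgg' l (by rw [hl]; exact h.ne.symm)
  have hleg : g' t = T.maskedLeg g' (fun _ => 1) V := by
    rw [← T.maskedLeg_congr hVeq fun _ _ _ => rfl, hg', Function.update_self, maskedLeg]
    congr 1
    funext a
    rw [T.masked_eq g _ (by have := h.two_le; omega), propFactor_of_null hnull]
    simp
  have hnd : (V ++ [t']).Nodup := by
    rw [List.nodup_append]
    refine ⟨(List.nodup_append.1 h.nodup).1, by simp, ?_⟩
    rintro a ha b hb rfl
    rw [List.mem_singleton] at hb
    exact ht'V (hb ▸ ha)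
  have hpre := T.maskedLoop_prefix (isCut_one htV) h.two_le hnd
    (by simp [htV, h.ne]) (by simp [h0, h.right_ne.symm]) h.left_ne hleg ℓ
  have hz : T.maskedLoop g' (cutMask [V]) (t :: [t']) ℓ = 0 :=
    (T.isLinearMap_maskedLoop g (cutMask [V]) (t := t) (L := t :: [t']) (labelMom g V) ℓ
      (by simp [h.ne]) (by simp) (by simp [h.left_ne.symm, h.right_ne.symm])
      fun i m hi _ => mem_corner_head t [t'] i m hi).map_zero
  rw [hz, add_zero] at hpre
  rw [T.maskedLoop_congr_legs _ ℓ hLeq, T.maskedLoop_congr_legs (fun _ => 1) ℓ hLeq]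
  refine Eq.trans (T.maskedLoop_congr_mask g' ℓ fun B hB => ?_) hpre.symm
  obtain ⟨v, hv, hv', -, hvt, hv0⟩ := h.exists_mem'
  have hBV : B ≠ V' := by
    rintro rfl
    have := hB hv
    simp [hv', hvt, hv0] at this
  simp [cutMask, hBV]

/-- Decomposition of the loop according to the tree lines joining `V` and `V'`. -/
theorem maskedLoop_decompose (T : PlanarTheory d F S) (g : ℕ → Leg d F) {V V' : List ℕ}
    {t t' : ℕ} (h : IsChannel V V' t t') (ℓ : Mom d) :
    T.maskedLoop g (fun _ => 1) (V ++ V') ℓ =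
      T.maskedLoop g (cutMask [V', V]) (V ++ V') ℓ +
      T.maskedLoop (Function.update g t (T.maskedLeg g (fun _ => 1) V)) (cutMask [V', V])
        (t :: V') ℓ +
      T.maskedLoop (Function.update g t' (T.maskedLeg g (fun _ => 1) V')) (cutMask [V', V])
        (V ++ [t']) ℓ +
      T.oneLoop [T.currentLeg (V.map g), T.currentLeg (V'.map g)] ℓ := by
  have htV : t ∉ V := fun ht => h.left (by simp [ht])
  have htV' : t ∉ V' := fun ht => h.left (by simp [ht])
  have ht'V : t' ∉ V := fun ht => h.right (by simp [ht])
  have ht'V' : t' ∉ V' := fun ht => h.right (by simp [ht])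
  have h0V' : 0 ∉ V' := fun h0 => h.zero (by simp [h0])
  set y := T.maskedLeg g (fun _ => 1) V with hy
  set y' := T.maskedLeg g (fun _ => 1) V' with hy'
  set γ := Function.update (Function.update g t y) t' y' with hγ
  have hγ0 : ∀ l, l ≠ t → l ≠ t' → g l = γ l := fun l h1 h2 => by
    rw [hγ, Function.update_of_ne h2, Function.update_of_ne h1]
  have hγt : γ t = y := by rw [hγ, Function.update_of_ne h.ne, Function.update_self]
  have hγt' : γ t' = y' := by rw [hγ, Function.update_self]
  have hV : ∀ l ∈ V, g l = γ l := fun l hl =>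
    hγ0 l (by rintro rfl; exact htV hl) (by rintro rfl; exact ht'V hl)
  have hV' : ∀ l ∈ V', g l = γ l := fun l hl =>
    hγ0 l (by rintro rfl; exact htV' hl) (by rintro rfl; exact ht'V' hl)
  have hVV' : ∀ l ∈ V ++ V', g l = γ l := fun l hl =>
    (List.mem_append.1 hl).elim (hV l) (hV' l)
  have hg1 : γ t = T.maskedLeg γ (fun _ => 1) V := by
    rw [hγt, hy, T.maskedLeg_congr hV fun _ _ _ => rfl]
  -- Removing the line `V` does not affect the current of `V'`, which has no block equal to `V`.
  have hg2 : γ t' = T.maskedLeg γ (cutMask [V]) V' := by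
    rw [hγt', hy', T.maskedLeg_congr hV' fun B hB _ => ?_]
    rw [cutMask_of_notMem]
    rw [List.mem_singleton]
    rintro rfl
    exact h.not_infix hB
  have e1 := T.maskedLoop_prefix (isCut_one htV) h.two_le h.nodup h.left h.zero h.left_ne hg1 ℓ
  have e2 := T.maskedLoop_suffix h.isCut_second h.two_le' h.nodup h.right h.zero h.right_ne hg2 ℓ
  -- `V'` is cut a second time, in the term where `V` is already contracted; contracting both leaves
  -- a loop with two legs.
  have e3 := T.maskedLoop_suffix (U := [t]) h.isCut_second h.two_le'
    (List.nodup_cons.2 ⟨htV', (List.nodup_append.1 h.nodup).2.1⟩)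
    (by simp [ht'V', h.ne.symm]) (by simp [h0V', h.left_ne.symm]) h.right_ne hg2 ℓ
  -- The remaining labels are `0`, `t` and `t'`, so the mask has nothing left to remove.
  have e4 : T.maskedLoop γ (cutMask [V', V]) ([t] ++ [t']) ℓ =
      T.oneLoop [T.currentLeg (V.map g), T.currentLeg (V'.map g)] ℓ := by
    have hm : [T.currentLeg (V.map g), T.currentLeg (V'.map g)] = ([t] ++ [t']).map γ := by
      simp [hγt, hγt', hy, hy', currentLeg_map]
    rw [hm, T.oneLoop_map γ (by simp [h.ne]) (by simp [h.left_ne.symm, h.right_ne.symm])]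
    refine T.maskedLoop_congr_mask γ ℓ fun B hB => cutMask_of_notMem ?_
    rw [List.mem_cons, List.mem_singleton]
    rintro (rfl | rfl)
    · obtain ⟨v, hv, -, h1, h2, h3⟩ := h.exists_mem'
      have := hB hv
      simp [h1, h2, h3] at this
    · obtain ⟨v, hv, -, h1, h2, h3⟩ := h.exists_mem
      have := hB hv
      simp [h1, h2, h3] at this
  have e5 : T.maskedLoop (Function.update g t y) (cutMask [V', V]) (t :: V') ℓ =
      T.maskedLoop γ (cutMask [V', V]) (t :: V') ℓ := by
    refine T.maskedLoop_congr_legs _ ℓ fun l hl => ?_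
    have hlt : l ≠ t' := by
      rintro rfl
      simp [ht'V', h.ne.symm] at hl
    rw [hγ, Function.update_of_ne hlt]
  have e6 : T.maskedLoop (Function.update g t' y') (cutMask [V', V]) (V ++ [t']) ℓ =
      T.maskedLoop γ (cutMask [V', V]) (V ++ [t']) ℓ := by
    refine T.maskedLoop_congr_legs _ ℓ fun l hl => ?_
    have hlt : l ≠ t := by
      rintro rfl
      simp [htV, h.ne] at hl
    rw [hγ, Function.update_comm h.ne, Function.update_of_ne hlt]
  rw [T.maskedLoop_congr_legs _ ℓ hVV', e5, e6, T.maskedLoop_congr_legs (cutMask _) ℓ hVV',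
    e1, e2]
  rw [List.singleton_append] at e3
  rw [e3, e4]
  ring

/-- The coefficient of the propagator of the line joining the labels `V`, in the diagrams in which
this line is the leg `t` of the loop. -/
def channelFactor (T : PlanarTheory d F S) (g : ℕ → Leg d F) (χ : List ℕ → ℂ) (V : List ℕ) (t : ℕ)
    (L : List ℕ) (ℓ : Mom d) : ℂ :=
  ∑ a : F, (∑ b : F, T.num (labelMom g V) a b *
    T.maskedAmp g (fun _ => 1) V ⟨-labelMom g V, unitWave b⟩) *
      T.maskedLoop (Function.update g t ⟨labelMom g V, unitWave a⟩) χ L ℓ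

section ChannelFactor

variable {L : List ℕ} {t : ℕ}

/-- The current of `V` is its propagator times an amputated part; linearity of the loop in the end
leg `t` pulls out the propagator, which carries the pole. -/
theorem maskedLoop_eq_channelFactor (T : PlanarTheory d F S) (g : ℕ → Leg d F) (χ : List ℕ → ℂ)
    {V : List ℕ} (hV : 2 ≤ V.length) (hL : L.Nodup) (ht : t ∈ L) (h0 : 0 ∉ L)
    (hend : ∀ i m, 1 ≤ i → m < L.length → t ∈ L.drop m ++ L.take i) (ℓ : Mom d) :
    T.maskedLoop (Function.update g t (T.maskedLeg g (fun _ => 1) V)) χ L ℓ =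
      propFactor (labelMom g V) * T.channelFactor g χ V t L ℓ := by
  have hlin := T.isLinearMap_maskedLoop g χ (labelMom g V) ℓ hL ht h0 hend
  rw [maskedLeg]
  rw [← sum_smul_unitWave (T.masked g (fun _ => 1) V)]
  rw [isLinearMap_map_sum hlin, channelFactor, Finset.mul_sum]
  refine Finset.sum_congr rfl fun a _ => ?_
  rw [T.masked_eq g _ (by omega)]
  ring

/-- Completeness of the states on a null line, for a bilinear function of the two ends. -/
theorem sum_num_mul (T : PlanarTheory d F S) {p : Mom d} (hp : p ≠ 0) (hpp : mdot p p = 0)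
    {f : (F → ℂ) → (F → ℂ) → ℂ} (hl : ∀ w, IsLinearMap ℂ fun v => f v w)
    (hr : ∀ v, IsLinearMap ℂ fun w => f v w) :
    ∑ a : F, ∑ b : F, T.num p a b * f (unitWave a) (unitWave b) =
      ∑ s : S, f (T.inWave p s) (T.outWave p s) := by
  have e : ∀ s : S, f (T.inWave p s) (T.outWave p s) = ∑ a : F, ∑ b : F,
      T.inWave p s a * T.outWave p s b * f (unitWave a) (unitWave b) := by
    intro s
    conv_lhs => rw [← sum_smul_unitWave (T.inWave p s), ← sum_smul_unitWave (T.outWave p s)]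
    rw [isLinearMap_map_sum (hl _)]
    refine Finset.sum_congr rfl fun a _ => ?_
    rw [isLinearMap_map_sum (hr _), Finset.mul_sum]
    exact Finset.sum_congr rfl fun b _ => by ring
  simp only [e, T.complete p hp hpp, Finset.sum_mul]
  rw [Finset.sum_comm]
  simp only [Finset.sum_comm (s := (Finset.univ : Finset S))]
  rw [Finset.sum_comm]

/-- On the pole the line is on shell, and the coefficient is bilinear in its two ends, so
completeness replaces the numerator by states. -/
theorem channelFactor_eq_sum_states (T : PlanarTheory d F S) (g : ℕ → Leg d F) (χ : List ℕ → ℂ)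
    {V : List ℕ} (hL : L.Nodup) (ht : t ∈ L) (h0 : 0 ∉ L)
    (hend : ∀ i m, 1 ≤ i → m < L.length → t ∈ L.drop m ++ L.take i) (ℓ : Mom d)
    (hp : labelMom g V ≠ 0) (hpp : mdot (labelMom g V) (labelMom g V) = 0) :
    T.channelFactor g χ V t L ℓ = ∑ s : S,
      T.maskedAmp g (fun _ => 1) V ⟨-labelMom g V, T.outWave (labelMom g V) s⟩ *
        T.maskedLoop (Function.update g t ⟨labelMom g V, T.inWave (labelMom g V) s⟩) χ L ℓ := by
  have hlin := T.isLinearMap_maskedLoop g χ (labelMom g V) ℓ hL ht h0 hend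
  have hamp := T.isLinearMap_maskedAmp_last g (fun _ => 1) V (-labelMom g V)
  rw [← T.sum_num_mul hp hpp (f := fun v w => T.maskedAmp g (fun _ => 1) V ⟨-labelMom g V, w⟩ *
    T.maskedLoop (Function.update g t ⟨labelMom g V, v⟩) χ L ℓ)
    (fun w => isLinearMap_const_mul _ hlin) fun v => ?_, channelFactor]
  · refine Finset.sum_congr rfl fun a _ => ?_
    rw [Finset.sum_mul]
    exact Finset.sum_congr rfl fun b _ => by ring
  · simp only [mul_comm _ (T.maskedLoop _ _ _ _)]
    exact isLinearMap_const_mul _ hamp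

theorem channelFactor_mem {𝒜 : Subalgebra ℂ (ℂ → ℂ)} {q : Mom d} {T : PlanarTheory d F S}
    (hT : T.PolynomialAlong q) (hid : (fun z : ℂ => z) ∈ 𝒜) {γ : ℂ → ℕ → Leg d F}
    {χ : List ℕ → ℂ} {V : List ℕ} {ℓ : ℂ → Mom d} (hleg : ∀ l ∈ V, RegularLeg 𝒜 q fun z => γ z l)
    (hline : ∀ B, B <:+: V → 2 ≤ B.length → B.length < V.length →
      RegularLine 𝒜 γ (fun _ => 1) B)
    (hloop : ∀ a : F, (fun z => T.maskedLoop (Function.update (γ z) t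
      ⟨labelMom (γ z) V, unitWave a⟩) χ L (ℓ z)) ∈ 𝒜) :
    (fun z => T.channelFactor (γ z) χ V t L (ℓ z)) ∈ 𝒜 := by
  have hmom := affineAlong_labelMom fun l hl => (hleg l hl).mom
  exact fun_sum_mem 𝒜 fun a _ => fun_mul_mem 𝒜 (fun_sum_mem 𝒜 fun b _ => fun_mul_mem 𝒜
    (T.num_mem hT hid hmom a b) (T.maskedAmp_mem hT hid (regularLeg_const_wave hmom.neg _) hleg
      hline)) (hloop a)

/-- The sign operator on the glued end acts on a state of definite parity as `1` or `-1`, which is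
the sign for fermion loops. -/
theorem maskedOpen_eq_sum_states (T : PlanarTheory d F S) (g : ℕ → Leg d F) (χ : List ℕ → ℂ)
    (hL : L.Nodup) (h0 : 0 ∉ L) {ℓ : Mom d} (hp : ℓ ≠ 0) (hpp : mdot ℓ ℓ = 0) :
    T.maskedOpen g χ L ℓ = ∑ s : S, (if T.stateOdd s then -1 else 1) *
      T.maskedAmp (Function.update g 0 ⟨ℓ, T.inWave ℓ s⟩) χ (0 :: L) ⟨-ℓ, T.outWave ℓ s⟩ := by
  have key := T.sum_num_mul hp hpp (f := fun v w =>
    T.maskedAmp (Function.update g 0 ⟨ℓ, v⟩) χ (0 :: L) ⟨-ℓ, fermSign T.odd w⟩)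
    (fun w => T.isLinearMap_maskedAmp g χ ℓ _ (List.nodup_cons.2 ⟨h0, hL⟩) List.mem_cons_self)
    fun v => isLinearMap_comp (f := fun w => T.maskedAmp (Function.update g 0 ⟨ℓ, v⟩) χ (0 :: L)
      ⟨-ℓ, w⟩) (T.isLinearMap_maskedAmp_last _ χ _ _) (isLinearMap_fermSign T.odd)
  rw [maskedOpen, key]
  refine Finset.sum_congr rfl fun s _ => ?_
  have hs : fermSign T.odd (T.outWave ℓ s) =
      (if T.stateOdd s then -1 else 1 : ℂ) • T.outWave ℓ s := by
    funext a
    by_cases h : T.odd a = T.stateOdd s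
    · cases hs : T.stateOdd s <;> simp [fermSign, h, hs]
    · simp [fermSign, T.outWave_parity ℓ s a h]
  rw [hs, (T.isLinearMap_maskedAmp_last _ χ _ _).map_smul, smul_eq_mul]

end ChannelFactor

end PlanarTheory

end Channels

/-! ### Residues at the origin and at the forward limit -/

noncomputable section Poles

variable {d : ℕ} {F S : Type*} [Fintype F] [DecidableEq F] [Fintype S]

namespace ShiftData

variable {X : ShiftData d F} {T : PlanarTheory d F S}

open PlanarTheory

theorem legs_one (X : ShiftData d F) (z : ℂ) (j : ℕ) :
    X.legs z 1 j = (List.range' 1 j).map (X.leg z) := rfl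

theorem legs_succ (X : ShiftData d F) (z : ℂ) (j : ℕ) :
    X.legs z (j + 1) X.n = (List.range' (j + 1) (X.n - j)).map (X.leg z) := by
  rw [legs, Nat.add_sub_add_right]

theorem zero_notMem_range' (s n : ℕ) : 0 ∉ List.range' (s + 1) n := by
  rw [List.mem_range'_1]; omega

theorem integrand_eq (X : ShiftData d F) (T : PlanarTheory d F S) (z : ℂ) :
    X.integrand T z =
      T.maskedLoop (X.leg z) (fun _ => 1) (List.range' 1 X.n) (X.ell z) := by
  rw [integrand, legs_one, T.oneLoop_map _ List.nodup_range' (zero_notMem_range' 0 _)]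

theorem affineAlong_channel (X : ShiftData d F) (j : ℕ) :
    AffineAlong X.q fun z => X.K 1 j + z • X.q :=
  ⟨X.K 1 j, 1, fun z => by rw [mul_one]⟩

theorem ell_sq (hX : X.OnShell) (z : ℂ) :
    mdot (X.ell z) (X.ell z) = 2 * mdot X.ell0 X.q * (X.alpha - z) := by
  rw [ell, mdot_add_smul_self, hX.ell0_null, hX.q_null]
  ring

theorem zI_ne_zero (hgen : X.Generic) {j : ℕ} (hj : 2 ≤ j) (hn : j + 2 ≤ X.n) : X.zI j ≠ 0 :=
  div_ne_zero (neg_ne_zero.2 (hgen.channel j hj hn))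
    (mul_ne_zero two_ne_zero (hgen.channel_q j hj hn))

theorem propFactor_channel_analytic (hX : X.OnShell) (hgen : X.Generic) {j : ℕ} (hj : 2 ≤ j)
    (hn : j + 2 ≤ X.n) {z₀ : ℂ} (hz : z₀ ≠ X.zI j) :
    (fun z => propFactor (X.K 1 j + z • X.q)) ∈ analyticSubalgebra z₀ := by
  refine propFactor_mem_analytic (X.affineAlong_channel j) ?_
  rw [channel_sq hX (hgen.channel_q j hj hn)]
  exact mul_ne_zero (mul_ne_zero two_ne_zero (hgen.channel_q j hj hn)) (sub_ne_zero.2 hz)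

theorem propFactor_ell_analytic (hX : X.OnShell) (hgen : X.Generic) {z₀ : ℂ} (hz : z₀ ≠ X.alpha) :
    (fun z => propFactor (X.ell z)) ∈ analyticSubalgebra z₀ := by
  refine propFactor_mem_analytic affineAlong_ell ?_
  rw [ell_sq hX]
  exact mul_ne_zero (mul_ne_zero two_ne_zero hgen.ell0_q) (sub_ne_zero.2 hz.symm)

theorem regularLoop_leg (hX : X.OnShell) {𝒜 : Subalgebra ℂ (ℂ → ℂ)}
    (hid : (fun z : ℂ => z) ∈ 𝒜) (h : ∀ j, 2 ≤ j → j + 2 ≤ X.n →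
      (fun z => propFactor (X.K 1 j + z • X.q)) ∈ 𝒜) :
    RegularLoop 𝒜 X.q X.leg (fun _ => 1) (List.range' 1 X.n) X.ell :=
  regularLoop hX hid (fun _ _ _ => rfl) (fun _ => rfl) (by simpa only [one_mul] using h)
    (by simpa only [one_mul] using h)

theorem integrand_meromorphicAt (hX : X.OnShell) (hT : T.PolynomialAlong X.q) (z₀ : ℂ) :
    MeromorphicAt (X.integrand T) z₀ := by
  have h := (regularLoop_leg hX (id_mem_meromorphicSubalgebra z₀) fun j _ _ =>
    propFactor_mem_meromorphic (X.affineAlong_channel j)).maskedLoop_mem hT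
      (id_mem_meromorphicSubalgebra z₀) (zero_notMem_range' 0 _)
      (propFactor_mem_meromorphic affineAlong_ell)
  simpa only [← integrand_eq] using mem_meromorphicSubalgebra.1 h

theorem integrand_analyticAt (hX : X.OnShell) (hgen : X.Generic) (hT : T.PolynomialAlong X.q)
    {z₀ : ℂ} (hα : z₀ ≠ X.alpha) (hz : ∀ j, 2 ≤ j → j + 2 ≤ X.n → z₀ ≠ X.zI j) :
    AnalyticAt ℂ (X.integrand T) z₀ := by
  have h := (regularLoop_leg hX (id_mem_analyticSubalgebra z₀) fun j hj hn =>
    propFactor_channel_analytic hX hgen hj hn (hz j hj hn)).maskedLoop_mem hT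
      (id_mem_analyticSubalgebra z₀) (zero_notMem_range' 0 _) (propFactor_ell_analytic hX hgen hα)
  simpa only [← integrand_eq] using mem_analyticSubalgebra.1 h

theorem hasResidue_zero (hX : X.OnShell) (hgen : X.Generic) (hT : T.PolynomialAlong X.q) :
    HasResidue (fun z => X.integrand T z / z) 0 (X.integrand T 0) := by
  have h := HasResidue.simple_pole (integrand_analyticAt hX hgen hT hgen.alpha_ne.symm
    fun j hj hn => (zI_ne_zero hgen hj hn).symm)
  simpa only [sub_zero, div_eq_inv_mul] using h

/-- The residue at `ℓ ^ 2 = 0` is given by the forward limit. -/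
theorem hasResidue_alpha (hX : X.OnShell) (hgen : X.Generic) (hT : T.PolynomialAlong X.q) :
    HasResidue (fun z => X.integrand T z / z) X.alpha (-X.forwardLimit T) := by
  have hid := id_mem_analyticSubalgebra X.alpha
  have hreg := regularLoop_leg hX hid fun j hj hn =>
    propFactor_channel_analytic hX hgen hj hn (hgen.zI_ne_alpha j hj hn).symm
  have h0 := zero_notMem_range' 0 X.n
  have hopen := mem_analyticSubalgebra.1 (hreg.maskedOpen_mem hT hid h0)
  have hcorner := mem_analyticSubalgebra.1 (hreg.maskedCorners_mem hT hid h0)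
  have hinv : AnalyticAt ℂ (fun z : ℂ => z⁻¹) X.alpha := analyticAt_id.inv hgen.alpha_ne
  set e := mdot X.ell0 X.q with he
  -- Here `1 / ℓ ^ 2 = -(2 * e)⁻¹ / (z - α)`. Dividing by `z = α` turns the prefactor into `-1 / ℓ ^
  -- 2` at `z = 0`. The corner diagrams do not contain this propagator.
  have key := (HasResidue.simple_pole ((analyticAt_const (v := -(2 * e)⁻¹)).mul
    (hinv.mul hopen))).add (HasResidue.of_analyticAt (hinv.mul hcorner))
  have hell : X.ell X.alpha = X.ell0 := by simp [ell]
  have hne : X.ell0 ≠ 0 := by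
    intro h
    apply hgen.ell0_q
    rw [h, mdot_zero_left]
  convert key using 1
  · funext z
    simp only [Pi.mul_apply]
    rw [integrand_eq, maskedLoop, propFactor_eq, ell_sq hX, ← he, ← neg_sub z X.alpha,
      mul_neg, inv_neg, mul_inv]
    ring
  · simp only [Pi.mul_apply]
    rw [hell, T.maskedOpen_eq_sum_states _ _ List.nodup_range' h0 hne hX.ell0_null, forwardLimit,
      ell_sq hX, sub_zero, ← he, add_zero]
    simp only [legs_one, ← map_update_cons _ h0, treeAmp_map]
    rw [one_div, mul_inv]
    ring

/-- The labels `n + 1` and `n + 2` are unused by external legs, and `0` is reserved for the opened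
loop. -/
theorem isChannel {j : ℕ} (hj : 2 ≤ j) (hn : j + 2 ≤ X.n) :
    IsChannel (List.range' 1 j) (List.range' (j + 1) (X.n - j)) (X.n + 1) (X.n + 2) where
  two_le := by simpa using hj
  two_le' := by rw [List.length_range']; omega
  nodup := by rw [add_comm j 1, List.range'_append_1]; exact List.nodup_range'
  zero := by rw [add_comm j 1, List.range'_append_1]; exact zero_notMem_range' 0 _
  left := by rw [add_comm j 1, List.range'_append_1, List.mem_range'_1]; omega
  right := by rw [add_comm j 1, List.range'_append_1, List.mem_range'_1]; omega
  ne := by omega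
  left_ne := by omega
  right_ne := by omega

theorem range'_split {j n : ℕ} (h : j ≤ n) :
    List.range' 1 n = List.range' 1 j ++ List.range' (j + 1) (n - j) := by
  rw [add_comm j 1, List.range'_append_1, Nat.add_sub_cancel' h]

/-- Near its pole, the channel `j` is the only one that is not regular. -/
theorem regularLoop_cut (hX : X.OnShell) (hgen : X.Generic) {j : ℕ} (hj : 2 ≤ j)
    (hn : j + 2 ≤ X.n) {γ : ℂ → ℕ → Leg d F} (hγ : ∀ z l, l ≤ X.n → γ z l = X.leg z l) :
    RegularLoop (analyticSubalgebra (X.zI j)) X.q γ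
      (cutMask [List.range' (j + 1) (X.n - j), List.range' 1 j]) (List.range' 1 X.n) X.ell := by
  have hne : ∀ i, 2 ≤ i → i + 2 ≤ X.n → i ≠ j → X.zI j ≠ X.zI i := by
    intro i hi hin hij
    rcases Nat.lt_or_gt_of_ne hij with h | h
    · exact (hgen.zI_injective i j hi h hn).symm
    · exact hgen.zI_injective j i hj h hin
  have hprop : ∀ (c : ℂ) (i : ℕ), 2 ≤ i → i + 2 ≤ X.n → (i = j → c = 0) →
      (fun z => c * propFactor (X.K 1 i + z • X.q)) ∈ analyticSubalgebra (X.zI j) := by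
    intro c i hi hin hc
    by_cases hij : i = j
    · simp only [hc hij, zero_mul]
      exact const_mem _ 0
    · exact fun_mul_mem _ (const_mem _ c)
        (propFactor_channel_analytic hX hgen hi hin (hne i hi hin hij))
  refine regularLoop hX (id_mem_analyticSubalgebra _) hγ (fun B => cutMask_of_notMem ?_)
    (fun i hi hin => hprop _ i hi hin ?_) (fun i hi hin => hprop _ i hi hin ?_)
  · intro h
    rcases List.mem_pair.1 h with h | h
    · exact zero_notMem_range' j (X.n - j) (h ▸ List.mem_cons_self)
    · exact zero_notMem_range' 0 j (h ▸ List.mem_cons_self)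
  · rintro rfl
    simp [cutMask]
  · rintro rfl
    simp [cutMask]

theorem selfEnergy_eq (X : ShiftData d F) (T : PlanarTheory d F S) (j : ℕ) (z : ℂ) :
    X.selfEnergy T j z = T.oneLoop [T.currentLeg ((List.range' 1 j).map (X.leg z)),
      T.currentLeg ((List.range' (j + 1) (X.n - j)).map (X.leg z))] (X.ell z) := by
  rw [selfEnergy, legs_succ, legs_one]

/-- The residue at the pole of the channel `j`, for a coefficient that is regular there. -/
theorem hasResidue_channel (hX : X.OnShell) (hgen : X.Generic) {j : ℕ} (hj : 2 ≤ j)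
    (hn : j + 2 ≤ X.n) {h : ℂ → ℂ} (hh : AnalyticAt ℂ h (X.zI j)) :
    HasResidue (fun z => propFactor (X.K 1 j + z • X.q) * h z / z) (X.zI j)
      (-(1 / mdot (X.K 1 j) (X.K 1 j) * h (X.zI j))) := by
  have hinv : AnalyticAt ℂ (fun z : ℂ => z⁻¹) (X.zI j) := analyticAt_id.inv (zI_ne_zero hgen hj hn)
  have hq := hgen.channel_q j hj hn
  have hK := hgen.channel j hj hn
  have key := HasResidue.simple_pole ((analyticAt_const (v := (2 * mdot (X.K 1 j) X.q)⁻¹)).mul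
    (hinv.mul hh))
  convert key using 1
  · funext z
    simp only [Pi.mul_apply]
    rw [propFactor_eq, channel_sq hX hq, mul_inv]
    ring
  · simp only [Pi.mul_apply]
    -- The factor `1 / z` at the pole converts `1 / (2 K ⬝ q)` into `-1 / K ^ 2`.
    have : (X.zI j)⁻¹ = -(2 * mdot (X.K 1 j) X.q) / mdot (X.K 1 j) (X.K 1 j) := by
      rw [zI, inv_div, div_neg, neg_div]
    rw [this]
    field_simp

end ShiftData

end Poles

/-! ### Residues at the channel poles -/

noncomputable section ChannelPoles

variable {d : ℕ} {F S : Type*} [Fintype F] [DecidableEq F] [Fintype S]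

theorem IsChannel.isCut_first {V V' : List ℕ} {t t' : ℕ} (h : IsChannel V V' t t') :
    IsCut (cutMask [V']) (cutMask [V', V]) V t := by
  have hc : cutMask [V', V] = cutMask [V, V'] := by
    funext B
    simp only [cutMask, List.mem_pair, or_comm]
  rw [hc]
  exact isCut_cutMask (fun hV => h.left (by simp [hV]))
    (by simpa using fun hV => h.left (by simp [hV])) (by simpa using h.not_infix)

theorem IsChannel.nodup_cons {V V' : List ℕ} {t t' : ℕ} (h : IsChannel V V' t t') :
    (t :: V').Nodup :=
  List.nodup_cons.2 ⟨fun ht => h.left (by simp [ht]), (List.nodup_append.1 h.nodup).2.1⟩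

theorem IsChannel.nodup_concat {V V' : List ℕ} {t t' : ℕ} (h : IsChannel V V' t t') :
    (V ++ [t']).Nodup := by
  rw [← List.concat_eq_append, List.nodup_concat]
  exact ⟨fun ht => h.right (by simp [ht]), (List.nodup_append.1 h.nodup).1⟩

theorem IsChannel.zero_cons {V V' : List ℕ} {t t' : ℕ} (h : IsChannel V V' t t') :
    0 ∉ t :: V' := by
  have := h.zero
  simp only [List.mem_append, not_or] at this
  simp [this.2, h.left_ne.symm]

theorem IsChannel.zero_concat {V V' : List ℕ} {t t' : ℕ} (h : IsChannel V V' t t') :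
    0 ∉ V ++ [t'] := by
  have := h.zero
  simp only [List.mem_append, not_or] at this
  simp [this.1, h.right_ne.symm]

namespace ShiftData

variable {X : ShiftData d F} {T : PlanarTheory d F S}

open PlanarTheory

/-- The coefficient of the pole of the channel `j`, in the diagrams in which the loop is on the side
of the leg `n`. -/
def firstFactor (X : ShiftData d F) (T : PlanarTheory d F S) (j : ℕ) (z : ℂ) : ℂ :=
  T.channelFactor (X.leg z) (cutMask [List.range' (j + 1) (X.n - j), List.range' 1 j])
    (List.range' 1 j) (X.n + 1) ((X.n + 1) :: List.range' (j + 1) (X.n - j)) (X.ell z)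

/-- The coefficient of the pole of the channel `j`, in the diagrams in which the loop is on the side
of the leg `1`. -/
def lastFactor (X : ShiftData d F) (T : PlanarTheory d F S) (j : ℕ) (z : ℂ) : ℂ :=
  T.channelFactor (X.leg z) (cutMask [List.range' (j + 1) (X.n - j), List.range' 1 j])
    (List.range' (j + 1) (X.n - j)) (X.n + 2) (List.range' 1 j ++ [X.n + 2]) (X.ell z)

/-- The diagrams without a propagator of the channel `j`. -/
def channelFree (X : ShiftData d F) (T : PlanarTheory d F S) (j : ℕ) (z : ℂ) : ℂ :=
  T.maskedLoop (X.leg z) (cutMask [List.range' (j + 1) (X.n - j), List.range' 1 j])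
    (List.range' 1 X.n) (X.ell z)

/-- By momentum conservation the two complementary blocks have opposite momenta, so both single-line
terms carry the same propagator. -/
theorem integrand_decompose (hX : X.OnShell) (T : PlanarTheory d F S) {j : ℕ} (hj : 2 ≤ j)
    (hn : j + 2 ≤ X.n) (z : ℂ) : X.integrand T z = X.channelFree T j z +
      propFactor (X.K 1 j + z • X.q) * X.firstFactor T j z +
      propFactor (X.K 1 j + z • X.q) * X.lastFactor T j z + X.selfEnergy T j z := by
  have hc := isChannel (X := X) hj hn
  rw [integrand_eq, channelFree, range'_split (j := j) (n := X.n) (by omega),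
    T.maskedLoop_decompose (X.leg z) hc (X.ell z), selfEnergy_eq,
    T.maskedLoop_eq_channelFactor _ _ hc.two_le hc.nodup_cons List.mem_cons_self hc.zero_cons
      fun i m hi _ => mem_corner_head _ _ i m hi,
    T.maskedLoop_eq_channelFactor _ _ hc.two_le' hc.nodup_concat (by simp) hc.zero_concat
      fun i m _ hm => mem_corner_last _ _ i m hm,
    X.labelMom_first z (by omega) (by omega), labelMom_last hX z (by omega) (by omega),
    propFactor_neg, firstFactor, lastFactor]

section Channel

variable (hX : X.OnShell) (hgen : X.Generic) {j : ℕ} (hj : 2 ≤ j) (hn : j + 2 ≤ X.n)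

include hX hgen hj hn

theorem channelFree_analyticAt (hT : T.PolynomialAlong X.q) :
    AnalyticAt ℂ (X.channelFree T j) (X.zI j) :=
  mem_analyticSubalgebra.1 <| (regularLoop_cut hX hgen hj hn fun _ _ _ => rfl).maskedLoop_mem hT
    (id_mem_analyticSubalgebra _) (zero_notMem_range' 0 _)
    (propFactor_ell_analytic hX hgen (hgen.zI_ne_alpha j hj hn))

/-- Strictly inside one side of the channel there is no line of the channel itself, so regularity
holds without the mask. -/
theorem regularLine_proper {V : List ℕ} (hV : V <:+: List.range' 1 X.n)
    (h : ∀ B, B <:+: V → B.length < V.length →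
      B ≠ List.range' 1 j ∧ B ≠ List.range' (j + 1) (X.n - j)) {B : List ℕ} (hB : B <:+: V)
    (hB2 : 2 ≤ B.length) (hlt : B.length < V.length) :
    RegularLine (analyticSubalgebra (X.zI j)) X.leg (fun _ => 1) B := by
  have hr := (regularLoop_cut hX hgen hj hn fun _ _ _ => rfl).tree B (hB.trans hV) hB2
  rwa [RegularLine, cutMask_of_notMem] at hr
  rw [List.mem_pair, not_or]
  exact (h B hB hlt).symm

theorem firstFactor_analyticAt (hT : T.PolynomialAlong X.q) :
    AnalyticAt ℂ (X.firstFactor T j) (X.zI j) := by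
  have hid := id_mem_analyticSubalgebra (X.zI j)
  have hc := isChannel (X := X) hj hn
  have hs := range'_split (j := j) (n := X.n) (by omega)
  refine mem_analyticSubalgebra.1 <| T.channelFactor_mem hT hid (fun l _ => regularLeg_leg hid l)
    (fun B hB hB2 hlt => regularLine_proper hX hgen hj hn (V := List.range' 1 j)
      ⟨[], _, hs.symm⟩ (fun B hB hlt => ⟨?_, ?_⟩) hB hB2 hlt) fun a => ?_
  · rintro rfl; exact hlt.false
  · rintro rfl; exact hc.not_infix' hB
  -- The new label exceeds `n`, so `γ` agrees with the external legs and the uncontracted loop stays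
  -- regular; contraction then gives the loop with leg `n + 1`.
  set γ : ℂ → ℕ → Leg d F := fun z => Function.update (X.leg z) (X.n + 1)
    ⟨labelMom (X.leg z) (List.range' 1 j), unitWave a⟩ with hγ
  have hγ0 : ∀ z l, l ≤ X.n → γ z l = X.leg z l := fun z l hl => by
    rw [hγ]; exact Function.update_of_ne (by omega) _ _
  have hreg := regularLoop_cut hX hgen hj hn hγ0
  have hmom : AffineAlong X.q fun z => labelMom (X.leg z) (List.range' 1 j) :=
    affineAlong_labelMom fun l _ => (regularLeg_leg hid l).mom
  rw [hs] at hreg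
  have hreg' := RegularLoop.contract (U := []) (t := X.n + 1) hreg hc.isCut_first
    (by intro h; have := hc.two_le; simp [h] at this) hc.nodup_cons ?_ fun z => ?_
  · exact hreg'.maskedLoop_mem hT hid hc.zero_cons
      (propFactor_ell_analytic hX hgen (hgen.zI_ne_alpha j hj hn))
  · simp only [hγ, Function.update_self]
    exact regularLeg_unitWave hmom a
  · simp only [hγ, Function.update_self]
    refine labelMom_congr fun l hl => ?_
    rw [Function.update_of_ne]
    rintro rfl
    exact hc.left (by simp [hl])

theorem lastFactor_analyticAt (hT : T.PolynomialAlong X.q) :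
    AnalyticAt ℂ (X.lastFactor T j) (X.zI j) := by
  have hid := id_mem_analyticSubalgebra (X.zI j)
  have hc := isChannel (X := X) hj hn
  have hs := range'_split (j := j) (n := X.n) (by omega)
  refine mem_analyticSubalgebra.1 <| T.channelFactor_mem hT hid (fun l _ => regularLeg_leg hid l)
    (fun B hB hB2 hlt => regularLine_proper hX hgen hj hn (V := List.range' (j + 1) (X.n - j))
      ⟨List.range' 1 j, [], by rw [hs, List.append_nil]⟩
      (fun B hB hlt => ⟨?_, ?_⟩) hB hB2 hlt) fun a => ?_
  · rintro rfl; exact hc.not_infix hB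
  · rintro rfl; exact hlt.false
  set γ : ℂ → ℕ → Leg d F := fun z => Function.update (X.leg z) (X.n + 2)
    ⟨labelMom (X.leg z) (List.range' (j + 1) (X.n - j)), unitWave a⟩ with hγ
  have hγ0 : ∀ z l, l ≤ X.n → γ z l = X.leg z l := fun z l hl => by
    rw [hγ]; exact Function.update_of_ne (by omega) _ _
  have hreg := regularLoop_cut hX hgen hj hn hγ0
  have hmom : AffineAlong X.q fun z => labelMom (X.leg z) (List.range' (j + 1) (X.n - j)) :=
    affineAlong_labelMom fun l _ => (regularLeg_leg hid l).mom
  rw [hs, ← List.append_nil (List.range' 1 j ++ _)] at hreg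
  have hreg' := RegularLoop.contract (t := X.n + 2) hreg hc.isCut_second
    (by intro h; have := hc.two_le'; simp [h] at this) hc.nodup_concat ?_ fun z => ?_
  · exact hreg'.maskedLoop_mem hT hid hc.zero_concat
      (propFactor_ell_analytic hX hgen (hgen.zI_ne_alpha j hj hn))
  · simp only [hγ, Function.update_self]
    exact regularLeg_unitWave hmom a
  · simp only [hγ, Function.update_self]
    refine labelMom_congr fun l hl => ?_
    rw [Function.update_of_ne]
    rintro rfl
    exact hc.right (by simp [hl])

theorem channel_null : mdot (X.K 1 j + X.zI j • X.q) (X.K 1 j + X.zI j • X.q) = 0 := by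
  rw [channel_sq hX (hgen.channel_q j hj hn), sub_self, mul_zero]

theorem channel_ne_zero : X.K 1 j + X.zI j • X.q ≠ 0 := by
  intro h
  apply hgen.channel_q j hj hn
  have := congrArg (fun p => mdot p X.q) h
  simpa only [mdot_add_left, mdot_smul_left, hX.q_null, mul_zero, add_zero, mdot_zero_left]
    using this

theorem factorFirst_eq : X.factorFirst T j =
    1 / mdot (X.K 1 j) (X.K 1 j) * X.firstFactor T j (X.zI j) := by
  have hc := isChannel (X := X) hj hn
  have hP := X.labelMom_first (X.zI j) (j := j) (by omega) (by omega)
  have hnull := channel_null hX hgen hj hn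
  have ht : X.n + 1 ∉ List.range' (j + 1) (X.n - j) := fun h => hc.left (by simp [h])
  rw [firstFactor, T.channelFactor_eq_sum_states _ _ hc.nodup_cons List.mem_cons_self hc.zero_cons
      (fun i m hi _ => mem_corner_head _ _ i m hi) _
      (by rw [hP]; exact channel_ne_zero hX hgen hj hn) (by rw [hP]; exact hnull),
    Finset.mul_sum, factorFirst]
  refine Finset.sum_congr rfl fun s _ => ?_
  -- At the pole the complementary line is null, so the mask may be dropped and the factor is a full
  -- one-loop integrand.
  rw [T.maskedLoop_cut_last hc, ← T.oneLoop_map _ hc.nodup_cons hc.zero_cons,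
    map_update_cons _ ht, ← treeAmp_map, legs_succ, legs_one, ← labelMom]
  · ring
  · have : labelMom (Function.update (X.leg (X.zI j)) (X.n + 1)
        ⟨labelMom (X.leg (X.zI j)) (List.range' 1 j),
          T.inWave (labelMom (X.leg (X.zI j)) (List.range' 1 j)) s⟩)
        (List.range' (j + 1) (X.n - j)) = -(X.K 1 j + X.zI j • X.q) := by
      rw [labelMom, map_update_of_notMem _ ht, ← labelMom, labelMom_last hX _ (by omega) (by omega)]
    rw [this, mdot_neg_self, hnull]

theorem K_last : mdot (X.K (j + 1) X.n) (X.K (j + 1) X.n) = mdot (X.K 1 j) (X.K 1 j) := by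
  have h : X.K 1 j + X.K (j + 1) X.n = 0 := by
    rw [← hX.conservation]
    have hI : ∀ i k : ℕ, Finset.Icc (i + 1) k = Finset.Ioc i k := fun i k =>
      Finset.Icc_succ_left_eq_Ioc i k
    rw [K, K, K, hI j, show ∀ k, Finset.Icc 1 k = Finset.Ioc 0 k from hI 0,
      show Finset.Icc 1 X.n = Finset.Ioc 0 X.n from hI 0 _]
    exact Finset.sum_Ioc_consecutive X.k (Nat.zero_le j) (by omega)
  rw [eq_neg_of_add_eq_zero_right h, mdot_neg_self]

theorem factorLast_eq : X.factorLast T j =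
    1 / mdot (X.K 1 j) (X.K 1 j) * X.lastFactor T j (X.zI j) := by
  have hc := isChannel (X := X) hj hn
  have hP := labelMom_last hX (X.zI j) (j := j) (by omega) (by omega)
  have hnull := channel_null hX hgen hj hn
  have ht : X.n + 2 ∉ List.range' 1 j := fun h => hc.right (by simp [h])
  rw [lastFactor, T.channelFactor_eq_sum_states _ _ hc.nodup_concat (by simp) hc.zero_concat
      (fun i m _ hm => mem_corner_last _ _ i m hm) _
      (by rw [hP]; exact neg_ne_zero.2 (channel_ne_zero hX hgen hj hn))
      (by rw [hP, mdot_neg_self]; exact hnull),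
    Finset.mul_sum, factorLast]
  refine Finset.sum_congr rfl fun s _ => ?_
  rw [T.maskedLoop_cut_first hc, ← T.oneLoop_map _ hc.nodup_concat hc.zero_concat,
    List.map_append, map_update_of_notMem _ ht, List.map_singleton, Function.update_self,
    ← treeAmp_map, legs_succ, legs_one, ← labelMom, K_last hX hgen hj hn]
  · ring
  · have : labelMom (Function.update (X.leg (X.zI j)) (X.n + 2)
        ⟨labelMom (X.leg (X.zI j)) (List.range' (j + 1) (X.n - j)),
          T.inWave (labelMom (X.leg (X.zI j)) (List.range' (j + 1) (X.n - j))) s⟩)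
        (List.range' 1 j) = X.K 1 j + X.zI j • X.q := by
      rw [labelMom, map_update_of_notMem _ ht, ← labelMom, X.labelMom_first _ (by omega) (by omega)]
    rw [this, hnull]

/-- Obtained by difference from the other terms of the decomposition, all known to be meromorphic.
-/
theorem selfEnergy_meromorphicAt (hT : T.PolynomialAlong X.q) :
    MeromorphicAt (X.selfEnergy T j) (X.zI j) := by
  have h1 := (firstFactor_analyticAt hX hgen hj hn hT).meromorphicAt
  have h2 := (lastFactor_analyticAt hX hgen hj hn hT).meromorphicAt
  have h3 := (channelFree_analyticAt hX hgen hj hn hT).meromorphicAt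
  have hprop : MeromorphicAt (fun z => propFactor (X.K 1 j + z • X.q)) (X.zI j) :=
    propFactor_mem_meromorphic (X.affineAlong_channel j)
  refine ((integrand_meromorphicAt hX hT (X.zI j)).sub
    ((h3.add (hprop.mul h1)).add (hprop.mul h2))).congr (Filter.Eventually.of_forall fun z => ?_)
  simp only [Pi.sub_apply, Pi.add_apply, Pi.mul_apply]
  rw [integrand_decompose hX T hj hn z]
  ring

/-- The residue at the pole of the channel `j`. -/
theorem exists_hasResidue_selfEnergy (hT : T.PolynomialAlong X.q) :
    ∃ ρ, HasResidue (fun z => X.selfEnergy T j z / z) (X.zI j) ρ ∧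
      HasResidue (fun z => X.integrand T z / z) (X.zI j)
        (ρ - (X.factorFirst T j + X.factorLast T j)) := by
  have h1 := firstFactor_analyticAt hX hgen hj hn hT
  have h2 := lastFactor_analyticAt hX hgen hj hn hT
  have h3 := channelFree_analyticAt hX hgen hj hn hT
  have hinv : AnalyticAt ℂ (fun z : ℂ => z⁻¹) (X.zI j) := analyticAt_id.inv (zI_ne_zero hgen hj hn)
  have hself := (selfEnergy_meromorphicAt hX hgen hj hn hT).mul hinv.meromorphicAt
  obtain ⟨ρ, hρ⟩ := hself.exists_hasResidue
  refine ⟨ρ, hρ, ?_⟩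
  have key := (((HasResidue.of_analyticAt (h3.mul hinv)).add
    (hasResidue_channel hX hgen hj hn h1)).add (hasResidue_channel hX hgen hj hn h2)).add hρ
  convert key using 1
  · funext z
    rw [integrand_decompose hX T hj hn z]
    simp only [Pi.mul_apply]
    ring
  · rw [factorFirst_eq hX hgen hj hn, factorLast_eq hX hgen hj hn]
    ring

end Channel

end ShiftData

/-- Nonnegative order means agreement with an analytic function near the point, and `1 / z` is
analytic there as `w ≠ 0`. -/
theorem HasResidue.eq_zero_of_order_nonneg {f : ℂ → ℂ} {w c : ℂ} (hw : w ≠ 0)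
    (h : HasResidue (fun z => f z / z) w c) (hf : MeromorphicAt f w)
    (ho : 0 ≤ meromorphicOrderAt f w) : c = 0 := by
  obtain ⟨g, hg, he⟩ := hf.meromorphicOrderAt_nonneg_iff.1 ho
  refine h.unique ((HasResidue.of_analyticAt (hg.div analyticAt_id hw)).congr ?_)
  filter_upwards [he] with z hz
  simp [hz]

end ChannelPoles

/-! ### Collecting the residues -/

theorem mainTheorem3 {d : ℕ} {F S : Type*} [Fintype F] [DecidableEq F] [Fintype S]
    (T : PlanarTheory d F S) (X : ShiftData d F) (hX : X.OnShell) (hgen : X.Generic)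
    (hT : T.PolynomialAlong X.q) :
    ∃ (B : ℂ) (ρ : ℕ → ℂ),
      HasBoundaryTerm (fun z => X.integrand T z / z) B ∧
      (∀ j ∈ Finset.Icc 2 (X.n - 2),
        HasResidue (fun z => X.selfEnergy T j z / z) (X.zI j) (ρ j)) ∧
      ((∀ j ∈ Finset.Icc 2 (X.n - 2), 0 ≤ meromorphicOrderAt (X.selfEnergy T j) (X.zI j)) →
        X.integrand T 0 = X.factorisation T + X.forwardLimit T + B) ∧
      X.integrand T 0 = X.factorisation T + X.forwardLimit T + B
        - ∑ j ∈ Finset.Icc 2 (X.n - 2), ρ j := by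
  have hJ : ∀ {j}, j ∈ Finset.Icc 2 (X.n - 2) ↔ 2 ≤ j ∧ j + 2 ≤ X.n := by
    intro j
    rw [Finset.mem_Icc]
    omega
  -- The membership condition sits inside the existential so that `choose` yields a total function
  -- `ρ`.
  have hres : ∀ j, ∃ ρ, j ∈ Finset.Icc 2 (X.n - 2) →
      HasResidue (fun z => X.selfEnergy T j z / z) (X.zI j) ρ ∧
      HasResidue (fun z => X.integrand T z / z) (X.zI j)
        (ρ - (X.factorFirst T j + X.factorLast T j)) := by
    intro j
    by_cases hj : j ∈ Finset.Icc 2 (X.n - 2)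
    · obtain ⟨ρ, h⟩ := ShiftData.exists_hasResidue_selfEnergy hX hgen (hJ.1 hj).1 (hJ.1 hj).2 hT
      exact ⟨ρ, fun _ => h⟩
    · exact ⟨0, fun h => absurd h hj⟩
  choose ρ hρ using hres
  set P : Finset ℂ := (Finset.Icc 2 (X.n - 2)).image X.zI with hP
  obtain ⟨r, hr, hB⟩ := exists_residues (insert 0 (insert X.alpha P))
    (fun z => X.integrand T z / z)
    (fun z hz => by
      simp only [hP, Finset.mem_insert, Finset.mem_image, not_or, not_exists, not_and] at hz
      exact (ShiftData.integrand_analyticAt hX hgen hT hz.2.1 fun j hj hn h =>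
        hz.2.2 j (hJ.2 ⟨hj, hn⟩) h.symm).div analyticAt_id hz.1)
    fun z _ => (ShiftData.integrand_meromorphicAt hX hT z).div (MeromorphicAt.id z)
  have hα : X.alpha ∉ P := by
    simp only [hP, Finset.mem_image, not_exists, not_and]
    exact fun j hj => hgen.zI_ne_alpha j (hJ.1 hj).1 (hJ.1 hj).2
  have h0 : (0 : ℂ) ∉ insert X.alpha P := by
    simp only [hP, Finset.mem_insert, Finset.mem_image, not_or, not_exists, not_and]
    exact ⟨hgen.alpha_ne.symm, fun j hj => ShiftData.zI_ne_zero hgen (hJ.1 hj).1 (hJ.1 hj).2⟩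
  -- Distinct channels have distinct poles, so the sum over poles is a sum over `j`.
  have hinj : Set.InjOn X.zI (Finset.Icc 2 (X.n - 2) : Finset ℕ) := by
    intro i hi j hj hij
    rcases Nat.lt_trichotomy i j with h | h | h
    · exact absurd hij (hgen.zI_injective i j (hJ.1 hi).1 h (hJ.1 hj).2)
    · exact h
    · exact absurd hij.symm (hgen.zI_injective j i (hJ.1 hj).1 h (hJ.1 hi).2)
  -- The residues from the residue theorem are identified with the computed ones by uniqueness.
  have e0 : r 0 = X.integrand T 0 :=
    (hr 0 (by simp)).unique (ShiftData.hasResidue_zero hX hgen hT)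
  have eα : r X.alpha = -X.forwardLimit T :=
    (hr _ (by simp)).unique (ShiftData.hasResidue_alpha hX hgen hT)
  have ej : ∀ j ∈ Finset.Icc 2 (X.n - 2),
      r (X.zI j) = ρ j - (X.factorFirst T j + X.factorLast T j) := fun j hj =>
    (hr _ (Finset.mem_insert_of_mem (Finset.mem_insert_of_mem
      (Finset.mem_image_of_mem _ hj)))).unique (hρ j hj).2
  have hsum : ∑ s ∈ insert 0 (insert X.alpha P), r s = X.integrand T 0 - X.forwardLimit T +
      (∑ j ∈ Finset.Icc 2 (X.n - 2), ρ j - X.factorisation T) := by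
    rw [Finset.sum_insert h0, Finset.sum_insert hα, hP, Finset.sum_image hinj,
      Finset.sum_congr rfl ej, Finset.sum_sub_distrib, e0, eα, ShiftData.factorisation]
    ring
  have hmain : X.integrand T 0 = X.factorisation T + X.forwardLimit T +
      ∑ s ∈ insert 0 (insert X.alpha P), r s - ∑ j ∈ Finset.Icc 2 (X.n - 2), ρ j := by
    rw [hsum]
    ring
  refine ⟨_, ρ, hB, fun j hj => (hρ j hj).1, fun hord => ?_, hmain⟩
  have hz : ∑ j ∈ Finset.Icc 2 (X.n - 2), ρ j = 0 := Finset.sum_eq_zero fun j hj =>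
    (hρ j hj).1.eq_zero_of_order_nonneg (ShiftData.zI_ne_zero hgen (hJ.1 hj).1 (hJ.1 hj).2)
      (ShiftData.selfEnergy_meromorphicAt hX hgen (hJ.1 hj).1 (hJ.1 hj).2 hT) (hord j hj)
  rw [hz, sub_zero] at hmain
  exact hmain
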